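/- **Theorem (joint eigenvalue–eigenvector density of the interpolating Ginibre ensemble).** Let $N\ge 1$, let $G_1,G_2$ be independent real $N\times N$ matrices with i.i.d. standard real normal entries, and let $$G_\tau=\sqrt{\tfrac{1+\tau}{2}}\,G_1+i\sqrt{\tfrac{1-\tau}{2}}\,G_2,\qquad 0\le\tau\le 1 .$$ For $\theta\in[0,2\pi)$ let $(z_a,\mathbf v_a(\theta))$ be the pairs of an eigenvalue of $G_\tau$ and an associated right eigenvector with $\mathbf v_a(\theta)^*\mathbf v_a(\theta)=1$ and first entry $v_{1a}=|v_{1a}|e^{i\theta}$ (it is standard that, almost surely, the eigenvalues are distinct and there is exactly one such pair per eigenvalue). Let the joint law of an eigenvalue and its normalized right eigenvector be the probability measure $$\frac1N\,\mathbb E\int_0^{2\pi}\sum_{a}\delta_{(z_a,\mathbf v_a(\theta))}\,\frac{d\theta}{2\pi}$$ on $\mathbb C\times\mathbf S$, where $\mathbf S=\{\mathbf v\in\mathbb C^N:\mathbf v^*\mathbf v=1\}$, and let $\mu_H$ be the unitarily invariant probability measure on $\mathbf S$. If $0\le\tau<1$, this law has, with respect to $d^2z\,d\mu_H(\mathbf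 v)$, the (nonnegative) density $$\mathcal P^{(\tau)}_N(z,\mathbf v)=\frac{1}{\pi N\,\Gamma(N)}\frac{1}{D^{N/2}}\,e^{-\frac{1-D}{2\tau D}\left(2\tau|z|^2-z^2-\overline z^2\right)}\Big\{\tfrac{1-\tau^2}{D}\,\Gamma(N,|z|^2)+\Gamma(N-1,|z|^2)\Big(1-\tfrac{1-\tau^2}{D}\Big)\Big[|z|^2-\tfrac1\tau(z^2+\overline z^2)+\tfrac{|z|^2}{\tau^2}\Big(1-\tfrac{1-\tau^2}{D}\Big)\Big]\Big\},$$ where $D=1-\tau^2|\mathbf v^T\mathbf v|^2$ and $\Gamma(s,a)=\int_a^\infty t^{s-1}e^{-t}\,dt$, with $\Gamma(N,a)=\Gamma(N)e^{-a}\sum_{n=0}^{N-1}\frac{a^n}{n!}$ for $a\ge0$. At $\tau=0$ the right-hand side is read as its limit $\frac{1}{\pi N\,\Gamma(N)}\Gamma(N,|z|^2)$; for $N=1$ the term containing $\Gamma(N-1,|z|^2)$ is absent, since its factor $1-\frac{1-\tau^2}{D}$ is zero. If $\tau=1$ and $N\ge 2$, the same formula gives the density of the restriction of this law to $\{(z,\mathbf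 v):\operatorname{Im} z\ne0\}$ (here $D>0$ for $\mu_H$-almost every $\mathbf v$). -/

import Mathlib

open MeasureTheory ProbabilityTheory
open scoped ENNReal

noncomputable section

namespace Ginibre

/-- The complex unit sphere `{v ∈ ℂ^N : v^* v = 1}`. -/
abbrev CSphere (N : ℕ) : Type := Metric.sphere (0 : EuclideanSpace ℂ (Fin N)) 1

/-- The unitarily invariant probability measure `μ_H` on the complex unit sphere: the surface
measure induced by Lebesgue measure on `ℂ^N`, divided by its total mass. -/
def sphereMeasure (N : ℕ) : Measure (CSphere N) :=
  ((volume : Measure (EuclideanSpace ℂ (Fin N))).toSphere Set.univ)⁻¹ •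
    (volume : Measure (EuclideanSpace ℂ (Fin N))).toSphere

/-- The law of a real Ginibre matrix: independent standard real normal entries. -/
def realGinibre (N : ℕ) : Measure (Fin N → Fin N → ℝ) :=
  Measure.pi fun _ => Measure.pi fun _ => gaussianReal 0 1

/-- `G_τ = √((1+τ)/2) G₁ + i √((1-τ)/2) G₂`. -/
def interpolating {N : ℕ} (τ : ℝ) (G₁ G₂ : Fin N → Fin N → ℝ) : Matrix (Fin N) (Fin N) ℂ :=
  Matrix.of fun j k =>
    ((√((1 + τ) / 2) * G₁ j k : ℝ) : ℂ) + Complex.I * ((√((1 - τ) / 2) * G₂ j k : ℝ) : ℂ)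

/-- The pairs of an eigenvalue `z` of `X` and a right eigenvector `v` of `X` for `z`, normalized by
`v^* v = 1`, whose first entry has phase `θ`, i.e. `v₁ = |v₁| e^{iθ}`. -/
def eigenpairs {N : ℕ} [NeZero N] (X : Matrix (Fin N) (Fin N) ℂ) (θ : ℝ) :
    Set (ℂ × CSphere N) :=
  {p | X.mulVec p.2.1.ofLp = p.1 • p.2.1.ofLp ∧
    p.2.1.ofLp 0 = (‖p.2.1.ofLp 0‖ : ℂ) * Complex.exp (Complex.I * θ)}

/-- The joint empirical measure `∑ₐ δ_{(zₐ, vₐ(θ))}` of eigenvalues and right eigenvectors with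
first entries of phase `θ`. -/
def empirical {N : ℕ} [NeZero N] (X : Matrix (Fin N) (Fin N) ℂ) (θ : ℝ) :
    Measure (ℂ × CSphere N) :=
  Measure.sum fun p : eigenpairs X θ => Measure.dirac p.1

/-- The uniform probability measure on `[0, 2π)`. -/
def uniformPhase : Measure ℝ :=
  (ENNReal.ofReal (2 * Real.pi))⁻¹ • volume.restrict (Set.Ico 0 (2 * Real.pi))

/-- The joint probability law of an eigenvalue of `G_τ` and the associated normalized right
eigenvector: `1/N` times the expectation, over `G₁`, `G₂` and the uniform phase `θ`, of the joint
empirical measure. -/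
def eigenLaw (N : ℕ) [NeZero N] (τ : ℝ) : Measure (ℂ × CSphere N) :=
  (N : ℝ≥0∞)⁻¹ •
    (((realGinibre N).prod (realGinibre N)).prod uniformPhase).bind
      fun ω => empirical (interpolating τ ω.1.1 ω.1.2) ω.2

/-- The incomplete Gamma function `Γ(s, a) = ∫_a^∞ t^{s-1} e^{-t} dt`. -/
def upperGamma (s a : ℝ) : ℝ :=
  ∫ t in Set.Ioi a, t ^ (s - 1) * Real.exp (-t)

/-- `D = 1 - τ² |vᵀ v|²`. -/
def D {N : ℕ} (τ : ℝ) (v : CSphere N) : ℝ :=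
  1 - τ ^ 2 * ‖∑ i, v.1.ofLp i ^ 2‖ ^ 2

/-- The joint probability density of an eigenvalue and the normalized right eigenvector.
At `τ = 0` the factors multiplying `1/τ` vanish identically; Lean's value there agrees with the
limit `τ → 0`, see `density_zero`. -/
def density (N : ℕ) (τ : ℝ) (z : ℂ) (v : CSphere N) : ℝ :=
  1 / (Real.pi * N * Real.Gamma N) * (1 / D τ v ^ ((N : ℝ) / 2)) *
    Real.exp (-((1 - D τ v) / (2 * τ * D τ v)) *
      (2 * τ * ‖z‖ ^ 2 - (z ^ 2 + starRingEnd ℂ z ^ 2).re)) *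
    ((1 - τ ^ 2) / D τ v * upperGamma N (‖z‖ ^ 2) +
      upperGamma (N - 1) (‖z‖ ^ 2) * (1 - (1 - τ ^ 2) / D τ v) *
        ((‖z‖ ^ 2 - 1 / τ * (z ^ 2 + starRingEnd ℂ z ^ 2).re) +
          ‖z‖ ^ 2 / τ ^ 2 * (1 - (1 - τ ^ 2) / D τ v)))

theorem density_zero (N : ℕ) (z : ℂ) (v : CSphere N) :
    density N 0 z v = 1 / (Real.pi * N * Real.Gamma N) * upperGamma N (‖z‖ ^ 2) := by
  simp [density, D]

end Ginibre

end

/-!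
Let `N = n + 1`. For `τ < 1` the entries of the random matrix have a Gaussian density on `ℂ`
(`measurePreserving_interpolating`). An eigenvector whose first entry does not vanish is a multiple
of `w = (1, u)`, and for given columns `B` other than the first, the eigenvalue equation `G w = z w`
determines the first column as a polynomial map of `(z, u)`. The solutions `(z, u)` are in bijection
with the eigenpairs (`lintegral_empirical_eq_tsum`), so that the area formula with multiplicity
(`lintegral_tsum_fiber_eq_lintegral_abs_det_fderiv_mul`) turns the expectation of a sum over
eigenpairs into an integral over `(z, u)` and `B` of the Gaussian weight times the squared modulus of
a complex Jacobian (`lintegral_rowWeight_mul_empirical`).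

The rows of `G` are independent. For each of them, conditioning on the value of `g ⬝ w` splits the
Gaussian weight into a function of this value and a Gaussian weight of fluctuations
(`rowWeight_regMean_add`), and the Jacobian becomes a determinant of a matrix with independent
rows, of mean `M` and with a common covariance `K` (`det_jacobianMatrix_rowSplit`). The second moment
of such a determinant is `∫₀^∞ e^{-t} det (t K + Mᵀ M̄) dt` (`sum_perm_sum_perm_eq_integral_det`). Here
`t K + Mᵀ M̄` is a perturbation of `t + |z|²` of rank two, living on the span of `w` and its conjugate
(`det_condCov_add_meanMatrix`), and the Laplace transform gives the incomplete Gamma functions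
(`integral_exp_neg_mul_add_pow`, `integral_exp_neg_mul_det`). In the coordinates `u` the invariant
measure of the sphere has a density proportional to `|w|^{-2N}` (`lintegral_sphereMeasure`), and
the result is the stated density (`density_eq_meanJacobian`, `eigenLaw_eq_withDensity`).

Almost every matrix has simple spectrum and eigenvectors with nonvanishing first entry
(`ae_isGeneric`). On such matrices the empirical measure of the eigenpairs is weakly continuous
(`continuous_lintegral_empirical`), by compactness of the set of enumerations of eigenpairs. This
gives the measurability that the definition of the law requires, and the weak continuity of the law
in `τ` (`tendsto_lintegral_eigenLaw`).

For `τ = 1` the law is the weak limit of the laws for `τ < 1`. On the open set where `D > 0` the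
densities converge and are bounded on compact sets, so that dominated convergence applies
(`tendsto_lintegral_density`), and the law has the limiting density there off the real axis. Where
`D = 0` an eigenvector is proportional to its conjugate, so that the eigenvalue of the real matrix
is real (`im_eq_zero_of_D_one_eq_zero`), while the set `D = 0` is null for the invariant measure
(`sphereMeasure_D_one_eq_zero`). Off the real axis the limiting density is thus the whole law.

Nonnegativity of the density follows by completing squares and from `a Γ(k, a) ≤ Γ(k + 1, a)`
(`density_nonneg`), and the finite sum for `Γ(N, a)` from an explicit antiderivative
(`upperGamma_natCast_succ`).
-/

noncomputable section

namespace Ginibre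

/-! ### Second moments of determinants with independent rows -/

section MixedDiscriminant

variable {ι : Type*} [Fintype ι] [DecidableEq ι]

/-- The determinant of the matrix whose column `c` is the column `c` of `K` if `f c = none`, and
the column `c` of the rank one matrix `m r (m' r)ᵀ` if `f c = some r`. The matrix is written
transposed, since multilinearity of the determinant is stated for rows. -/
def partialDet (K : Matrix ι ι ℂ) (m m' : ι → ι → ℂ) (f : ι → Option ι) : ℂ :=
  Matrix.det (Matrix.of fun c i => (f c).elim (K i c) (fun r => m' r c * m r i))

/-- Two columns from the same rank one matrix are proportional. -/
theorem partialDet_eq_zero (K : Matrix ι ι ℂ) (m m' : ι → ι → ℂ) (f : ι → Option ι)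
    {c d r : ι} (hcd : c ≠ d) (hc : f c = some r) (hd : f d = some r) :
    partialDet K m m' f = 0 := by
  unfold partialDet
  by_cases h : m' r d = 0
  · refine Matrix.det_eq_zero_of_row_eq_zero d fun i => ?_
    simp [hd, h]
  · have key := Matrix.det_updateRow_add_smul_self
      (Matrix.of fun c i => (f c).elim (K i c) (fun r => m' r c * m r i)) hcd (-(m' r c / m' r d))
    rw [← key]
    refine Matrix.det_eq_zero_of_row_eq_zero c fun i => ?_
    simp only [Matrix.updateRow_self, Pi.add_apply, Pi.smul_apply, Matrix.of_apply, hc, hd,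
      Option.elim_some, smul_eq_mul]
    field_simp
    ring

/-- Reindexing the pair of permutations by their quotient turns the sum into determinants of
matrices whose columns are taken from the `S r`, one from each. -/
theorem sum_perm_sum_perm_eq_sum_det (S : ι → Matrix ι ι ℂ) :
    ∑ σ : Equiv.Perm ι, ∑ σ' : Equiv.Perm ι,
      ((Equiv.Perm.sign σ : ℤ) : ℂ) * ((Equiv.Perm.sign σ' : ℤ) : ℂ) *
        ∏ r, S r (σ r) (σ' r) =
    ∑ π : Equiv.Perm ι, Matrix.det (Matrix.of fun i c => S (π c) i c) := by
  simp_rw [Matrix.det_apply']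
  rw [Finset.sum_comm, ← Equiv.sum_comp (Equiv.inv (Equiv.Perm ι))]
  refine Finset.sum_congr rfl fun π _ => ?_
  rw [← Equiv.sum_comp (Equiv.mulRight π⁻¹)]
  refine Finset.sum_congr rfl fun ρ _ => ?_
  have h1 : ((Equiv.Perm.sign π : ℤ) : ℂ) * ((Equiv.Perm.sign π : ℤ) : ℂ) = 1 := by
    rw [← Int.cast_mul, ← Units.val_mul, Int.units_mul_self]; simp
  have h2 : ∀ i, π⁻¹ (π i) = i := π.symm_apply_apply
  rw [← Equiv.prod_comp π]
  simp only [Equiv.inv_apply, Equiv.coe_mulRight, Equiv.Perm.mul_apply, h2,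
    Matrix.of_apply, Equiv.Perm.sign_mul, Equiv.Perm.sign_inv, Units.val_mul, Int.cast_mul]
  rw [mul_assoc ((Equiv.Perm.sign ρ : ℤ) : ℂ), h1, mul_one]

theorem det_add_eq_sum_partialDet (K : Matrix ι ι ℂ) (m m' : ι → ι → ℂ) (π : Equiv.Perm ι) :
    Matrix.det (Matrix.of fun i c => K i c + m (π c) i * m' (π c) c) =
      ∑ T : Finset ι, partialDet K m m' (fun c => if c ∈ T then none else some (π c)) := by
  rw [← Matrix.det_transpose]
  have := (Matrix.detRowAlternating (n := ι) (R := ℂ)).toMultilinearMap.map_add_univ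
    (fun c i => K i c) (fun c i => m' (π c) c * m (π c) i)
  convert this using 1
  · change Matrix.det _ = Matrix.det _
    congr 1
    ext c i
    simp [mul_comm]
  · refine Finset.sum_congr rfl fun T _ => ?_
    change Matrix.det _ = Matrix.det _
    congr 1
    ext c i
    by_cases h : c ∈ T <;> simp [Finset.piecewise, h]

theorem det_smul_add_sum_eq_sum_partialDet (K : Matrix ι ι ℂ) (m m' : ι → ι → ℂ) (t : ℂ) :
    Matrix.det (Matrix.of fun i c => t * K i c + ∑ r, m r i * m' r c) =
      ∑ f : ι → Option ι, t ^ Fintype.card {c // f c = none} * partialDet K m m' f := by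
  rw [← Matrix.det_transpose]
  have := (Matrix.detRowAlternating (n := ι) (R := ℂ)).toMultilinearMap.map_sum
    (fun (c : ι) (o : Option ι) => (o.elim (fun i => t * K i c) (fun r i => m' r c * m r i) : ι → ℂ))
  convert this using 1
  · change Matrix.det _ = Matrix.det _
    congr 1
    ext c i
    simp [Fintype.sum_option, mul_comm]
  · refine Finset.sum_congr rfl fun f _ => ?_
    have h2 := (Matrix.detRowAlternating (n := ι) (R := ℂ)).toMultilinearMap.map_smul_univ
      (fun c => if f c = none then t else 1)
      (fun c i => (f c).elim (K i c) (fun r => m' r c * m r i))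
    have h3 : ∏ c, (if f c = none then t else 1) = t ^ Fintype.card {c // f c = none} := by
      rw [Finset.prod_ite]
      simp [Fintype.card_subtype]
    rw [h3] at h2
    change _ = _ • Matrix.det _ at h2
    unfold partialDet
    rw [smul_eq_mul] at h2
    refine h2.symm.trans ?_
    congr 1
    ext c i
    cases f c <;> simp

/-- The number of pairs of a permutation and a set of columns which induce a given partial
injection, undefined at `k` places, is `k!`: permutations extending it form a coset of the group
of permutations fixing its domain. -/
theorem card_perm_finset_eq (f : ι → Option ι)
    (hf : ∀ c d r, f c = some r → f d = some r → c = d) :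
    (Finset.univ.filter fun p : Equiv.Perm ι × Finset ι =>
      (fun c => if c ∈ p.2 then none else some (p.1 c)) = f).card =
      (Fintype.card {c // f c = none}).factorial := by
  classical
  -- a permutation `π₀` extending the partial injection `f`
  obtain ⟨π₀, h0⟩ : ∃ π₀ : Equiv.Perm ι, ∀ c r, f c = some r → π₀ c = r := by
    obtain ⟨g, hg⟩ := Finset.exists_equiv_extend_of_card_eq (α := ι) (β := ι)
      (t := Finset.univ) (by simp) (s := Finset.univ.filter fun c => (f c).isSome)
      (f := fun c => (f c).getD c) (by simp) (by
        intro c hc d hd hcd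
        simp only [Finset.coe_filter, Finset.mem_univ, true_and, Set.mem_ofPred_eq,
          Option.isSome_iff_exists] at hc hd
        obtain ⟨r, hr⟩ := hc
        obtain ⟨r', hr'⟩ := hd
        simp only [hr, hr', Option.getD_some] at hcd
        subst hcd
        exact hf c d r hr hr')
    refine ⟨g.trans (Equiv.subtypeUnivEquiv (by simp)), fun c r hc => ?_⟩
    have := hg c (by simp [hc])
    simpa [hc] using this
  -- all other pairs differ from `π₀` by a permutation of the set where `f` is undefined, and this
  -- set is the set of columns of the pair
  rw [← Fintype.card_perm, ← Fintype.card_congr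
    (Equiv.Perm.subtypeEquivSubtypePerm (fun c => f c = none)).symm, ← Fintype.card_coe]
  refine Fintype.card_congr
    { toFun := fun p => ⟨π₀⁻¹ * p.1.1, ?_⟩
      invFun := fun g => ⟨(π₀ * g.1, Finset.univ.filter fun c => f c = none), ?_⟩
      left_inv := ?_
      right_inv := ?_ }
  · intro c hc
    have hp := congrFun (Finset.mem_filter.1 p.2).2 c
    change (if c ∈ p.1.2 then none else some (p.1.1 c)) = f c at hp
    split_ifs at hp with h
    · exact absurd hp.symm hc
    · rw [Equiv.Perm.mul_apply, ← h0 c _ hp.symm]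
      exact π₀.symm_apply_apply c
  · simp only [Finset.mem_filter, Finset.mem_univ, true_and]
    ext1 c
    by_cases hc : f c = none
    · simp [hc]
    · obtain ⟨r, hr⟩ := Option.ne_none_iff_exists'.1 hc
      simp [hr, g.2 c hc, h0 c r hr]
  · rintro ⟨⟨π, T⟩, hp⟩
    have hp' := (Finset.mem_filter.1 hp).2
    refine Subtype.ext (Prod.ext (mul_inv_cancel_left π₀ π) ?_)
    ext c
    simp [← hp']
  · rintro ⟨g, hg⟩
    simp

/-- The expansion of a sum over pairs of permutations, which is the second moment of a determinant
with independent rows, in determinants of partial type. -/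
theorem sum_perm_sum_perm_eq_sum_partialDet (K : Matrix ι ι ℂ) (m m' : ι → ι → ℂ) :
    ∑ σ : Equiv.Perm ι, ∑ σ' : Equiv.Perm ι,
      ((Equiv.Perm.sign σ : ℤ) : ℂ) * ((Equiv.Perm.sign σ' : ℤ) : ℂ) *
        ∏ r, (K (σ r) (σ' r) + m r (σ r) * m' r (σ' r)) =
    ∑ f : ι → Option ι,
      ((Fintype.card {c // f c = none}).factorial : ℂ) * partialDet K m m' f := by
  classical
  refine (sum_perm_sum_perm_eq_sum_det (fun r i c => K i c + m r i * m' r c)).trans ?_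
  simp_rw [det_add_eq_sum_partialDet]
  rw [← Finset.sum_product', Finset.univ_product_univ,
    ← Finset.sum_fiberwise Finset.univ (fun p : Equiv.Perm ι × Finset ι =>
      (fun c => if c ∈ p.2 then none else some (p.1 c) : ι → Option ι))]
  refine Finset.sum_congr rfl fun f _ => ?_
  rw [Finset.sum_congr rfl (g := fun _ => partialDet K m m' f)
    (fun p hp => by rw [← (Finset.mem_filter.1 hp).2]), Finset.sum_const, nsmul_eq_mul]
  -- if `f` repeats a row, two columns are proportional and the number of pairs is irrelevant
  by_cases hf : ∀ c d r, f c = some r → f d = some r → c = d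
  · rw [← card_perm_finset_eq f hf]
  · push Not at hf
    obtain ⟨c, d, r, hc, hd, hcd⟩ := hf
    rw [partialDet_eq_zero K m m' f hcd hc hd, mul_zero, mul_zero]

theorem integrableOn_exp_neg_mul_pow (k : ℕ) :
    IntegrableOn (fun t : ℝ => Real.exp (-t) * t ^ k) (Set.Ioi 0) := by
  have := Real.GammaIntegral_convergent (s := k + 1) (by positivity)
  refine this.congr_fun (fun t _ => ?_) measurableSet_Ioi
  simp

theorem integral_exp_neg_mul_pow (k : ℕ) :
    ∫ t in Set.Ioi (0 : ℝ), Real.exp (-t) * t ^ k = k.factorial := by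
  rw [← Real.Gamma_nat_eq_factorial, Real.Gamma_eq_integral (by positivity)]
  refine setIntegral_congr_fun measurableSet_Ioi fun t _ => ?_
  simp

/-- A second moment of a determinant with independent rows of covariance `K` and means `m r`
as a Laplace transform of ordinary determinants: the factor `k!` counting the placements of the `k`
fluctuating columns is `∫₀^∞ t ^ k e^{-t} dt`. -/
theorem sum_perm_sum_perm_eq_integral_det (K : Matrix ι ι ℂ) (m m' : ι → ι → ℂ) :
    ∑ σ : Equiv.Perm ι, ∑ σ' : Equiv.Perm ι,
      ((Equiv.Perm.sign σ : ℤ) : ℂ) * ((Equiv.Perm.sign σ' : ℤ) : ℂ) *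
        ∏ r, (K (σ r) (σ' r) + m r (σ r) * m' r (σ' r)) =
    ∫ t in Set.Ioi (0 : ℝ), (Real.exp (-t) : ℂ) *
      Matrix.det (Matrix.of fun i c => (t : ℂ) * K i c + ∑ r, m r i * m' r c) := by
  have hint : ∀ f : ι → Option ι, IntegrableOn (fun t : ℝ =>
      (Real.exp (-t) : ℂ) * ((t : ℂ) ^ Fintype.card {c // f c = none} * partialDet K m m' f))
      (Set.Ioi 0) := by
    intro f
    have := ((integrableOn_exp_neg_mul_pow (Fintype.card {c // f c = none})).ofReal
      (𝕜 := ℂ)).mul_const (partialDet K m m' f)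
    refine this.congr (ae_of_all _ fun t => ?_)
    simp [mul_assoc]
  simp_rw [det_smul_add_sum_eq_sum_partialDet, Finset.mul_sum]
  rw [integral_finsetSum _ fun f _ => hint f, sum_perm_sum_perm_eq_sum_partialDet]
  refine Finset.sum_congr rfl fun f _ => ?_
  simp_rw [← mul_assoc]
  rw [integral_mul_const]
  congr 1
  have := congrArg (fun x : ℝ => (x : ℂ)) (integral_exp_neg_mul_pow (Fintype.card {c // f c = none}))
  simp only [Complex.ofReal_natCast, ← integral_complex_ofReal] at this
  rw [← this]
  simp

end MixedDiscriminant

/-! ### The area formula with multiplicity -/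

section AreaFormula

open scoped NNReal Function

variable {E : Type*} [NormedAddCommGroup E] [NormedSpace ℝ E] [FiniteDimensional ℝ E]

/-- A differentiable map is injective on each piece of a countable measurable partition of its
regular points, because on each piece it is well approximated by an invertible linear map. -/
theorem exists_partition_injOn_of_det_fderiv_ne_zero [MeasurableSpace E] [BorelSpace E]
    {f : E → E} {f' : E → E →L[ℝ] E} {s : Set E} (hf' : ∀ x ∈ s, HasFDerivAt f (f' x) x)
    (hdet : ∀ x ∈ s, (f' x).det ≠ 0) :
    ∃ t : ℕ → Set E, Pairwise (Disjoint on t) ∧ (∀ n, MeasurableSet (t n)) ∧ s ⊆ ⋃ n, t n ∧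
      ∀ n, Set.InjOn f (s ∩ t n) := by
  classical
  -- a radius of approximation that forces injectivity, for each invertible linear map
  have hr : ∀ A : E →L[ℝ] E, ∃ r : ℝ≥0, r ≠ 0 ∧
      ∀ B : E ≃L[ℝ] E, (B : E →L[ℝ] E) = A →
        Subsingleton E ∨ r < ‖(B.symm : E →L[ℝ] E)‖₊⁻¹ := by
    intro A
    by_cases hA : ∃ B : E ≃L[ℝ] E, (B : E →L[ℝ] E) = A
    · obtain ⟨B, hB⟩ := hA
      rcases subsingleton_or_nontrivial E with hE | hE
      · exact ⟨1, one_ne_zero, fun _ _ => Or.inl hE⟩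
      · refine ⟨‖(B.symm : E →L[ℝ] E)‖₊⁻¹ / 2, ?_, fun B' hB' => Or.inr ?_⟩
        · have := B.nnnorm_symm_pos
          positivity
        · have : B' = B := ContinuousLinearEquiv.coe_injective (hB'.trans hB.symm)
          rw [this]
          exact NNReal.half_lt_self (inv_ne_zero B.nnnorm_symm_pos.ne')
    · exact ⟨1, one_ne_zero, fun B hB => absurd ⟨B, hB⟩ hA⟩
  choose r hr0 hr1 using hr
  rcases s.eq_empty_or_nonempty with rfl | hs
  · exact ⟨fun _ => ∅, fun _ _ _ => by simp, by simp, by simp, by simp⟩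
  obtain ⟨t, A, htd, htm, hst, happ, hA⟩ :=
    exists_partition_approximatesLinearOn_of_hasFDerivWithinAt f s f'
      (fun x hx => (hf' x hx).hasFDerivWithinAt) r hr0
  refine ⟨t, htd, htm, hst, fun n => ?_⟩
  obtain ⟨y, hy, hAy⟩ := hA hs n
  have hd : (A n).det ≠ 0 := hAy ▸ hdet y hy
  have hB : (((A n).toContinuousLinearEquivOfDetNeZero hd : E ≃L[ℝ] E) : E →L[ℝ] E) = A n := by
    simp
  have happ' := happ n
  rw [← hB] at happ'
  exact happ'.injOn (by rw [hB]; exact hr1 (A n) _ hB)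

variable [MeasurableSpace E] [BorelSpace E] (μ : Measure E) [μ.IsAddHaarMeasure]

/-- The area formula for maps that need not be injective: points are counted with multiplicity. -/
theorem lintegral_tsum_fiber_eq_lintegral_abs_det_fderiv_mul {f : E → E} {f' : E → E →L[ℝ] E}
    (hf' : ∀ x, HasFDerivAt f (f' x) x) (hm : MeasurableSet {x | (f' x).det ≠ 0})
    {g : E → ℝ≥0∞} (hg : Measurable g) :
    ∫⁻ y, ∑' x : {x // f x = y}, g x.1 ∂μ = ∫⁻ x, ENNReal.ofReal |(f' x).det| * g x ∂μ := by
  classical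
  set R : Set E := {x | (f' x).det ≠ 0} with hR
  obtain ⟨t, htd, htm, hst, hinj⟩ := exists_partition_injOn_of_det_fderiv_ne_zero
    (fun x (_ : x ∈ R) => hf' x) (fun x hx => hx)
  have hsm : ∀ n, MeasurableSet (R ∩ t n) := fun n => hm.inter (htm n)
  have hfd : ∀ n, ∀ x ∈ R ∩ t n, HasFDerivWithinAt f (f' x) (R ∩ t n) x :=
    fun n x _ => (hf' x).hasFDerivWithinAt
  -- critical values form a null set, by Sard
  have hnull : μ (f '' Rᶜ) = 0 := addHaar_image_eq_zero_of_det_fderivWithin_eq_zero μ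
    (fun x _ => (hf' x).hasFDerivWithinAt) (fun x hx => by simpa [hR] using hx)
  have hcover : ∀ x ∈ R, ∃ n, x ∈ R ∩ t n := fun x hx => by
    obtain ⟨n, hn⟩ := Set.mem_iUnion.1 (hst hx)
    exact ⟨n, hx, hn⟩
  -- `G n` is `g` composed with the inverse of `f` on the `n`-th piece, extended by zero
  set G : ℕ → E → ℝ≥0∞ := fun n => (f '' (R ∩ t n)).indicator
    (fun y => g (Function.invFunOn f (R ∩ t n) y)) with hG
  have hGapp : ∀ n, ∀ x ∈ R ∩ t n, G n (f x) = g x := by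
    intro n x hx
    have hfx : f x ∈ f '' (R ∩ t n) := ⟨x, hx, rfl⟩
    simp only [hG, Set.indicator_of_mem hfx]
    congr 1
    exact (hinj n) (Function.invFunOn_mem hfx) hx (Function.invFunOn_eq hfx)
  have hGm : ∀ n, Measurable (G n) := by
    intro n
    have he := measurableEmbedding_of_fderivWithin (hsm n) (hfd n) (hinj n)
    have : G n = Function.extend ((R ∩ t n).domRestrict f) (fun x => g x.1) 0 := by
      funext y
      by_cases hy : ∃ x, (R ∩ t n).domRestrict f x = y
      · obtain ⟨x, rfl⟩ := hy
        rw [he.injective.extend_apply]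
        exact hGapp n x.1 x.2
      · rw [Function.extend_apply' _ _ _ hy]
        simp only [hG]
        rw [Set.indicator_of_notMem]
        · rfl
        · rintro ⟨x, hx, hxy⟩
          exact hy ⟨⟨x, hx⟩, hxy⟩
    rw [this]
    exact he.measurable_extend (hg.comp measurable_subtype_coe) measurable_zero
  -- over a regular value the fibre meets each piece at most once
  have hfib : ∀ y, y ∉ f '' Rᶜ → ∑' x : {x // f x = y}, g x.1 = ∑' n, G n y := by
    intro y hy
    have hRy : ∀ x, f x = y → x ∈ R := fun x hx => by
      by_contra h
      exact hy ⟨x, h, hx⟩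
    have h1 : ∀ x : {x // f x = y}, g x.1 = ∑' n, (R ∩ t n).indicator g x.1 := by
      rintro ⟨x, hx⟩
      obtain ⟨n, hn⟩ := hcover x (hRy x hx)
      rw [tsum_eq_single n, Set.indicator_of_mem hn]
      intro k hk
      refine Set.indicator_of_notMem (fun hxk => ?_) _
      exact Set.disjoint_left.1 (htd hk) hxk.2 hn.2
    simp_rw [h1]
    rw [ENNReal.tsum_comm]
    refine tsum_congr fun n => ?_
    by_cases hyn : y ∈ f '' (R ∩ t n)
    · obtain ⟨x, hx, rfl⟩ := hyn
      rw [hGapp n x hx, tsum_eq_single ⟨x, rfl⟩, Set.indicator_of_mem hx]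
      rintro ⟨x', hx'⟩ hne
      refine Set.indicator_of_notMem (fun hxn => hne ?_) _
      exact Subtype.ext (hinj n hxn hx hx')
    · simp only [hG, Set.indicator_of_notMem hyn]
      refine ENNReal.tsum_eq_zero.2 fun x => Set.indicator_of_notMem (fun hxn => hyn ?_) _
      exact ⟨x.1, hxn, x.2⟩
  have hRint : ∫⁻ x, ENNReal.ofReal |(f' x).det| * g x ∂μ =
      ∫⁻ x in R, ENNReal.ofReal |(f' x).det| * g x ∂μ := by
    rw [← lintegral_indicator hm]
    congr 1
    funext x
    by_cases hx : x ∈ R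
    · rw [Set.indicator_of_mem hx]
    · have : (f' x).det = 0 := by simpa [hR] using hx
      rw [Set.indicator_of_notMem hx, this]
      simp
  have hRU : R = ⋃ n, R ∩ t n := by
    rw [← Set.inter_iUnion, Set.inter_eq_left.2 hst]
  calc ∫⁻ y, ∑' x : {x // f x = y}, g x.1 ∂μ = ∫⁻ y, ∑' n, G n y ∂μ := by
        refine lintegral_congr_ae ?_
        have : ∀ᵐ y ∂μ, y ∉ f '' Rᶜ := measure_eq_zero_iff_ae_notMem.1 hnull
        filter_upwards [this] with y hy using hfib y hy
    _ = ∑' n, ∫⁻ y, G n y ∂μ := lintegral_tsum fun n => (hGm n).aemeasurable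
    _ = ∑' n, ∫⁻ x in R ∩ t n, ENNReal.ofReal |(f' x).det| * g x ∂μ := by
        refine tsum_congr fun n => ?_
        have himg : MeasurableSet (f '' (R ∩ t n)) :=
          measurable_image_of_fderivWithin (hsm n) (hfd n) (hinj n)
        rw [show ∫⁻ y, G n y ∂μ = ∫⁻ y in f '' (R ∩ t n), G n y ∂μ by
          rw [← lintegral_indicator himg]
          simp only [hG, Set.indicator_indicator, Set.inter_self]]
        rw [lintegral_image_eq_lintegral_abs_det_fderiv_mul μ (hsm n) (hfd n) (hinj n)]
        refine setLIntegral_congr_fun (hsm n) fun x hx => ?_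
        rw [hGapp n x hx]
    _ = ∫⁻ x in R, ENNReal.ofReal |(f' x).det| * g x ∂μ := by
        conv_rhs => rw [hRU]
        rw [lintegral_iUnion hsm]
        intro i j hij
        exact (htd hij).mono Set.inter_subset_right Set.inter_subset_right
    _ = _ := hRint.symm

end AreaFormula

/-! ### Incomplete Gamma functions of integer order -/

section UpperGamma

theorem hasDerivAt_exp_neg_mul_sum_pow (k : ℕ) (t : ℝ) :
    HasDerivAt (fun t : ℝ => -(Real.exp (-t) * ∑ j ∈ Finset.range (k + 1), t ^ j / (j.factorial : ℝ)))
      (Real.exp (-t) * (t ^ k / (k.factorial : ℝ))) t := by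
  have he : HasDerivAt (fun t : ℝ => Real.exp (-t)) (-Real.exp (-t)) t := by
    simpa using (hasDerivAt_neg t).exp
  induction k with
  | zero =>
    refine (he.neg.congr_deriv ?_).congr_of_eventuallyEq (.of_forall fun t => ?_) <;> simp
  | succ k ih =>
    have hp : HasDerivAt (fun t : ℝ => t ^ (k + 1) / ((k + 1).factorial : ℝ))
        (t ^ k / (k.factorial : ℝ)) t := by
      have := (hasDerivAt_pow (k + 1) t).div_const ((k + 1).factorial : ℝ)
      refine this.congr_deriv ?_
      rw [Nat.factorial_succ]
      push_cast
      have h1 : (k : ℝ) + 1 ≠ 0 := by positivity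
      have h2 : (k.factorial : ℝ) ≠ 0 := by positivity
      field_simp
    have := ih.sub (he.mul hp)
    refine (this.congr_deriv ?_).congr_of_eventuallyEq (.of_forall fun t => ?_)
    · ring
    · simp only [Finset.sum_range_succ _ (k + 1), Pi.sub_apply, Pi.mul_apply]
      ring

theorem integrableOn_exp_neg_mul_pow_Ioi (k : ℕ) {a : ℝ} (ha : 0 ≤ a) :
    IntegrableOn (fun t : ℝ => Real.exp (-t) * t ^ k) (Set.Ioi a) :=
  (integrableOn_exp_neg_mul_pow k).mono_set (Set.Ioi_subset_Ioi ha)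

theorem upperGamma_natCast_succ_eq_integral (k : ℕ) (a : ℝ) :
    upperGamma ((k : ℝ) + 1) a = ∫ t in Set.Ioi a, Real.exp (-t) * t ^ k := by
  unfold upperGamma
  refine integral_congr_ae (ae_of_all _ fun t => ?_)
  simp [mul_comm]

/-- The closed form of `Γ(k + 1, a)`, from the explicit antiderivative of `t ^ k e^{-t}`. -/
theorem upperGamma_natCast_succ (k : ℕ) {a : ℝ} (ha : 0 ≤ a) :
    upperGamma ((k : ℝ) + 1) a =
      k.factorial * (Real.exp (-a) * ∑ j ∈ Finset.range (k + 1), a ^ j / (j.factorial : ℝ)) := by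
  rw [upperGamma_natCast_succ_eq_integral]
  have hk : (k.factorial : ℝ) ≠ 0 := by positivity
  have hlim : Filter.Tendsto (fun t : ℝ =>
      -(Real.exp (-t) * ∑ j ∈ Finset.range (k + 1), t ^ j / (j.factorial : ℝ)))
      Filter.atTop (nhds 0) := by
    have : ∀ j : ℕ, Filter.Tendsto (fun t : ℝ => Real.exp (-t) * (t ^ j / (j.factorial : ℝ)))
        Filter.atTop (nhds 0) := fun j => by
      have := (Real.tendsto_pow_mul_exp_neg_atTop_nhds_zero j).div_const (j.factorial : ℝ)
      rw [zero_div] at this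
      exact this.congr fun t => by ring
    have h := (tendsto_finsetSum (Finset.range (k + 1)) fun j _ => this j).neg
    simp only [Finset.sum_const_zero, neg_zero, ← Finset.mul_sum] at h
    exact h
  have hint : IntegrableOn (fun t : ℝ => Real.exp (-t) * (t ^ k / (k.factorial : ℝ)))
      (Set.Ioi a) := by
    refine ((integrableOn_exp_neg_mul_pow_Ioi k ha).div_const (k.factorial : ℝ)).congr
      (ae_of_all _ fun t => ?_)
    simp only
    ring
  have := integral_Ioi_of_hasDerivAt_of_tendsto' (a := a)
    (fun t _ => hasDerivAt_exp_neg_mul_sum_pow k t) hint hlim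
  rw [zero_sub, neg_neg] at this
  rw [← this, ← integral_const_mul]
  congr 1
  funext t
  field_simp

theorem upperGamma_natCast_succ_nonneg (k : ℕ) {a : ℝ} (ha : 0 ≤ a) :
    0 ≤ upperGamma ((k : ℝ) + 1) a := by
  rw [upperGamma_natCast_succ k ha]
  positivity

theorem mul_upperGamma_le (k : ℕ) {a : ℝ} (ha : 0 ≤ a) :
    a * upperGamma ((k : ℝ) + 1) a ≤ upperGamma (((k + 1 : ℕ) : ℝ) + 1) a := by
  rw [upperGamma_natCast_succ_eq_integral, upperGamma_natCast_succ_eq_integral,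
    ← integral_const_mul]
  refine setIntegral_mono_on ((integrableOn_exp_neg_mul_pow_Ioi k ha).const_mul a)
    (integrableOn_exp_neg_mul_pow_Ioi (k + 1) ha) measurableSet_Ioi fun t ht => ?_
  have h0 : 0 ≤ Real.exp (-t) * t ^ k := by
    have : 0 ≤ t := ha.trans (le_of_lt ht)
    positivity
  have := mul_le_mul_of_nonneg_right (le_of_lt ht) h0
  calc a * (Real.exp (-t) * t ^ k) ≤ t * (Real.exp (-t) * t ^ k) := this
    _ = _ := by ring

/-- The Laplace transform to which the averaged determinant reduces. -/
theorem integral_exp_neg_mul_add_pow (k : ℕ) {r : ℝ} (hr : 0 ≤ r) (y κ : ℝ) :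
    ∫ t in Set.Ioi (0 : ℝ), Real.exp (-t) * ((t + r) ^ k * (t * κ + y)) =
      Real.exp r * (κ * upperGamma (((k + 1 : ℕ) : ℝ) + 1) r +
        (y - κ * r) * upperGamma ((k : ℝ) + 1) r) := by
  have h1 : ∀ t : ℝ, Real.exp (-t) * ((t + r) ^ k * (t * κ + y)) =
      (fun s => Real.exp r * (κ * (Real.exp (-s) * s ^ (k + 1)) +
        (y - κ * r) * (Real.exp (-s) * s ^ k))) (t + r) := fun t => by
    have : Real.exp (-t) = Real.exp r * Real.exp (-(t + r)) := by
      rw [← Real.exp_add]; ring_nf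
    simp only [this]
    ring
  simp_rw [h1]
  have h2 : ∀ f : ℝ → ℝ, ∫ t in Set.Ioi (0 : ℝ), f (t + r) = ∫ t in Set.Ioi r, f t := fun f => by
    rw [← integral_indicator measurableSet_Ioi, ← integral_indicator measurableSet_Ioi,
      ← integral_add_right_eq_self ((Set.Ioi r).indicator f) r]
    congr 1
    funext t
    simp [Set.indicator_apply]
  rw [h2 (fun s => Real.exp r * (κ * (Real.exp (-s) * s ^ (k + 1)) +
    (y - κ * r) * (Real.exp (-s) * s ^ k))), integral_const_mul, integral_add, integral_const_mul, integral_const_mul,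
    ← upperGamma_natCast_succ_eq_integral, ← upperGamma_natCast_succ_eq_integral]
  · exact (integrableOn_exp_neg_mul_pow_Ioi (k + 1) hr).const_mul κ
  · exact (integrableOn_exp_neg_mul_pow_Ioi k hr).const_mul _

end UpperGamma

/-! ### Nonnegativity of the density -/

section Nonneg

theorem norm_sum_sq_le_one {N : ℕ} (v : CSphere N) : ‖∑ i, v.1.ofLp i ^ 2‖ ≤ 1 := by
  have h : ∑ i, ‖v.1.ofLp i‖ ^ 2 = 1 := by
    have := v.2
    rw [mem_sphere_zero_iff_norm, EuclideanSpace.norm_eq, Real.sqrt_eq_one] at this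
    exact this
  refine (norm_sum_le _ _).trans ?_
  simp_rw [norm_pow]
  exact h.le

theorem D_le_one {N : ℕ} (τ : ℝ) (v : CSphere N) : D τ v ≤ 1 := by
  unfold D
  have : 0 ≤ τ ^ 2 * ‖∑ i, v.1.ofLp i ^ 2‖ ^ 2 := by positivity
  linarith

theorem one_sub_sq_le_D {N : ℕ} (τ : ℝ) (v : CSphere N) : 1 - τ ^ 2 ≤ D τ v := by
  unfold D
  have h1 : ‖∑ i, v.1.ofLp i ^ 2‖ ^ 2 ≤ 1 := pow_le_one₀ (norm_nonneg _) (norm_sum_sq_le_one v)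
  nlinarith [sq_nonneg τ]

theorem sq_add_conj_sq_re (z : ℂ) : (z ^ 2 + starRingEnd ℂ z ^ 2).re = 2 * (z.re ^ 2 - z.im ^ 2) := by
  simp [sq]
  ring

theorem norm_sq_eq (z : ℂ) : ‖z‖ ^ 2 = z.re ^ 2 + z.im ^ 2 := by
  rw [← Complex.normSq_eq_norm_sq, Complex.normSq_apply]; ring

/-- Nonnegativity of the density. The bracket equals
`κ (Γ(N, r) - r Γ(N - 1, r)) + Γ(N - 1, r) |z̄ - (1 - κ) z / τ|²` with `κ = (1 - τ²) / D`. -/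
theorem density_nonneg {N : ℕ} [NeZero N] {τ : ℝ} (h0 : 0 ≤ τ) (h1 : τ < 1 ∨ τ = 1 ∧ 2 ≤ N)
    (z : ℂ) (v : CSphere N) : 0 ≤ density N τ z v := by
  obtain ⟨n, rfl⟩ : ∃ n, N = n + 1 := Nat.exists_eq_succ_of_ne_zero (NeZero.ne N)
  have hτ1 : τ ≤ 1 := by rcases h1 with h | h <;> linarith
  have hD0 : 0 ≤ D τ v := le_trans (by nlinarith) (one_sub_sq_le_D τ v)
  have hr : 0 ≤ ‖z‖ ^ 2 := by positivity
  -- `D = 0` occurs for `τ = 1` only; the value of the density there is zero because the prefactor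
  -- is `1 / 0 = 0`
  rcases hD0.eq_or_lt with hD | hD
  · have hn : ((n + 1 : ℕ) : ℝ) / 2 ≠ 0 := by positivity
    unfold density
    rw [← hD, Real.zero_rpow hn]
    simp
  set κ := (1 - τ ^ 2) / D τ v with hκ
  have hκ0 : 0 ≤ κ := div_nonneg (by nlinarith) hD.le
  have hκ1 : κ ≤ 1 := (div_le_one hD).2 (one_sub_sq_le_D τ v)
  have hG := upperGamma_natCast_succ_nonneg n hr
  unfold density
  rw [← hκ]
  have hpre : 0 ≤ 1 / (Real.pi * ((n + 1 : ℕ) : ℝ) * Real.Gamma ((n + 1 : ℕ) : ℝ)) *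
      (1 / D τ v ^ (((n + 1 : ℕ) : ℝ) / 2)) := by
    have : 0 < Real.Gamma ((n + 1 : ℕ) : ℝ) := Real.Gamma_pos_of_pos (by positivity)
    have := Real.pi_pos
    positivity
  refine mul_nonneg (mul_nonneg hpre (Real.exp_nonneg _)) ?_
  -- for `κ = 1` only the first incomplete Gamma function remains
  rcases eq_or_ne κ 1 with hk | hk
  · rw [hk]
    push_cast
    simpa using hG
  -- otherwise `N ≥ 2`, because `|vᵀ v| = 1` and so `D = 1 - τ²` in dimension one
  obtain ⟨m, rfl⟩ : ∃ m, n = m + 1 := by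
    refine Nat.exists_eq_succ_of_ne_zero fun hn => hk ?_
    subst hn
    have hτ : τ < 1 := by
      rcases h1 with h | h
      · exact h
      · omega
    have hv : ‖v.1.ofLp 0‖ = 1 := by
      have := v.2
      rw [mem_sphere_zero_iff_norm, EuclideanSpace.norm_eq, Real.sqrt_eq_one] at this
      have h1 : ‖v.1.ofLp 0‖ = 1 ∨ ‖v.1.ofLp 0‖ = -1 := by simpa using this
      rcases h1 with h | h
      · exact h
      · linarith [norm_nonneg (v.1.ofLp 0)]
    have hDv : D τ v = 1 - τ ^ 2 := by
      simp [D, hv]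
    rw [hκ, hDv, div_self]
    nlinarith
  have hG' := upperGamma_natCast_succ_nonneg m hr
  have hle := mul_upperGamma_le m hr
  -- and `τ ≠ 0`, because `D = 1` for `τ = 0`
  have hτ0 : τ ≠ 0 := by
    rintro rfl
    apply hk
    rw [hκ]
    simp [D]
  have e1 : (((m + 1 + 1 : ℕ) : ℝ) - 1) = (m : ℝ) + 1 := by push_cast; ring
  have e2 : ((m + 1 + 1 : ℕ) : ℝ) = ((m + 1 : ℕ) : ℝ) + 1 := by push_cast; ring
  rw [e1, e2]
  set A := upperGamma (((m + 1 : ℕ) : ℝ) + 1) (‖z‖ ^ 2)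
  set B := upperGamma ((m : ℝ) + 1) (‖z‖ ^ 2)
  have key : κ * A + B * (1 - κ) * ((‖z‖ ^ 2 - 1 / τ * (z ^ 2 + starRingEnd ℂ z ^ 2).re) +
        ‖z‖ ^ 2 / τ ^ 2 * (1 - κ)) = κ * (A - ‖z‖ ^ 2 * B) +
        B * ((1 - (1 - κ) / τ) ^ 2 * z.re ^ 2 + (1 + (1 - κ) / τ) ^ 2 * z.im ^ 2) := by
    rw [sq_add_conj_sq_re, norm_sq_eq]
    field_simp
    ring
  rw [key]
  have : 0 ≤ A - ‖z‖ ^ 2 * B := by linarith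
  positivity

end Nonneg

/-! ### Moments of a Gaussian weight on `ℂ`, up to order two -/

section GaussianMoments

theorem integral_exp_neg_sq_div (a : ℝ) :
    ∫ x : ℝ, Real.exp (-(x ^ 2 / a)) = √(Real.pi * a) := by
  have := integral_gaussian a⁻¹
  rw [div_inv_eq_mul] at this
  rw [← this]
  congr 1
  funext x
  congr 1
  ring

theorem integral_mul_exp_neg_sq_div (a : ℝ) :
    ∫ x : ℝ, x * Real.exp (-(x ^ 2 / a)) = 0 := by
  have h := integral_neg_eq_self (fun x : ℝ => x * Real.exp (-(x ^ 2 / a))) volume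
  simp only [neg_mul, neg_sq, integral_neg] at h
  linarith

theorem integral_sq_mul_exp_neg_sq_div {a : ℝ} (ha : 0 < a) :
    ∫ x : ℝ, x ^ 2 * Real.exp (-(x ^ 2 / a)) = a / 2 * √(Real.pi * a) := by
  obtain ⟨v, hv⟩ : ∃ v : NNReal, (v : ℝ) = a / 2 := ⟨_, Real.coe_toNNReal (a / 2) (by positivity)⟩
  have hv0 : v ≠ 0 := fun h => by
    rw [h, NNReal.coe_zero] at hv
    linarith
  have h := variance_fun_id_gaussianReal (μ := 0) (v := v)
  rw [variance_of_integral_eq_zero (by fun_prop) integral_id_gaussianReal,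
    integral_gaussianReal_eq_integral_smul hv0] at h
  have e : ∀ x : ℝ, gaussianPDFReal 0 v x • x ^ 2 =
      (√(Real.pi * a))⁻¹ * (x ^ 2 * Real.exp (-(x ^ 2 / a))) := fun x => by
    have h1 : (2 : ℝ) * Real.pi * v = Real.pi * a := by rw [hv]; ring
    have h2 : -(x - 0) ^ 2 / (2 * (v : ℝ)) = -(x ^ 2 / a) := by
      rw [hv]; ring
    rw [gaussianPDFReal, h1, h2, smul_eq_mul]
    ring
  simp_rw [e] at h
  rw [integral_const_mul] at h
  have hs : √(Real.pi * a) ≠ 0 := by positivity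
  rw [inv_mul_eq_iff_eq_mul₀ hs] at h
  rw [h, hv]
  ring

/-- The weight `exp (-(x ² / a + y ² / b))` on `ℂ`. -/
def gaussWeight (a b : ℝ) (c : ℂ) : ℝ := Real.exp (-(c.re ^ 2 / a + c.im ^ 2 / b))

theorem continuous_gaussWeight (a b : ℝ) : Continuous (gaussWeight a b) := by
  unfold gaussWeight
  fun_prop

theorem integral_complex_mul (f g : ℝ → ℂ) :
    ∫ c : ℂ, f c.re * g c.im = (∫ x, f x) * ∫ y, g y := by
  rw [← integral_prod_mul, ← Measure.volume_eq_prod,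
    ← Complex.volume_preserving_equiv_real_prod.integral_comp
      Complex.measurableEquivRealProd.measurableEmbedding]
  rfl

theorem integrable_complex_mul {f g : ℝ → ℂ} (hf : Integrable f) (hg : Integrable g) :
    Integrable fun c : ℂ => f c.re * g c.im := by
  have := hf.mul_prod hg
  rw [← Measure.volume_eq_prod] at this
  exact (Complex.volume_preserving_equiv_real_prod.integrable_comp_emb
    Complex.measurableEquivRealProd.measurableEmbedding).2 this

section

variable {a b : ℝ}

theorem gaussWeight_eq (c : ℂ) : (gaussWeight a b c : ℂ) =
    ((Real.exp (-(c.re ^ 2 / a)) : ℝ) : ℂ) * ((Real.exp (-(c.im ^ 2 / b)) : ℝ) : ℂ) := by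
  rw [gaussWeight, ← Complex.ofReal_mul, ← Real.exp_add]
  congr 2
  ring

theorem integral_gaussWeight (ha : 0 < a) :
    ∫ c, (gaussWeight a b c : ℂ) = (Real.pi * √(a * b) : ℝ) := by
  simp_rw [gaussWeight_eq]
  rw [integral_complex_mul (fun x => ((Real.exp (-(x ^ 2 / a)) : ℝ) : ℂ))
    (fun x => ((Real.exp (-(x ^ 2 / b)) : ℝ) : ℂ)), integral_complex_ofReal,
    integral_complex_ofReal, integral_exp_neg_sq_div, integral_exp_neg_sq_div,
    ← Complex.ofReal_mul, ← Real.sqrt_mul (by positivity)]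
  congr 1
  rw [show Real.pi * a * (Real.pi * b) = Real.pi ^ 2 * (a * b) by ring,
    Real.sqrt_mul (by positivity), Real.sqrt_sq Real.pi_pos.le]

theorem integral_gaussWeight_re (a b : ℝ) :
    ∫ c, (gaussWeight a b c : ℂ) * (c.re : ℂ) = 0 := by
  have : ∀ c : ℂ, (gaussWeight a b c : ℂ) * (c.re : ℂ) =
      ((c.re * Real.exp (-(c.re ^ 2 / a)) : ℝ) : ℂ) * ((Real.exp (-(c.im ^ 2 / b)) : ℝ) : ℂ) :=
    fun c => by rw [gaussWeight_eq]; push_cast; ring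
  simp_rw [this]
  rw [integral_complex_mul (fun x => ((x * Real.exp (-(x ^ 2 / a)) : ℝ) : ℂ))
    (fun x => ((Real.exp (-(x ^ 2 / b)) : ℝ) : ℂ)), integral_complex_ofReal,
    integral_mul_exp_neg_sq_div]
  simp

theorem integral_gaussWeight_im (a b : ℝ) :
    ∫ c, (gaussWeight a b c : ℂ) * (c.im : ℂ) = 0 := by
  have : ∀ c : ℂ, (gaussWeight a b c : ℂ) * (c.im : ℂ) =
      ((Real.exp (-(c.re ^ 2 / a)) : ℝ) : ℂ) * ((c.im * Real.exp (-(c.im ^ 2 / b)) : ℝ) : ℂ) :=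
    fun c => by rw [gaussWeight_eq]; push_cast; ring
  simp_rw [this]
  rw [integral_complex_mul (fun x => ((Real.exp (-(x ^ 2 / a)) : ℝ) : ℂ))
    (fun x => ((x * Real.exp (-(x ^ 2 / b)) : ℝ) : ℂ)), integral_complex_ofReal,
    integral_complex_ofReal, integral_mul_exp_neg_sq_div]
  simp

theorem integral_gaussWeight_re_mul_im (a b : ℝ) :
    ∫ c, (gaussWeight a b c : ℂ) * ((c.re : ℂ) * c.im) = 0 := by
  have : ∀ c : ℂ, (gaussWeight a b c : ℂ) * ((c.re : ℂ) * c.im) =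
      ((c.re * Real.exp (-(c.re ^ 2 / a)) : ℝ) : ℂ) *
        ((c.im * Real.exp (-(c.im ^ 2 / b)) : ℝ) : ℂ) :=
    fun c => by rw [gaussWeight_eq]; push_cast; ring
  simp_rw [this]
  rw [integral_complex_mul (fun x => ((x * Real.exp (-(x ^ 2 / a)) : ℝ) : ℂ))
    (fun x => ((x * Real.exp (-(x ^ 2 / b)) : ℝ) : ℂ)), integral_complex_ofReal,
    integral_mul_exp_neg_sq_div]
  simp

theorem integral_gaussWeight_re_sq (ha : 0 < a) :
    ∫ c, (gaussWeight a b c : ℂ) * (c.re : ℂ) ^ 2 = (a / 2 * (Real.pi * √(a * b)) : ℝ) := by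
  have : ∀ c : ℂ, (gaussWeight a b c : ℂ) * (c.re : ℂ) ^ 2 =
      ((c.re ^ 2 * Real.exp (-(c.re ^ 2 / a)) : ℝ) : ℂ) * ((Real.exp (-(c.im ^ 2 / b)) : ℝ) : ℂ) :=
    fun c => by rw [gaussWeight_eq]; push_cast; ring
  simp_rw [this]
  rw [integral_complex_mul (fun x => ((x ^ 2 * Real.exp (-(x ^ 2 / a)) : ℝ) : ℂ))
    (fun x => ((Real.exp (-(x ^ 2 / b)) : ℝ) : ℂ)), integral_complex_ofReal,
    integral_complex_ofReal, integral_sq_mul_exp_neg_sq_div ha, integral_exp_neg_sq_div,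
    ← Complex.ofReal_mul, mul_assoc, ← Real.sqrt_mul (by positivity)]
  congr 2
  rw [show Real.pi * a * (Real.pi * b) = Real.pi ^ 2 * (a * b) by ring,
    Real.sqrt_mul (by positivity), Real.sqrt_sq Real.pi_pos.le]

theorem integral_gaussWeight_im_sq (ha : 0 < a) (hb : 0 < b) :
    ∫ c, (gaussWeight a b c : ℂ) * (c.im : ℂ) ^ 2 = (b / 2 * (Real.pi * √(a * b)) : ℝ) := by
  have : ∀ c : ℂ, (gaussWeight a b c : ℂ) * (c.im : ℂ) ^ 2 =
      ((Real.exp (-(c.re ^ 2 / a)) : ℝ) : ℂ) * ((c.im ^ 2 * Real.exp (-(c.im ^ 2 / b)) : ℝ) : ℂ) :=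
    fun c => by rw [gaussWeight_eq]; push_cast; ring
  simp_rw [this]
  rw [integral_complex_mul (fun x => ((Real.exp (-(x ^ 2 / a)) : ℝ) : ℂ))
    (fun x => ((x ^ 2 * Real.exp (-(x ^ 2 / b)) : ℝ) : ℂ)), integral_complex_ofReal,
    integral_complex_ofReal, integral_sq_mul_exp_neg_sq_div hb, integral_exp_neg_sq_div,
    ← Complex.ofReal_mul, mul_left_comm, ← Real.sqrt_mul (by positivity)]
  congr 2
  rw [show Real.pi * a * (Real.pi * b) = Real.pi ^ 2 * (a * b) by ring,
    Real.sqrt_mul (by positivity), Real.sqrt_sq Real.pi_pos.le]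

theorem integrable_exp_neg_mul_norm_sq {ε : ℝ} (hε : 0 < ε) :
    Integrable fun c : ℂ => Real.exp (-(ε * ‖c‖ ^ 2)) := by
  have h1 := (integrable_exp_neg_mul_sq hε).ofReal (𝕜 := ℂ)
  have h2 := (integrable_complex_mul h1 h1).norm
  refine h2.congr (ae_of_all _ fun c => ?_)
  simp only [Complex.coe_algebraMap, norm_mul, Complex.norm_real, Real.norm_eq_abs, Real.abs_exp]
  rw [← Real.exp_add, norm_sq_eq]
  congr 1
  ring

theorem integrable_exp_neg_mul_sum_norm_sq {m : ℕ} {ε : ℝ} (hε : 0 < ε) :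
    Integrable fun β : Fin m → ℂ => Real.exp (-(ε * ∑ k, ‖β k‖ ^ 2)) := by
  have := Integrable.fintype_prod (μ := fun _ : Fin m => (volume : Measure ℂ))
    (fun _ : Fin m => integrable_exp_neg_mul_norm_sq hε)
  refine this.congr (ae_of_all _ fun β => ?_)
  simp only
  rw [← Real.exp_sum, Finset.sum_neg_distrib, Finset.mul_sum]

/-- Half of the Gaussian decay absorbs quadratic growth. -/
theorem add_mul_exp_le {A C ε s : ℝ} (hA : 0 ≤ A) (hC : 0 ≤ C) (hε : 0 < ε) (hs : 0 ≤ s) :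
    (A + C * s) * Real.exp (-(ε * s)) ≤ (A + 2 * C / ε) * Real.exp (-(ε / 2 * s)) := by
  have h1 : s ≤ 2 / ε * Real.exp (ε / 2 * s) := by
    have := Real.add_one_le_exp (ε / 2 * s)
    rw [div_mul_eq_mul_div, le_div_iff₀ hε]
    nlinarith
  have h2 : 1 ≤ Real.exp (ε / 2 * s) := Real.one_le_exp (by positivity)
  have h3 : Real.exp (-(ε / 2 * s)) = Real.exp (ε / 2 * s) * Real.exp (-(ε * s)) := by
    rw [← Real.exp_add]; ring_nf
  rw [h3, ← mul_assoc]
  refine mul_le_mul_of_nonneg_right ?_ (Real.exp_nonneg _)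
  have h4 := mul_le_mul_of_nonneg_left h1 hC
  have h5 := mul_le_mul_of_nonneg_left h2 hA
  calc A + C * s ≤ A * Real.exp (ε / 2 * s) + C * (2 / ε * Real.exp (ε / 2 * s)) := by linarith
    _ = _ := by ring

theorem integrable_of_norm_le_complex {f : ℂ → ℂ} (hf : Continuous f) {A C ε : ℝ} (hA : 0 ≤ A)
    (hC : 0 ≤ C) (hε : 0 < ε) (h : ∀ c, ‖f c‖ ≤ (A + C * ‖c‖ ^ 2) * Real.exp (-(ε * ‖c‖ ^ 2))) :
    Integrable f := by
  refine ((integrable_exp_neg_mul_norm_sq (half_pos hε)).const_mul (A + 2 * C / ε)).mono'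
    hf.aestronglyMeasurable (ae_of_all _ fun c => (h c).trans ?_)
  exact add_mul_exp_le hA hC hε (by positivity)

theorem integrable_of_norm_le_pi {m : ℕ} {f : (Fin m → ℂ) → ℂ} (hf : Continuous f) {A C ε : ℝ}
    (hA : 0 ≤ A) (hC : 0 ≤ C) (hε : 0 < ε)
    (h : ∀ β, ‖f β‖ ≤ (A + C * ∑ k, ‖β k‖ ^ 2) * Real.exp (-(ε * ∑ k, ‖β k‖ ^ 2))) :
    Integrable f := by
  refine ((integrable_exp_neg_mul_sum_norm_sq (half_pos hε)).const_mul (A + 2 * C / ε)).mono'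
    hf.aestronglyMeasurable (ae_of_all _ fun c => (h c).trans ?_)
  exact add_mul_exp_le hA hC hε (by positivity)

theorem gaussWeight_le {M : ℝ} (ha : 0 < a) (hb : 0 < b) (haM : a ≤ M) (hbM : b ≤ M) (c : ℂ) :
    gaussWeight a b c ≤ Real.exp (-(M⁻¹ * ‖c‖ ^ 2)) := by
  unfold gaussWeight
  rw [Real.exp_le_exp, neg_le_neg_iff, norm_sq_eq, mul_add, inv_mul_eq_div, inv_mul_eq_div]
  gcongr

theorem integrable_gaussWeight_mul (ha : 0 < a) (hb : 0 < b) {f : ℂ → ℂ} (hf : Continuous f)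
    (h : ∀ c, ‖f c‖ ≤ 1 + ‖c‖ ^ 2) : Integrable fun c => (gaussWeight a b c : ℂ) * f c := by
  have hM : 0 < max a b := lt_max_of_lt_left ha
  refine integrable_of_norm_le_complex (A := 1) (C := 1) (ε := (max a b)⁻¹)
    ((Complex.continuous_ofReal.comp (continuous_gaussWeight a b)).mul hf) zero_le_one zero_le_one
    (by positivity) fun c => ?_
  rw [norm_mul, mul_comm, one_mul, Complex.norm_real,
    Real.norm_of_nonneg (show 0 ≤ gaussWeight a b c from Real.exp_nonneg _)]
  exact mul_le_mul (h c) (gaussWeight_le ha hb (le_max_left _ _) (le_max_right _ _) c)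
    (Real.exp_nonneg _) (by positivity)

theorem integral_gaussWeight_mul_self (ha : 0 < a) (hb : 0 < b) :
    ∫ c, (gaussWeight a b c : ℂ) * c = 0 := by
  have e : ∀ c : ℂ, (gaussWeight a b c : ℂ) * c =
      (gaussWeight a b c : ℂ) * (c.re : ℂ) + (gaussWeight a b c : ℂ) * (c.im : ℂ) * Complex.I :=
    fun c => by
      apply Complex.ext <;> simp
  have hb1 : ∀ x : ℝ, x ≤ 1 + x ^ 2 := fun x => by nlinarith [sq_nonneg (x - 1)]
  have h1 : Integrable fun c : ℂ => (gaussWeight a b c : ℂ) * (c.re : ℂ) :=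
    integrable_gaussWeight_mul ha hb (by fun_prop) fun c => by
      rw [Complex.norm_real]
      exact (Complex.abs_re_le_norm c).trans (hb1 _)
  have h2 : Integrable fun c : ℂ => (gaussWeight a b c : ℂ) * (c.im : ℂ) :=
    integrable_gaussWeight_mul ha hb (by fun_prop) fun c => by
      rw [Complex.norm_real]
      exact (Complex.abs_im_le_norm c).trans (hb1 _)
  simp_rw [e]
  rw [integral_add h1 (h2.mul_const _), integral_mul_const, integral_gaussWeight_re,
    integral_gaussWeight_im]
  simp

theorem integrable_gaussWeight_re_sq (ha : 0 < a) (hb : 0 < b) :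
    Integrable fun c : ℂ => (gaussWeight a b c : ℂ) * (c.re : ℂ) ^ 2 :=
  integrable_gaussWeight_mul ha hb (by fun_prop) fun c => by
    rw [norm_pow, Complex.norm_real, norm_sq_eq, Real.norm_eq_abs, sq_abs]
    nlinarith [sq_nonneg c.im]

theorem integrable_gaussWeight_im_sq (ha : 0 < a) (hb : 0 < b) :
    Integrable fun c : ℂ => (gaussWeight a b c : ℂ) * (c.im : ℂ) ^ 2 :=
  integrable_gaussWeight_mul ha hb (by fun_prop) fun c => by
    rw [norm_pow, Complex.norm_real, norm_sq_eq, Real.norm_eq_abs, sq_abs]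
    nlinarith [sq_nonneg c.re]

theorem integral_gaussWeight_mul_conj (ha : 0 < a) (hb : 0 < b) :
    ∫ c, (gaussWeight a b c : ℂ) * (c * starRingEnd ℂ c) =
      ((a + b) / 2 * (Real.pi * √(a * b)) : ℝ) := by
  have e : ∀ c : ℂ, (gaussWeight a b c : ℂ) * (c * starRingEnd ℂ c) =
      (gaussWeight a b c : ℂ) * (c.re : ℂ) ^ 2 + (gaussWeight a b c : ℂ) * (c.im : ℂ) ^ 2 :=
    fun c => by
      rw [Complex.mul_conj, Complex.normSq_apply]
      push_cast
      ring
  simp_rw [e]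
  rw [integral_add (integrable_gaussWeight_re_sq ha hb) (integrable_gaussWeight_im_sq ha hb),
    integral_gaussWeight_re_sq ha, integral_gaussWeight_im_sq ha hb]
  push_cast
  ring

theorem integral_gaussWeight_mul_sq (ha : 0 < a) (hb : 0 < b) :
    ∫ c, (gaussWeight a b c : ℂ) * (c * c) = ((a - b) / 2 * (Real.pi * √(a * b)) : ℝ) := by
  have e : ∀ c : ℂ, (gaussWeight a b c : ℂ) * (c * c) =
      ((gaussWeight a b c : ℂ) * (c.re : ℂ) ^ 2 - (gaussWeight a b c : ℂ) * (c.im : ℂ) ^ 2) +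
        (gaussWeight a b c : ℂ) * ((c.re : ℂ) * c.im) * (2 * Complex.I) :=
    fun c => by
      apply Complex.ext <;> simp [sq] <;> ring
  have h3 : Integrable fun c : ℂ => (gaussWeight a b c : ℂ) * ((c.re : ℂ) * c.im) :=
    integrable_gaussWeight_mul ha hb (by fun_prop) fun c => by
      rw [norm_mul, Complex.norm_real, Complex.norm_real, Real.norm_eq_abs, Real.norm_eq_abs,
        norm_sq_eq]
      nlinarith [sq_nonneg (|c.re| - |c.im|), sq_abs c.re, sq_abs c.im, sq_nonneg c.re]
  simp_rw [e]
  have h12 : Integrable fun c : ℂ => (gaussWeight a b c : ℂ) * (c.re : ℂ) ^ 2 -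
      (gaussWeight a b c : ℂ) * (c.im : ℂ) ^ 2 :=
    (integrable_gaussWeight_re_sq ha hb).sub (integrable_gaussWeight_im_sq ha hb)
  rw [integral_add h12 (h3.mul_const _), integral_sub (integrable_gaussWeight_re_sq ha hb)
    (integrable_gaussWeight_im_sq ha hb),
    integral_gaussWeight_re_sq ha, integral_gaussWeight_im_sq ha hb, integral_mul_const,
    integral_gaussWeight_re_mul_im]
  push_cast
  ring

end

end GaussianMoments

/-! ### Conditioning a Gaussian row on its pairing with a vector -/

section RowDecomposition

open scoped ComplexConjugate

section Vectors

variable {ι : Type*} [Fintype ι]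

/-- `∑ |w i|²`. -/
def sumNormSq (w : ι → ℂ) : ℝ := ∑ i, ‖w i‖ ^ 2

/-- `wᵀ w`. -/
def sumSq (w : ι → ℂ) : ℂ := ∑ i, w i ^ 2

/-- `|w|⁴ - τ² |wᵀ w|²`. For a row `g` of the random matrix, `g ⬝ w` has `E |g ⬝ w|² = |w|²` and
`E (g ⬝ w)² = τ wᵀ w`, and this is four times the determinant of its real covariance matrix. -/
def covDet (τ : ℝ) (w : ι → ℂ) : ℝ := sumNormSq w ^ 2 - τ ^ 2 * ‖sumSq w‖ ^ 2

/-- The coefficient of `c` in the conditional mean of a row `g` given `g ⬝ w = c`. -/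
def regP (τ : ℝ) (w : ι → ℂ) (i : ι) : ℂ :=
  (sumNormSq w * conj (w i) - τ ^ 2 * conj (sumSq w) * w i) / covDet τ w

/-- The coefficient of `conj c` in the conditional mean of a row `g` given `g ⬝ w = c`. -/
def regR (τ : ℝ) (w : ι → ℂ) (i : ι) : ℂ :=
  τ * (sumNormSq w * w i - sumSq w * conj (w i)) / covDet τ w

/-- The conditional mean of a row `g` given `g ⬝ w = c`, a real linear function of `c`. -/
def regMean (τ : ℝ) (w : ι → ℂ) (c : ℂ) (i : ι) : ℂ := c * regP τ w i + conj c * regR τ w i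

/-- The density of a row for `τ < 1`, without its normalizing factor: the real and imaginary parts
of the entries are independent of variances `(1 + τ) / 2` and `(1 - τ) / 2`. -/
def rowWeight (τ : ℝ) (g : ι → ℂ) : ℝ := ∏ k, gaussWeight (1 + τ) (1 - τ) (g k)

/-- The density of `g ⬝ w` at `c` for a row `g`, without its normalizing factor. -/
def pairingWeight (τ : ℝ) (w : ι → ℂ) (c : ℂ) : ℝ :=
  Real.exp (-((sumNormSq w * ‖c‖ ^ 2 - τ * (conj (sumSq w) * c ^ 2).re) / covDet τ w))

theorem sum_mul_conj_eq (w : ι → ℂ) : ∑ i, w i * conj (w i) = sumNormSq w := by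
  simp only [sumNormSq, Complex.mul_conj, Complex.normSq_eq_norm_sq, Complex.ofReal_sum]

theorem norm_sumSq_le (w : ι → ℂ) : ‖sumSq w‖ ≤ sumNormSq w := by
  refine (norm_sum_le _ _).trans ?_
  simp_rw [norm_pow]
  exact le_rfl

theorem sumNormSq_nonneg (w : ι → ℂ) : 0 ≤ sumNormSq w :=
  Finset.sum_nonneg fun _ _ => by positivity

variable {τ : ℝ} {w : ι → ℂ}

theorem mul_norm_sumSq_lt (h0 : 0 ≤ τ) (h1 : τ < 1) (hw : 0 < sumNormSq w) :
    τ * ‖sumSq w‖ < sumNormSq w := by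
  have := norm_sumSq_le w
  nlinarith [norm_nonneg (sumSq w)]

theorem covDet_eq (τ : ℝ) (w : ι → ℂ) : covDet τ w =
    (sumNormSq w + τ * ‖sumSq w‖) * (sumNormSq w - τ * ‖sumSq w‖) := by
  unfold covDet; ring

theorem covDet_pos (h0 : 0 ≤ τ) (h1 : τ < 1) (hw : 0 < sumNormSq w) : 0 < covDet τ w := by
  rw [covDet_eq]
  have := mul_norm_sumSq_lt h0 h1 hw
  have : 0 ≤ τ * ‖sumSq w‖ := by positivity
  apply mul_pos <;> linarith

theorem covDet_ofReal (τ : ℝ) (w : ι → ℂ) : (covDet τ w : ℂ) =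
    sumNormSq w ^ 2 - τ ^ 2 * (sumSq w * conj (sumSq w)) := by
  rw [Complex.mul_conj, Complex.normSq_eq_norm_sq, covDet]
  push_cast
  ring

theorem sum_mul_regP (hΔ : covDet τ w ≠ 0) : ∑ i, w i * regP τ w i = 1 := by
  have hΔ' : (covDet τ w : ℂ) ≠ 0 := by exact_mod_cast hΔ
  have : ∀ i, w i * regP τ w i = (sumNormSq w * (w i * conj (w i)) -
      τ ^ 2 * conj (sumSq w) * w i ^ 2) / covDet τ w := fun i => by
    unfold regP; ring
  simp_rw [this]
  rw [← Finset.sum_div, Finset.sum_sub_distrib, ← Finset.mul_sum, ← Finset.mul_sum,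
    sum_mul_conj_eq, div_eq_one_iff_eq hΔ', covDet_ofReal]
  unfold sumSq
  ring

theorem sum_mul_regR (τ : ℝ) (w : ι → ℂ) : ∑ i, w i * regR τ w i = 0 := by
  have : ∀ i, w i * regR τ w i = (τ * sumNormSq w * w i ^ 2 -
      τ * sumSq w * (w i * conj (w i))) / covDet τ w := fun i => by
    unfold regR; ring
  simp_rw [this]
  rw [← Finset.sum_div, Finset.sum_sub_distrib, ← Finset.mul_sum, ← Finset.mul_sum,
    sum_mul_conj_eq]
  unfold sumSq
  ring

theorem sum_mul_regMean (hΔ : covDet τ w ≠ 0) (c : ℂ) : ∑ i, w i * regMean τ w c i = c := by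
  have : ∀ i, w i * regMean τ w c i = c * (w i * regP τ w i) + conj c * (w i * regR τ w i) :=
    fun i => by unfold regMean; ring
  simp_rw [this]
  rw [Finset.sum_add_distrib, ← Finset.mul_sum, ← Finset.mul_sum, sum_mul_regP hΔ, sum_mul_regR]
  ring

theorem conj_regMean_sub (τ : ℝ) (w : ι → ℂ) (c : ℂ) (i : ι) :
    conj (regMean τ w c i) - τ * regMean τ w c i =
      (1 - τ ^ 2) * ((sumNormSq w * conj c - τ * conj (sumSq w) * c) / covDet τ w) * w i := by
  simp only [regMean, regP, regR, map_add, map_mul, map_div₀, map_sub, Complex.conj_conj,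
    Complex.conj_ofReal, map_pow]
  ring

/-- The conditional mean is orthogonal to the remaining part of the row for the quadratic form of
the Gaussian weight, so that the weight factorizes. -/
theorem rowWeight_regMean_add (h0 : 0 ≤ τ) (h1 : τ < 1) (hw : 0 < sumNormSq w) (c : ℂ)
    {ξ : ι → ℂ} (hξ : ∑ i, w i * ξ i = 0) :
    rowWeight τ (regMean τ w c + ξ) = pairingWeight τ w c * rowWeight τ ξ := by
  have hp : (0 : ℝ) < 1 + τ := by linarith
  have hm : (0 : ℝ) < 1 - τ := by linarith
  have hΔ : covDet τ w ≠ 0 := (covDet_pos h0 h1 hw).ne'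
  -- the quadratic form of the weight, whose polar form against `h` involves `conj g - τ g`
  have hform : ∀ g : ℂ, g.re ^ 2 / (1 + τ) + g.im ^ 2 / (1 - τ) =
      ((conj g - τ * g) * g).re / (1 - τ ^ 2) := fun g => by
    rw [show 1 - τ ^ 2 = (1 + τ) * (1 - τ) by ring]
    simp
    field_simp
    ring
  have hadd : ∀ g h : ℂ, (g + h).re ^ 2 / (1 + τ) + (g + h).im ^ 2 / (1 - τ) =
      ((conj g - τ * g) * g).re / (1 - τ ^ 2) + (h.re ^ 2 / (1 + τ) + h.im ^ 2 / (1 - τ)) +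
        2 * ((conj g - τ * g) * h).re / (1 - τ ^ 2) := fun g h => by
    rw [show 1 - τ ^ 2 = (1 + τ) * (1 - τ) by ring]
    simp
    field_simp
    ring
  have hτ2 : (1 - τ ^ 2) ≠ 0 := by nlinarith
  set a : ℂ := (sumNormSq w * conj c - τ * conj (sumSq w) * c) / covDet τ w with ha
  -- for the conditional mean the vector `conj g - τ g` is a multiple of `w`, so that the cross
  -- terms only involve `w ⬝ ξ = 0`
  have hcoef : ∀ i (x : ℂ), ((conj (regMean τ w c i) - τ * regMean τ w c i) * x).re / (1 - τ ^ 2) =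
      (a * (w i * x)).re := fun i x => by
    rw [conj_regMean_sub, ← ha, div_eq_iff hτ2,
      show (1 - (τ : ℂ) ^ 2) * a * w i * x = ((1 - τ ^ 2 : ℝ) : ℂ) * (a * (w i * x)) by
        push_cast; ring, Complex.re_ofReal_mul]
    ring
  unfold rowWeight gaussWeight pairingWeight
  rw [← Real.exp_sum, ← Real.exp_sum, ← Real.exp_add]
  congr 1
  rw [Finset.sum_neg_distrib, Finset.sum_neg_distrib, ← neg_add]
  congr 1
  simp_rw [Pi.add_apply, hadd, mul_div_assoc, hcoef]
  rw [Finset.sum_add_distrib, Finset.sum_add_distrib, ← Complex.re_sum, ← Finset.mul_sum,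
    ← Finset.mul_sum, ← Complex.re_sum, ← Finset.mul_sum, hξ, sum_mul_regMean hΔ]
  have : (a * c).re = (sumNormSq w * ‖c‖ ^ 2 - τ * (conj (sumSq w) * c ^ 2).re) / covDet τ w := by
    rw [ha, div_mul_eq_mul_div, Complex.div_ofReal_re]
    congr 1
    rw [show (sumNormSq w * conj c - τ * conj (sumSq w) * c) * c =
      ((sumNormSq w * ‖c‖ ^ 2 : ℝ) : ℂ) - τ * (conj (sumSq w) * c ^ 2) by
        push_cast
        rw [← Complex.mul_conj']
        ring, Complex.sub_re, Complex.ofReal_re, Complex.re_ofReal_mul]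
  rw [this]
  simp

theorem continuous_rowWeight (τ : ℝ) : Continuous (rowWeight τ : (ι → ℂ) → ℝ) :=
  continuous_finsetProd _ fun k _ => (continuous_gaussWeight _ _).comp (continuous_apply k)

theorem rowWeight_nonneg (τ : ℝ) (g : ι → ℂ) : 0 ≤ rowWeight τ g :=
  Finset.prod_nonneg fun _ _ => Real.exp_nonneg _

theorem pairingWeight_nonneg (τ : ℝ) (w : ι → ℂ) (c : ℂ) : 0 ≤ pairingWeight τ w c :=
  Real.exp_nonneg _

theorem rowWeight_neg (τ : ℝ) (g : ι → ℂ) : rowWeight τ (-g) = rowWeight τ g := by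
  simp [rowWeight, gaussWeight]

theorem continuous_pairingWeight (τ : ℝ) (w : ι → ℂ) : Continuous (pairingWeight τ w) := by
  unfold pairingWeight
  fun_prop

theorem continuous_regMean (τ : ℝ) (w : ι → ℂ) (i : ι) :
    Continuous fun c => regMean τ w c i := by
  unfold regMean
  fun_prop

theorem pairingWeight_le (h0 : 0 ≤ τ) (h1 : τ < 1) (hw : 0 < sumNormSq w) (c : ℂ) :
    pairingWeight τ w c ≤ Real.exp (-((sumNormSq w + τ * ‖sumSq w‖)⁻¹ * ‖c‖ ^ 2)) := by
  have hm := mul_norm_sumSq_lt h0 h1 hw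
  have hΔ := covDet_pos h0 h1 hw
  have hp : 0 < sumNormSq w + τ * ‖sumSq w‖ := by positivity
  unfold pairingWeight
  rw [Real.exp_le_exp, neg_le_neg_iff, le_div_iff₀ hΔ, covDet_eq]
  have h2 : (conj (sumSq w) * c ^ 2).re ≤ ‖sumSq w‖ * ‖c‖ ^ 2 := by
    refine (Complex.re_le_norm _).trans ?_
    simp
  calc _ = (sumNormSq w - τ * ‖sumSq w‖) * ‖c‖ ^ 2 := by field_simp
    _ ≤ _ := by nlinarith

theorem integrable_pairingWeight_mul (h0 : 0 ≤ τ) (h1 : τ < 1) (hw : 0 < sumNormSq w) {f : ℂ → ℂ}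
    (hf : Continuous f) {A C : ℝ} (hA : 0 ≤ A) (hC : 0 ≤ C) (h : ∀ c, ‖f c‖ ≤ A + C * ‖c‖ ^ 2) :
    Integrable fun c => (pairingWeight τ w c : ℂ) * f c := by
  have hp : 0 < sumNormSq w + τ * ‖sumSq w‖ := by positivity
  refine integrable_of_norm_le_complex (A := A) (C := C) (ε := (sumNormSq w + τ * ‖sumSq w‖)⁻¹)
    ((Complex.continuous_ofReal.comp (continuous_pairingWeight τ w)).mul hf) hA hC
    (by positivity) fun c => ?_
  rw [norm_mul, mul_comm, Complex.norm_real, Real.norm_of_nonneg (pairingWeight_nonneg τ w c)]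
  exact mul_le_mul (h c) (pairingWeight_le h0 h1 hw c) (pairingWeight_nonneg τ w c) (by positivity)

/-- The total mass of the Gaussian weight on `ℂ`, computed in coordinates in which
`wᵀ w` becomes real. -/
theorem integral_pairingWeight (h0 : 0 ≤ τ) (h1 : τ < 1) (hw : 0 < sumNormSq w) :
    ∫ c, (pairingWeight τ w c : ℂ) = (Real.pi * √(covDet τ w) : ℝ) := by
  have hm := mul_norm_sumSq_lt h0 h1 hw
  have hΔ := covDet_pos h0 h1 hw
  have hp : 0 < sumNormSq w + τ * ‖sumSq w‖ := by positivity
  have hm' : 0 < sumNormSq w - τ * ‖sumSq w‖ := by linarith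
  -- rotating `c` by half the argument of `wᵀ w` diagonalizes the quadratic form
  set η : Circle := Circle.exp ((sumSq w).arg / 2) with hη
  have hη2 : conj (sumSq w) * (η : ℂ) ^ 2 = ‖sumSq w‖ := by
    have h2 : (η : ℂ) ^ 2 = Complex.exp ((sumSq w).arg * Complex.I) := by
      rw [hη, Circle.coe_exp, ← Complex.exp_nat_mul]
      congr 1
      push_cast
      ring
    have h3 : (‖sumSq w‖ : ℂ) * (η : ℂ) ^ 2 = sumSq w := by
      rw [h2]; exact Complex.norm_mul_exp_arg_mul_I _
    have h4 : conj ((η : ℂ) ^ 2) * (η : ℂ) ^ 2 = 1 := by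
      rw [← Complex.normSq_eq_conj_mul_self]; simp
    conv_lhs => rw [← h3, map_mul, Complex.conj_ofReal, mul_assoc, h4, mul_one]
  have key : ∀ c, pairingWeight τ w (rotation η c) =
      gaussWeight (sumNormSq w + τ * ‖sumSq w‖) (sumNormSq w - τ * ‖sumSq w‖) c := fun c => by
    unfold pairingWeight gaussWeight
    congr 2
    rw [LinearIsometryEquiv.norm_map, rotation_apply, mul_pow, ← mul_assoc, hη2, covDet_eq,
      Complex.re_ofReal_mul, norm_sq_eq, sq c, Complex.mul_re]
    field_simp
    ring
  rw [covDet_eq, ← integral_gaussWeight hp, ← (rotation η).measurePreserving.integral_comp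
    (rotation η).toHomeomorph.measurableEmbedding]
  simp_rw [key]

end Vectors

section Row

variable {n : ℕ} {τ : ℝ}

/-- The vector `(1, u)`. -/
def affineVec (u : Fin n → ℂ) : Fin (n + 1) → ℂ := Fin.cons 1 u

/-- The vector with last entries `β` which is orthogonal to `(1, u)` for the bilinear form
`(g, w) ↦ ∑ gᵢ wᵢ`, which is not the Hermitian one. -/
def fluct (u β : Fin n → ℂ) : Fin (n + 1) → ℂ := Fin.cons (-∑ k, β k * u k) β

theorem one_le_sumNormSq_affineVec (u : Fin n → ℂ) : 1 ≤ sumNormSq (affineVec u) := by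
  simp [sumNormSq, affineVec, Fin.sum_univ_succ]
  positivity

theorem sumNormSq_affineVec_pos (u : Fin n → ℂ) : 0 < sumNormSq (affineVec u) :=
  zero_lt_one.trans_le (one_le_sumNormSq_affineVec u)

theorem sum_affineVec_mul_fluct (u β : Fin n → ℂ) : ∑ i, affineVec u i * fluct u β i = 0 := by
  simp only [affineVec, fluct, Fin.sum_univ_succ, Fin.cons_zero, Fin.cons_succ, one_mul]
  simp_rw [mul_comm (u _)]
  ring

theorem continuous_fluct (u : Fin n → ℂ) : Continuous (fluct u) := by
  refine continuous_pi fun i => ?_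
  refine Fin.cases ?_ (fun k => ?_) i
  · simp only [fluct, Fin.cons_zero]; fun_prop
  · simp only [fluct, Fin.cons_succ]; fun_prop

theorem fluct_neg (u β : Fin n → ℂ) : fluct u (-β) = -fluct u β := by
  funext i
  refine Fin.cases ?_ (fun k => ?_) i <;> simp [fluct]

/-- The linear change of variables splitting a row `g` into `c = g ⬝ (1, u)` and the deviation
from the conditional mean. -/
def rowSplit (τ : ℝ) (u : Fin n → ℂ) (p : ℂ × (Fin n → ℂ)) : Fin (n + 1) → ℂ :=
  regMean τ (affineVec u) p.1 + fluct u p.2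

/-- The map is a composition of two shears: `β` is translated by the last entries of the
conditional mean, which depends on `c`, and then `c` is translated by a function of the last
entries. -/
theorem measurePreserving_rowSplit (h0 : 0 ≤ τ) (h1 : τ < 1) (u : Fin n → ℂ) :
    MeasurePreserving (rowSplit τ u) (volume.prod volume) volume := by
  have hΔ := (covDet_pos h0 h1 (sumNormSq_affineVec_pos u)).ne'
  have e1 : MeasurePreserving (fun p : ℂ × (Fin n → ℂ) =>
      (p.1, (fun k : Fin n => regMean τ (affineVec u) p.1 k.succ) + p.2))
      (volume.prod volume) (volume.prod volume) := by
    refine (MeasurePreserving.id volume).skew_product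
      (g := fun c β => (fun k : Fin n => regMean τ (affineVec u) c k.succ) + β) ?_ ?_
    · refine Continuous.measurable ?_
      refine continuous_pi fun k => ?_
      exact ((continuous_regMean τ (affineVec u) k.succ).comp continuous_fst).add
        ((continuous_apply k).comp continuous_snd)
    · exact ae_of_all _ fun c => map_add_left_eq_self _ _
  have e2 : MeasurePreserving (fun p : (Fin n → ℂ) × ℂ => (p.1, -(∑ k, p.1 k * u k) + p.2))
      (volume.prod volume) (volume.prod volume) := by
    refine (MeasurePreserving.id volume).skew_product
      (g := fun (b : Fin n → ℂ) c => -(∑ k, b k * u k) + c) ?_ ?_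
    · refine Continuous.measurable ?_
      fun_prop
    · exact ae_of_all _ fun c => map_add_left_eq_self _ _
  have e3 := (volume_preserving_piFinSuccAbove (fun _ : Fin (n + 1) => ℂ) 0).symm
  have := e3.comp (Measure.measurePreserving_swap.comp
    (e2.comp (Measure.measurePreserving_swap.comp e1)))
  refine (congrArg (fun f => MeasurePreserving f (volume.prod volume) volume) ?_).mpr this
  funext p i
  refine Fin.cases ?_ (fun k => ?_) i
  · have := sum_mul_regMean hΔ p.1
    rw [Fin.sum_univ_succ] at this
    simp [affineVec] at this
    simp [rowSplit, fluct, MeasurableEquiv.piFinSuccAbove, Fin.insertNthEquiv, affineVec, add_mul,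
      Finset.sum_add_distrib]
    rw [← sub_eq_iff_eq_add.2 this.symm]
    simp_rw [mul_comm (u _)]
    ring
  · simp [rowSplit, fluct, MeasurableEquiv.piFinSuccAbove, Fin.insertNthEquiv]

end Row

end RowDecomposition

/-! ### Second moments of a row and of its conditioned part -/

section RowMoments

open scoped ComplexConjugate

section Entries

variable {ι : Type*} [Fintype ι] {τ : ℝ}

/-- The integral over `ℂ` of the weight of an entry. -/
def entryMass (τ : ℝ) : ℝ := Real.pi * √((1 + τ) * (1 - τ))

theorem entryMass_pos (h0 : 0 ≤ τ) (h1 : τ < 1) : 0 < entryMass τ := by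
  have : 0 < (1 + τ) * (1 - τ) := by apply mul_pos <;> linarith
  have := Real.pi_pos
  unfold entryMass
  positivity

theorem integral_rowWeight (h0 : 0 ≤ τ) :
    ∫ g : ι → ℂ, (rowWeight τ g : ℂ) = entryMass τ ^ Fintype.card ι := by
  have : ∀ g : ι → ℂ, (rowWeight τ g : ℂ) = ∏ k, (gaussWeight (1 + τ) (1 - τ) (g k) : ℂ) := fun g =>
    by simp [rowWeight]
  simp_rw [this]
  rw [integral_fintype_prod_volume_eq_prod fun _ c => (gaussWeight (1 + τ) (1 - τ) c : ℂ)]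
  simp [integral_gaussWeight (show (0 : ℝ) < 1 + τ by linarith), entryMass]

theorem rowWeight_le (h0 : 0 ≤ τ) (h1 : τ < 1) (g : ι → ℂ) :
    rowWeight τ g ≤ Real.exp (-(2⁻¹ * ∑ k, ‖g k‖ ^ 2)) := by
  rw [Finset.mul_sum, ← Finset.sum_neg_distrib, Real.exp_sum]
  refine Finset.prod_le_prod (fun _ _ => Real.exp_nonneg _) fun k _ => ?_
  exact gaussWeight_le (by linarith) (by linarith) (by linarith) (by linarith) _

variable [DecidableEq ι]

theorem integral_rowWeight_mul (h₁ h₂ : ℂ → ℂ) (i j : ι) :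
    ∫ g : ι → ℂ, (rowWeight τ g : ℂ) * (h₁ (g i) * h₂ (g j)) =
      ∏ k, ∫ c, (gaussWeight (1 + τ) (1 - τ) c : ℂ) *
        ((if k = i then h₁ c else 1) * (if k = j then h₂ c else 1)) := by
  rw [← integral_fintype_prod_volume_eq_prod (fun k c => (gaussWeight (1 + τ) (1 - τ) c : ℂ) *
        ((if k = i then h₁ c else 1) * (if k = j then h₂ c else 1)))]
  congr 1
  funext g
  rw [Finset.prod_mul_distrib, Finset.prod_mul_distrib, rowWeight]
  simp

theorem integral_rowWeight_mul_of_ne (h0 : 0 ≤ τ) (h1 : τ < 1) (h₂ : ℂ → ℂ) {i j : ι}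
    (hij : i ≠ j) : ∫ g : ι → ℂ, (rowWeight τ g : ℂ) * (g i * h₂ (g j)) = 0 := by
  rw [integral_rowWeight_mul (fun c => c) h₂]
  refine Finset.prod_eq_zero (Finset.mem_univ i) ?_
  simp [hij, integral_gaussWeight_mul_self (show (0 : ℝ) < 1 + τ by linarith)
    (show (0 : ℝ) < 1 - τ by linarith)]

theorem integral_rowWeight_mul_same (h0 : 0 ≤ τ) {h₁ h₂ : ℂ → ℂ} {t : ℂ} (i : ι)
    (h : ∫ c, (gaussWeight (1 + τ) (1 - τ) c : ℂ) * (h₁ c * h₂ c) = t * entryMass τ) :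
    ∫ g : ι → ℂ, (rowWeight τ g : ℂ) * (h₁ (g i) * h₂ (g i)) =
      t * entryMass τ ^ Fintype.card ι := by
  rw [integral_rowWeight_mul]
  have : ∀ k, ∫ c, (gaussWeight (1 + τ) (1 - τ) c : ℂ) *
        ((if k = i then h₁ c else 1) * (if k = i then h₂ c else 1)) =
      (if k = i then t else 1) * entryMass τ := fun k => by
    by_cases hk : k = i
    · simp only [hk, if_true]
      exact h
    · simp only [hk, if_false, mul_one, one_mul]
      rw [integral_gaussWeight (show (0 : ℝ) < 1 + τ by linarith), entryMass]
  simp_rw [this]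
  rw [Finset.prod_mul_distrib]
  simp

theorem integral_rowWeight_mul_conj (h0 : 0 ≤ τ) (h1 : τ < 1) (i j : ι) :
    ∫ g : ι → ℂ, (rowWeight τ g : ℂ) * (g i * conj (g j)) =
      (if i = j then 1 else 0) * entryMass τ ^ Fintype.card ι := by
  by_cases hij : i = j
  · subst hij
    rw [if_pos rfl]
    refine integral_rowWeight_mul_same (h₁ := fun c => c) (h₂ := fun c => conj c) h0 i ?_
    rw [integral_gaussWeight_mul_conj (show (0 : ℝ) < 1 + τ by linarith)
      (show (0 : ℝ) < 1 - τ by linarith), entryMass, ← Complex.ofReal_one, ← Complex.ofReal_mul]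
    congr 1
    ring
  · rw [integral_rowWeight_mul_of_ne h0 h1 (fun c => conj c) hij, if_neg hij, zero_mul]

theorem integral_rowWeight_mul_mul (h0 : 0 ≤ τ) (h1 : τ < 1) (i j : ι) :
    ∫ g : ι → ℂ, (rowWeight τ g : ℂ) * (g i * g j) =
      (if i = j then (τ : ℂ) else 0) * entryMass τ ^ Fintype.card ι := by
  by_cases hij : i = j
  · subst hij
    rw [if_pos rfl]
    refine integral_rowWeight_mul_same (h₁ := fun c => c) (h₂ := fun c => c) h0 i ?_
    rw [integral_gaussWeight_mul_sq (show (0 : ℝ) < 1 + τ by linarith)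
      (show (0 : ℝ) < 1 - τ by linarith), entryMass, ← Complex.ofReal_mul]
    congr 1
    ring
  · rw [integral_rowWeight_mul_of_ne h0 h1 (fun c => c) hij, if_neg hij, zero_mul]

end Entries

section Fluct

variable {n : ℕ} {τ : ℝ}

theorem integrable_rowWeight_mul (h0 : 0 ≤ τ) (h1 : τ < 1) {m : ℕ} {f : (Fin m → ℂ) → ℂ}
    (hf : Continuous f) {A C : ℝ} (hA : 0 ≤ A) (hC : 0 ≤ C)
    (h : ∀ g, ‖f g‖ ≤ A + C * ∑ k, ‖g k‖ ^ 2) :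
    Integrable fun g : Fin m → ℂ => (rowWeight τ g : ℂ) * f g := by
  refine integrable_of_norm_le_pi (A := A) (C := C) (ε := 2⁻¹)
    ((Complex.continuous_ofReal.comp (continuous_rowWeight τ)).mul hf) hA hC
    (by norm_num) fun g => ?_
  rw [norm_mul, mul_comm, Complex.norm_real, Real.norm_of_nonneg (rowWeight_nonneg τ g)]
  exact mul_le_mul (h g) (rowWeight_le h0 h1 g) (rowWeight_nonneg τ g) (by positivity)

theorem sum_norm_sq_le_fluct (u β : Fin n → ℂ) : ∑ k, ‖β k‖ ^ 2 ≤ ∑ k, ‖fluct u β k‖ ^ 2 := by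
  rw [Fin.sum_univ_succ]
  simp [fluct]

theorem fluct_sum_norm_sq_le (u β : Fin n → ℂ) :
    ∑ k, ‖fluct u β k‖ ^ 2 ≤ sumNormSq (affineVec u) * ∑ k, ‖β k‖ ^ 2 := by
  have h1 : ‖∑ k, β k * u k‖ ^ 2 ≤ (∑ k, ‖β k‖ ^ 2) * ∑ k, ‖u k‖ ^ 2 := by
    calc ‖∑ k, β k * u k‖ ^ 2 ≤ (∑ k, ‖β k‖ * ‖u k‖) ^ 2 := by
          gcongr
          refine (norm_sum_le _ _).trans ?_
          simp
      _ ≤ _ := Finset.sum_mul_sq_le_sq_mul_sq _ _ _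
  rw [Fin.sum_univ_succ, sumNormSq, Fin.sum_univ_succ]
  simp only [fluct, affineVec, Fin.cons_zero, Fin.cons_succ, norm_neg, norm_one]
  linarith

theorem integrable_rowWeight_fluct_mul (h0 : 0 ≤ τ) (h1 : τ < 1) (u : Fin n → ℂ)
    {f : (Fin (n + 1) → ℂ) → ℂ} (hf : Continuous f) {A C : ℝ} (hA : 0 ≤ A) (hC : 0 ≤ C)
    (h : ∀ g, ‖f g‖ ≤ A + C * ∑ k, ‖g k‖ ^ 2) :
    Integrable fun β : Fin n → ℂ => (rowWeight τ (fluct u β) : ℂ) * f (fluct u β) := by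
  have hS := sumNormSq_nonneg (affineVec u)
  refine integrable_of_norm_le_pi (A := A) (C := C * sumNormSq (affineVec u)) (ε := 2⁻¹)
    ((Complex.continuous_ofReal.comp ((continuous_rowWeight τ).comp (continuous_fluct u))).mul
      (hf.comp (continuous_fluct u))) hA (by positivity) (by norm_num) fun β => ?_
  rw [norm_mul, mul_comm, Complex.norm_real, Real.norm_of_nonneg (rowWeight_nonneg τ _)]
  refine mul_le_mul ((h _).trans ?_) ((rowWeight_le h0 h1 _).trans ?_) (rowWeight_nonneg τ _)
    (by positivity)
  · have := mul_le_mul_of_nonneg_left (fluct_sum_norm_sq_le u β) hC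
    linarith
  · have := sum_norm_sq_le_fluct u β
    gcongr

theorem norm_mul_le_sum {m : ℕ} (g : Fin m → ℂ) (i j : Fin m) :
    ‖g i‖ * ‖g j‖ ≤ ∑ k, ‖g k‖ ^ 2 := by
  have h : ∀ i, ‖g i‖ ^ 2 ≤ ∑ k, ‖g k‖ ^ 2 := fun i =>
    Finset.single_le_sum (f := fun k => ‖g k‖ ^ 2) (fun _ _ => by positivity) (Finset.mem_univ i)
  nlinarith [h i, h j, sq_nonneg (‖g i‖ - ‖g j‖)]

theorem norm_le_one_add_sum {m : ℕ} (g : Fin m → ℂ) (i : Fin m) :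
    ‖g i‖ ≤ 1 + 1 * ∑ k, ‖g k‖ ^ 2 := by
  have h := norm_mul_le_sum g i i
  nlinarith [sq_nonneg (‖g i‖ - 1)]

/-- The total mass of the Gaussian weight on the fluctuations orthogonal to `(1, u)`. -/
def fluctMass (τ : ℝ) (u : Fin n → ℂ) : ℂ := ∫ β : Fin n → ℂ, (rowWeight τ (fluct u β) : ℂ)

/-- The conditional covariance `E[gᵢ ḡⱼ] - E[gᵢ] E[ḡⱼ]` of a row `g` given `g ⬝ w`, where the
entries of `g` have `E |gᵢ|² = 1`. It does not depend on the value of `g ⬝ w`. -/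
def condCov (τ : ℝ) {m : ℕ} (w : Fin m → ℂ) (i j : Fin m) : ℂ :=
  (if i = j then 1 else 0) - regP τ w i * w j - τ * regR τ w i * conj (w j)

/-- Odd functions of the fluctuations have mean zero. -/
theorem integral_rowWeight_fluct_mul_self (u : Fin n → ℂ) (h : ℂ → ℂ)
    (hh : ∀ c, h (-c) = -h c) (i : Fin (n + 1)) :
    ∫ β : Fin n → ℂ, (rowWeight τ (fluct u β) : ℂ) * h (fluct u β i) = 0 := by
  have := integral_neg_eq_self
    (fun β : Fin n → ℂ => (rowWeight τ (fluct u β) : ℂ) * h (fluct u β i)) volume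
  simp only [fluct_neg, rowWeight_neg, Pi.neg_apply, hh, mul_neg, integral_neg] at this
  linear_combination (1 / 2 : ℂ) * (-this)

/-- Integrals over a row, with `g ⬝ (1, u)` and the fluctuations as independent variables. -/
theorem integral_rowWeight_mul_eq_rowSplit (h0 : 0 ≤ τ) (h1 : τ < 1) (u : Fin n → ℂ)
    {f : (Fin (n + 1) → ℂ) → ℂ} (hf : Continuous f) :
    ∫ g, (rowWeight τ g : ℂ) * f g = ∫ p : ℂ × (Fin n → ℂ),
      (pairingWeight τ (affineVec u) p.1 : ℂ) * (rowWeight τ (fluct u p.2) : ℂ) *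
        f (regMean τ (affineVec u) p.1 + fluct u p.2) ∂(volume.prod volume) := by
  have hmp := measurePreserving_rowSplit h0 h1 u
  have hc : Continuous fun g : Fin (n + 1) → ℂ => (rowWeight τ g : ℂ) * f g :=
    (Complex.continuous_ofReal.comp (continuous_rowWeight τ)).mul hf
  rw [← hmp.map_eq, integral_map hmp.measurable.aemeasurable hc.aestronglyMeasurable]
  congr 1
  funext p
  simp only [rowSplit]
  rw [rowWeight_regMean_add h0 h1 (sumNormSq_affineVec_pos u) _ (sum_affineVec_mul_fluct u p.2)]
  push_cast
  ring

theorem sum_affineVec_mul_add (h0 : 0 ≤ τ) (h1 : τ < 1) (u β : Fin n → ℂ) (c : ℂ) :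
    ∑ i, affineVec u i * (regMean τ (affineVec u) c + fluct u β) i = c := by
  simp only [Pi.add_apply, mul_add]
  rw [Finset.sum_add_distrib, sum_affineVec_mul_fluct,
    sum_mul_regMean (covDet_pos h0 h1 (sumNormSq_affineVec_pos u)).ne', add_zero]

/-- The moments of `c = g ⬝ (1, u)` computed from those of a row `g`. -/
theorem integral_pairingWeight_mul_mul_fluctMass (h0 : 0 ≤ τ) (h1 : τ < 1) (u : Fin n → ℂ)
    {f : ℂ → ℂ} (hf : Continuous f) :
    (∫ c, (pairingWeight τ (affineVec u) c : ℂ) * f c) * fluctMass τ u =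
      ∫ g : Fin (n + 1) → ℂ, (rowWeight τ g : ℂ) * f (∑ i, affineVec u i * g i) := by
  rw [integral_rowWeight_mul_eq_rowSplit h0 h1 u (f := fun g => f (∑ i, affineVec u i * g i))
    (by fun_prop), fluctMass, ← integral_prod_mul]
  congr 1
  funext p
  rw [sum_affineVec_mul_add h0 h1]
  ring

theorem integral_pairingWeight_mul_fluctMass (h0 : 0 ≤ τ) (h1 : τ < 1) (u : Fin n → ℂ) :
    (∫ c, (pairingWeight τ (affineVec u) c : ℂ)) * fluctMass τ u =
      entryMass τ ^ (n + 1) := by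
  have := integral_pairingWeight_mul_mul_fluctMass h0 h1 u (f := fun _ => 1) continuous_const
  simpa [integral_rowWeight h0] using this

theorem fluctMass_eq (h0 : 0 ≤ τ) (h1 : τ < 1) (u : Fin n → ℂ) :
    fluctMass τ u = (entryMass τ ^ (n + 1) / (Real.pi * √(covDet τ (affineVec u))) : ℝ) := by
  have h := integral_pairingWeight_mul_fluctMass h0 h1 u
  have hw := sumNormSq_affineVec_pos u
  rw [integral_pairingWeight h0 h1 hw] at h
  have := covDet_pos h0 h1 hw
  have := Real.pi_pos
  have h2 : ((Real.pi * √(covDet τ (affineVec u)) : ℝ) : ℂ) ≠ 0 := by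
    have : Real.pi * √(covDet τ (affineVec u)) ≠ 0 := by positivity
    exact_mod_cast this
  rw [Complex.ofReal_div, eq_div_iff h2, mul_comm, h]
  push_cast
  rfl

theorem integral_rowWeight_mul_sum_mul_sum (h0 : 0 ≤ τ) (h1 : τ < 1) (w : Fin (n + 1) → ℂ) :
    ∫ g : Fin (n + 1) → ℂ, (rowWeight τ g : ℂ) * ((∑ i, w i * g i) * (∑ i, w i * g i)) =
      τ * sumSq w * entryMass τ ^ (n + 1) := by
  have hint : ∀ i j, Integrable fun g : Fin (n + 1) → ℂ =>
      (rowWeight τ g : ℂ) * (g i * g j) := fun i j =>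
    integrable_rowWeight_mul h0 h1 (A := 0) (C := 1) (by fun_prop) le_rfl zero_le_one fun g => by
      rw [norm_mul]; simpa using norm_mul_le_sum g i j
  have e : ∀ g : Fin (n + 1) → ℂ,
      (rowWeight τ g : ℂ) * ((∑ i, w i * g i) * (∑ i, w i * g i)) =
        ∑ i, ∑ j, w i * w j * ((rowWeight τ g : ℂ) * (g i * g j)) := fun g => by
    rw [Finset.sum_mul_sum, Finset.mul_sum]
    simp_rw [Finset.mul_sum]
    refine Finset.sum_congr rfl fun i _ => Finset.sum_congr rfl fun j _ => by ring
  simp_rw [e]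
  rw [integral_finsetSum _ fun i _ => integrable_finsetSum _ fun j _ => (hint i j).const_mul _]
  simp_rw [integral_finsetSum _ fun j _ => (hint _ j).const_mul _, integral_const_mul,
    integral_rowWeight_mul_mul h0 h1]
  simp [sumSq, Finset.mul_sum, Finset.sum_mul, sq]
  exact Finset.sum_congr rfl fun i _ => by ring

theorem integral_rowWeight_mul_conj_sum_mul_sum (h0 : 0 ≤ τ) (h1 : τ < 1)
    (w : Fin (n + 1) → ℂ) :
    ∫ g : Fin (n + 1) → ℂ, (rowWeight τ g : ℂ) * (conj (∑ i, w i * g i) * conj (∑ i, w i * g i)) =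
      τ * conj (sumSq w) * entryMass τ ^ (n + 1) := by
  have := congrArg conj (integral_rowWeight_mul_sum_mul_sum h0 h1 w)
  rw [← integral_conj] at this
  simp only [map_mul, Complex.conj_ofReal, map_pow] at this
  exact this

theorem integral_rowWeight_mul_sum_mul_conj_sum (h0 : 0 ≤ τ) (h1 : τ < 1) (w : Fin (n + 1) → ℂ) :
    ∫ g : Fin (n + 1) → ℂ, (rowWeight τ g : ℂ) * ((∑ i, w i * g i) * conj (∑ i, w i * g i)) =
      sumNormSq w * entryMass τ ^ (n + 1) := by
  have hint : ∀ i j, Integrable fun g : Fin (n + 1) → ℂ =>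
      (rowWeight τ g : ℂ) * (g i * conj (g j)) := fun i j =>
    integrable_rowWeight_mul h0 h1 (A := 0) (C := 1) (by fun_prop) le_rfl zero_le_one fun g => by
      rw [norm_mul, RCLike.norm_conj]; simpa using norm_mul_le_sum g i j
  have e : ∀ g : Fin (n + 1) → ℂ,
      (rowWeight τ g : ℂ) * ((∑ i, w i * g i) * conj (∑ i, w i * g i)) =
        ∑ i, ∑ j, w i * conj (w j) * ((rowWeight τ g : ℂ) * (g i * conj (g j))) := fun g => by
    rw [map_sum, Finset.sum_mul_sum, Finset.mul_sum]
    simp_rw [Finset.mul_sum]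
    refine Finset.sum_congr rfl fun i _ => Finset.sum_congr rfl fun j _ => by
      rw [map_mul]; ring
  simp_rw [e]
  rw [integral_finsetSum _ fun i _ => integrable_finsetSum _ fun j _ => (hint i j).const_mul _]
  simp_rw [integral_finsetSum _ fun j _ => (hint _ j).const_mul _, integral_const_mul,
    integral_rowWeight_mul_conj h0 h1, ← sum_mul_conj_eq]
  simp [Finset.sum_mul]

/-- With `sumSq_mul_conj_regP_add`, the normal equations of the regression of `g` on `g ⬝ w` and
its conjugate. -/
theorem sumNormSq_mul_conj_regP_add {m : ℕ} {w : Fin m → ℂ} (hΔ : covDet τ w ≠ 0) (j : Fin m) :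
    sumNormSq w * conj (regP τ w j) + τ * sumSq w * conj (regR τ w j) = w j := by
  have hΔ' : (covDet τ w : ℂ) ≠ 0 := by exact_mod_cast hΔ
  simp only [regP, regR, map_div₀, map_sub, map_mul, Complex.conj_conj, Complex.conj_ofReal,
    map_pow]
  field_simp
  rw [covDet_ofReal]
  ring

theorem sumSq_mul_conj_regP_add {m : ℕ} {w : Fin m → ℂ} (hΔ : covDet τ w ≠ 0) (j : Fin m) :
    τ * conj (sumSq w) * conj (regP τ w j) + sumNormSq w * conj (regR τ w j) =
      τ * conj (w j) := by
  have hΔ' : (covDet τ w : ℂ) ≠ 0 := by exact_mod_cast hΔ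
  simp only [regP, regR, map_div₀, map_sub, map_mul, Complex.conj_conj, Complex.conj_ofReal,
    map_pow]
  field_simp
  rw [covDet_ofReal]
  ring

/-- The second moments of the fluctuations: those of the row minus those of the conditional
mean. -/
theorem integral_rowWeight_fluct_mul_conj (h0 : 0 ≤ τ) (h1 : τ < 1) (u : Fin n → ℂ)
    (i j : Fin (n + 1)) :
    ∫ β : Fin n → ℂ, (rowWeight τ (fluct u β) : ℂ) * (fluct u β i * conj (fluct u β j)) =
      fluctMass τ u * condCov τ (affineVec u) i j := by
  set w := affineVec u with hwdef
  have hw : 0 < sumNormSq w := sumNormSq_affineVec_pos u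
  have hΔ := (covDet_pos h0 h1 hw).ne'
  set A := ∫ c, (pairingWeight τ w c : ℂ) with hA
  set Q := ∫ β : Fin n → ℂ, (rowWeight τ (fluct u β) : ℂ) * (fluct u β i * conj (fluct u β j))
    with hQ
  have hAm : A * fluctMass τ u = entryMass τ ^ (n + 1) :=
    integral_pairingWeight_mul_fluctMass h0 h1 u
  -- the second moments of `c = g ⬝ w`
  have hA11 := (integral_pairingWeight_mul_mul_fluctMass h0 h1 u (f := fun c => c * conj c)
    (by fun_prop)).trans (integral_rowWeight_mul_sum_mul_conj_sum h0 h1 _)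
  have hA20 := (integral_pairingWeight_mul_mul_fluctMass h0 h1 u (f := fun c => c * c)
    (by fun_prop)).trans (integral_rowWeight_mul_sum_mul_sum h0 h1 _)
  have hA02 := (integral_pairingWeight_mul_mul_fluctMass h0 h1 u
    (f := fun c => conj c * conj c)
    (by fun_prop)).trans (integral_rowWeight_mul_conj_sum_mul_sum h0 h1 _)
  rw [← hwdef] at hA11 hA20 hA02
  -- the second moment of the whole row, expanded below into a part from the conditional mean, a
  -- part from the fluctuations, and cross terms
  have hrow := integral_rowWeight_mul_conj h0 h1 i j
  rw [integral_rowWeight_mul_eq_rowSplit h0 h1 u (f := fun g => g i * conj (g j)) (by fun_prop),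
    ← hwdef] at hrow
  have hlin : ∀ i c, ‖regMean τ w c i‖ ≤ (‖regP τ w i‖ + ‖regR τ w i‖) * ‖c‖ := fun i c => by
    unfold regMean
    refine (norm_add_le _ _).trans ?_
    rw [norm_mul, norm_mul, RCLike.norm_conj]
    linarith
  have hp1 : Integrable fun c => (pairingWeight τ w c : ℂ) *
      (regMean τ w c i * conj (regMean τ w c j)) := by
    refine integrable_pairingWeight_mul h0 h1 hw ((continuous_regMean τ w i).mul
      (Complex.continuous_conj.comp (continuous_regMean τ w j))) (A := 0)
      (C := (‖regP τ w i‖ + ‖regR τ w i‖) * (‖regP τ w j‖ + ‖regR τ w j‖)) le_rfl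
      (by positivity) fun c => ?_
    rw [norm_mul, RCLike.norm_conj]
    refine (mul_le_mul (hlin i c) (hlin j c) (norm_nonneg _) (by positivity)).trans ?_
    apply le_of_eq
    ring
  have hp2 : ∀ i, Integrable fun c => (pairingWeight τ w c : ℂ) * regMean τ w c i := fun i => by
    refine integrable_pairingWeight_mul h0 h1 hw (continuous_regMean τ w i)
      (A := ‖regP τ w i‖ + ‖regR τ w i‖) (C := ‖regP τ w i‖ + ‖regR τ w i‖) (by positivity)
      (by positivity) fun c => (hlin i c).trans ?_
    have : ‖c‖ ≤ 1 + ‖c‖ ^ 2 := by nlinarith [sq_nonneg (‖c‖ - 1)]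
    have := mul_le_mul_of_nonneg_left this
      (show 0 ≤ ‖regP τ w i‖ + ‖regR τ w i‖ by positivity)
    linarith
  have hp2' : Integrable fun c => (pairingWeight τ w c : ℂ) * conj (regMean τ w c j) := by
    have := (Complex.conjLIE.toContinuousLinearEquiv.integrable_comp_iff).2 (hp2 j)
    refine this.congr (ae_of_all _ fun c => ?_)
    simp
  have hp0 : Integrable fun c => (pairingWeight τ w c : ℂ) := by
    have := integrable_pairingWeight_mul h0 h1 hw (f := fun _ => 1) continuous_const (A := 1)
      (C := 0) zero_le_one le_rfl (by simp)
    simpa using this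
  have hr0 : Integrable fun β : Fin n → ℂ => (rowWeight τ (fluct u β) : ℂ) := by
    have := integrable_rowWeight_fluct_mul h0 h1 u (f := fun _ => 1) continuous_const (A := 1)
      (C := 0) zero_le_one le_rfl (by simp)
    simpa using this
  have hr1 : Integrable fun β : Fin n → ℂ => (rowWeight τ (fluct u β) : ℂ) * fluct u β i :=
    integrable_rowWeight_fluct_mul h0 h1 u (f := fun g => g i) (by fun_prop) zero_le_one
      zero_le_one fun g => norm_le_one_add_sum g i
  have hr1' : Integrable fun β : Fin n → ℂ =>
      (rowWeight τ (fluct u β) : ℂ) * conj (fluct u β j) :=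
    integrable_rowWeight_fluct_mul h0 h1 u (f := fun g => conj (g j)) (by fun_prop) zero_le_one
      zero_le_one fun g => by rw [RCLike.norm_conj]; exact norm_le_one_add_sum g j
  have hr2 : Integrable fun β : Fin n → ℂ =>
      (rowWeight τ (fluct u β) : ℂ) * (fluct u β i * conj (fluct u β j)) :=
    integrable_rowWeight_fluct_mul h0 h1 u (f := fun g => g i * conj (g j)) (by fun_prop)
      (A := 0) (C := 1) le_rfl zero_le_one fun g => by
        rw [norm_mul, RCLike.norm_conj]; simpa using norm_mul_le_sum g i j
  have e : ∀ p : ℂ × (Fin n → ℂ),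
      (pairingWeight τ w p.1 : ℂ) * (rowWeight τ (fluct u p.2) : ℂ) *
        ((regMean τ w p.1 + fluct u p.2) i * conj ((regMean τ w p.1 + fluct u p.2) j)) =
      ((pairingWeight τ w p.1 : ℂ) * (regMean τ w p.1 i * conj (regMean τ w p.1 j)) *
          (rowWeight τ (fluct u p.2) : ℂ) +
        (pairingWeight τ w p.1 : ℂ) *
          ((rowWeight τ (fluct u p.2) : ℂ) * (fluct u p.2 i * conj (fluct u p.2 j)))) +
      ((pairingWeight τ w p.1 : ℂ) * regMean τ w p.1 i *
          ((rowWeight τ (fluct u p.2) : ℂ) * conj (fluct u p.2 j)) +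
        (pairingWeight τ w p.1 : ℂ) * conj (regMean τ w p.1 j) *
          ((rowWeight τ (fluct u p.2) : ℂ) * fluct u p.2 i)) := fun p => by
    simp only [Pi.add_apply, map_add]
    ring
  simp_rw [e] at hrow
  have i1 := hp1.mul_prod hr0
  have i2 := hp0.mul_prod hr2
  have i3 := (hp2 i).mul_prod hr1'
  have i4 := hp2'.mul_prod hr1
  rw [integral_add, integral_add i1 i2, integral_add i3 i4] at hrow
  rotate_left
  · exact i1.add i2
  · exact i3.add i4
  rw [integral_prod_mul (fun c => (pairingWeight τ w c : ℂ) *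
      (regMean τ w c i * conj (regMean τ w c j))) (fun β => (rowWeight τ (fluct u β) : ℂ)),
    integral_prod_mul (fun c => (pairingWeight τ w c : ℂ))
      (fun β => (rowWeight τ (fluct u β) : ℂ) * (fluct u β i * conj (fluct u β j))),
    integral_prod_mul (fun c => (pairingWeight τ w c : ℂ) * regMean τ w c i)
      (fun β => (rowWeight τ (fluct u β) : ℂ) * conj (fluct u β j)),
    integral_prod_mul (fun c => (pairingWeight τ w c : ℂ) * conj (regMean τ w c j))
      (fun β => (rowWeight τ (fluct u β) : ℂ) * fluct u β i)] at hrow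
  -- the cross terms vanish because the fluctuations are symmetric
  rw [integral_rowWeight_fluct_mul_self u (fun c => c) (fun c => rfl) i,
    integral_rowWeight_fluct_mul_self u (fun c => conj c) (fun c => map_neg _ c) j,
    ← hA, ← hQ, mul_zero, mul_zero, add_zero, add_zero] at hrow
  -- the part from the conditional mean
  have hmm : (∫ c, (pairingWeight τ w c : ℂ) * (regMean τ w c i * conj (regMean τ w c j))) *
      fluctMass τ u = (regP τ w i * w j + τ * regR τ w i * conj (w j)) *
        entryMass τ ^ (n + 1) := by
    have j11 : Integrable fun c => (pairingWeight τ w c : ℂ) * (c * conj c) :=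
      integrable_pairingWeight_mul h0 h1 hw (by fun_prop) (A := 0) (C := 1) le_rfl zero_le_one
        fun c => by rw [norm_mul, RCLike.norm_conj]; simp [sq]
    have j20 : Integrable fun c => (pairingWeight τ w c : ℂ) * (c * c) :=
      integrable_pairingWeight_mul h0 h1 hw (by fun_prop) (A := 0) (C := 1) le_rfl zero_le_one
        fun c => by rw [norm_mul]; simp [sq]
    have j02 : Integrable fun c => (pairingWeight τ w c : ℂ) * (conj c * conj c) :=
      integrable_pairingWeight_mul h0 h1 hw (by fun_prop) (A := 0) (C := 1) le_rfl zero_le_one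
        fun c => by rw [norm_mul, RCLike.norm_conj]; simp [sq]
    have e2 : ∀ c, (pairingWeight τ w c : ℂ) * (regMean τ w c i * conj (regMean τ w c j)) =
        (pairingWeight τ w c : ℂ) * (c * conj c) *
            (regP τ w i * conj (regP τ w j) + regR τ w i * conj (regR τ w j)) +
          ((pairingWeight τ w c : ℂ) * (c * c) * (regP τ w i * conj (regR τ w j)) +
          (pairingWeight τ w c : ℂ) * (conj c * conj c) * (regR τ w i * conj (regP τ w j))) :=
      fun c => by
        simp only [regMean, map_add, map_mul, Complex.conj_conj]
        ring
    simp_rw [e2]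
    rw [integral_add, integral_add (j20.mul_const _) (j02.mul_const _), integral_mul_const,
      integral_mul_const, integral_mul_const]
    rotate_left
    · exact j11.mul_const _
    · exact (j20.mul_const _).add (j02.mul_const _)
    have k1 := sumNormSq_mul_conj_regP_add hΔ j
    have k2 := sumSq_mul_conj_regP_add hΔ j
    linear_combination (regP τ w i * conj (regP τ w j) + regR τ w i * conj (regR τ w j)) * hA11 +
      (regP τ w i * conj (regR τ w j)) * hA20 + (regR τ w i * conj (regP τ w j)) * hA02 +
      (entryMass τ : ℂ) ^ (n + 1) * regP τ w i * k1 +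
      (entryMass τ : ℂ) ^ (n + 1) * regR τ w i * k2
  have hA0 : A ≠ 0 := by
    intro h
    rw [h, zero_mul] at hAm
    have : (entryMass τ : ℂ) ^ (n + 1) ≠ 0 :=
      pow_ne_zero _ (by exact_mod_cast (entryMass_pos h0 h1).ne')
    exact this hAm.symm
  refine mul_left_cancel₀ hA0 ?_
  unfold condCov
  rw [Fintype.card_fin] at hrow
  change _ * fluctMass τ u + A * Q = _ at hrow
  rw [hmm] at hrow
  linear_combination hrow - ((if i = j then 1 else 0) - regP τ w i * w j -
    τ * regR τ w i * conj (w j)) * hAm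

end Fluct

end RowMoments

/-! ### The averaged determinant as a rank two perturbation -/

section Determinant

open scoped ComplexConjugate

/-- The characteristic determinant of a product does not depend on the order of the factors, up
to a power of the scalar. -/
theorem det_smul_one_add_mul {n : ℕ} (L : Matrix (Fin n) (Fin 2) ℂ) (M : Matrix (Fin 2) (Fin n) ℂ)
    {x : ℂ} (hx : x ≠ 0) :
    Matrix.det (x • (1 : Matrix (Fin n) (Fin n) ℂ) + L * M) * x ^ 2 =
      x ^ n * Matrix.det (x • (1 : Matrix (Fin 2) (Fin 2) ℂ) + M * L) := by
  have h1 : x • (1 : Matrix (Fin n) (Fin n) ℂ) + L * M = x • (1 + (x⁻¹ • L) * M) := by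
    rw [smul_add, Matrix.smul_mul, smul_smul, mul_inv_cancel₀ hx, one_smul]
  have h2 : x • (1 : Matrix (Fin 2) (Fin 2) ℂ) + M * L = x • (1 + M * (x⁻¹ • L)) := by
    rw [smul_add, Matrix.mul_smul, smul_smul, mul_inv_cancel₀ hx, one_smul]
  rw [h1, h2, Matrix.det_smul, Matrix.det_smul, Matrix.det_one_add_mul_comm]
  simp
  ring

section

variable {m : ℕ} {τ : ℝ} {w : Fin m → ℂ}

/-- The conditional mean of `z - G + w w^* / |w|²` given `G w = z w`. The rank one term replaces
the eigenvalue zero of `z - G` on `w` by one. -/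
def meanMatrix (τ : ℝ) (w : Fin m → ℂ) (z : ℂ) (r i : Fin m) : ℂ :=
  (if r = i then z else 0) + w r * conj (w i) / sumNormSq w - regMean τ w (z * w r) i

/-- The conditional variance of `g ⬝ e` for a row `g` given `g ⬝ w`, where `e` is a unit vector in
the span of `w` and its conjugate which is orthogonal to `w` in the Hermitian sense. On the unit
sphere it equals `(1 - τ²) / D`. -/
def condVar (τ : ℝ) (w : Fin m → ℂ) : ℝ := (1 - τ ^ 2) * sumNormSq w ^ 2 / covDet τ w

/-- The coefficient of `conj z` in the determinant of
`det_condCov_add_meanMatrix`; it measures the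
part of the conditional mean which is antilinear in `z`. -/
def condShift (τ : ℝ) (w : Fin m → ℂ) : ℝ :=
  τ * (sumNormSq w ^ 2 - ‖sumSq w‖ ^ 2) / covDet τ w

/-- The mean matrix differs from `z` by `w pᵀ + w̄ qᵀ`, so that its product with its adjoint is
explicit. -/
theorem sum_meanMatrix_mul_conj (τ : ℝ) (w : Fin m → ℂ) (z : ℂ) (p q : Fin m → ℂ)
    (h : ∀ r i, meanMatrix τ w z r i = (if r = i then z else 0) + (w r * p i + conj (w r) * q i))
    (i j : Fin m) :
    ∑ r, meanMatrix τ w z r i * conj (meanMatrix τ w z r j) =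
      (if i = j then z * conj z else 0) +
        z * (conj (w i) * conj (p j) + w i * conj (q j)) +
        conj z * (w j * p i + conj (w j) * q i) +
        (sumNormSq w * (p i * conj (p j)) + sumSq w * (p i * conj (q j)) +
          conj (sumSq w) * (q i * conj (p j)) + sumNormSq w * (q i * conj (q j))) := by
  have e : ∀ r, meanMatrix τ w z r i * conj (meanMatrix τ w z r j) =
      (if r = i then (if r = j then z * conj z else 0) else 0) +
      (if r = i then z * (conj (w r) * conj (p j) + w r * conj (q j)) else 0) +
      (if r = j then conj z * (w r * p i + conj (w r) * q i) else 0) +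
      (w r * conj (w r) * (p i * conj (p j)) + w r ^ 2 * (p i * conj (q j)) +
        conj (w r ^ 2) * (q i * conj (p j)) + w r * conj (w r) * (q i * conj (q j))) := fun r => by
    rw [h, h]
    have hz : conj (if r = j then z else 0) = if r = j then conj z else 0 := by
      split_ifs <;> simp
    simp only [map_add, map_mul, hz, Complex.conj_conj, map_pow]
    by_cases h1 : r = i
    · by_cases h2 : r = j
      · simp only [if_pos h1, if_pos h2]; ring
      · simp only [if_pos h1, if_neg h2]; ring
    · by_cases h2 : r = j
      · simp only [if_neg h1, if_pos h2]; ring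
      · simp only [if_neg h1, if_neg h2]; ring
  simp_rw [e]
  simp only [Finset.sum_add_distrib, Finset.sum_ite_eq', Finset.mem_univ,
    if_true, ← Finset.sum_mul, sum_mul_conj_eq, ← map_sum]
  rfl

/-- The determinant to be averaged is that of a rank two perturbation of a multiple of the
identity, in the span of `w` and `conj w`. The determinant is multiplied by `(t + |z|²)²` because
the exponent `m - 2` may be negative. -/
theorem det_condCov_add_meanMatrix (h0 : 0 ≤ τ) (h1 : τ < 1) (hw : 0 < sumNormSq w) (z : ℂ)
    {t : ℝ} (ht : 0 < t) :
    Matrix.det (Matrix.of fun i j => (t : ℂ) * condCov τ w i j +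
        ∑ r, meanMatrix τ w z r i * conj (meanMatrix τ w z r j)) * ((t : ℂ) + ‖z‖ ^ 2) ^ 2 =
      ((t : ℂ) + ‖z‖ ^ 2) ^ m *
        (t * condVar τ w + (z - condShift τ w * conj z) * conj (z - condShift τ w * conj z)) := by
  have hΔ := (covDet_pos h0 h1 hw).ne'
  have hΔ' : (covDet τ w : ℂ) ≠ 0 := by exact_mod_cast hΔ
  have hS : (sumNormSq w : ℂ) ≠ 0 := by exact_mod_cast hw.ne'
  have hx : (t : ℂ) + ‖z‖ ^ 2 ≠ 0 := by
    have : t + ‖z‖ ^ 2 ≠ 0 := by positivity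
    exact_mod_cast this
  set S : ℂ := ((sumNormSq w : ℝ) : ℂ) with hSdef
  set σ : ℂ := sumSq w with hσ
  set Δ : ℂ := ((covDet τ w : ℝ) : ℂ) with hΔdef
  have hSc : conj S = S := Complex.conj_ofReal _
  have hΔc : conj Δ = Δ := Complex.conj_ofReal _
  have hΔeq : Δ = S ^ 2 - τ ^ 2 * (σ * conj σ) := covDet_ofReal τ w
  -- the coefficients of the mean matrix in the span of `w` and `conj w`
  set a : ℂ := 1 / S - z * S / Δ with ha
  set b : ℂ := z * τ ^ 2 * conj σ / Δ with hb
  set c : ℂ := conj z * τ * σ / Δ with hc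
  set d : ℂ := -(conj z * τ * S) / Δ with hd
  have hac : conj a = 1 / S - conj z * S / Δ := by
    simp only [ha, map_sub, map_div₀, map_mul, map_one, hSc, hΔc]
  have hbc : conj b = conj z * τ ^ 2 * σ / Δ := by
    simp only [hb, map_div₀, map_mul, map_pow, Complex.conj_ofReal, Complex.conj_conj, hΔc]
  have hcc : conj c = z * τ * conj σ / Δ := by
    simp only [hc, map_div₀, map_mul, Complex.conj_ofReal, Complex.conj_conj, hΔc]
  have hdc : conj d = -(z * τ * S) / Δ := by
    simp only [hd, map_div₀, map_mul, map_neg, Complex.conj_ofReal, Complex.conj_conj, hΔc, hSc]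
  have hform := sum_meanMatrix_mul_conj τ w z (fun i => a * conj (w i) + b * w i)
    (fun i => c * conj (w i) + d * w i) (fun r i => by
      simp only [meanMatrix, regMean, regP, regR, map_mul, ← hSdef, ← hσ, ← hΔdef, ha, hb, hc, hd]
      ring)
  -- the perturbation is `L Y L'` with a `2 × 2` matrix `Y`; its determinant is then computed from
  -- the Gram matrix `L' L`
  let L : Matrix (Fin m) (Fin 2) ℂ := Matrix.of fun i => ![conj (w i), w i]
  let Y : Matrix (Fin 2) (Fin 2) ℂ := !![
    z * conj a + conj z * a + (S * (a * conj a) + σ * (a * conj c) + conj σ * (c * conj a) +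
      S * (c * conj c)) - t * S / Δ,
    z * conj b + conj z * c + (S * (a * conj b) + σ * (a * conj d) + conj σ * (c * conj b) +
      S * (c * conj d)) + t * τ ^ 2 * σ / Δ;
    z * conj c + conj z * b + (S * (b * conj a) + σ * (b * conj c) + conj σ * (d * conj a) +
      S * (d * conj c)) + t * τ ^ 2 * conj σ / Δ,
    z * conj d + conj z * d + (S * (b * conj b) + σ * (b * conj d) + conj σ * (d * conj b) +
      S * (d * conj d)) - t * τ ^ 2 * S / Δ]
  let L' : Matrix (Fin 2) (Fin m) ℂ := Matrix.of ![fun j => w j, fun j => conj (w j)]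
  have hmat : (Matrix.of fun i j => (t : ℂ) * condCov τ w i j +
        ∑ r, meanMatrix τ w z r i * conj (meanMatrix τ w z r j)) =
      ((t : ℂ) + ‖z‖ ^ 2) • (1 : Matrix (Fin m) (Fin m) ℂ) + L * (Y * L') := by
    ext i j
    rw [Matrix.of_apply, hform i j]
    simp only [Matrix.add_apply, Matrix.smul_apply, Matrix.one_apply, Matrix.mul_apply,
      Fin.sum_univ_two, smul_eq_mul, condCov, regP, regR, ← hSdef, ← hσ, ← hΔdef, L, L', Y,
      Matrix.of_apply, Matrix.cons_val_zero, Matrix.cons_val_one, map_add, map_mul,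
      Complex.conj_conj, ← Complex.mul_conj']
    split_ifs <;> ring
  have hLL : L' * L = !![S, σ; conj σ, S] := by
    ext i j
    have e1 : ∑ k, conj (w k) * conj (w k) = conj σ := by
      simp only [hσ, sumSq, map_sum, map_mul, sq]
    have e2 : ∑ k, w k * w k = σ := by simp only [hσ, sumSq, sq]
    have e3 : ∑ k, w k * conj (w k) = S := sum_mul_conj_eq w
    have e4 : ∑ k, conj (w k) * w k = S := by rw [← e3]; simp only [mul_comm]
    fin_cases i <;> fin_cases j <;> simp [L, L', Matrix.mul_apply, e1, e2, e3, e4]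
  rw [hmat, det_smul_one_add_mul _ _ hx, Matrix.mul_assoc, hLL]
  congr 1
  rw [Matrix.det_fin_two, Matrix.one_fin_two, Matrix.mul_fin_two]
  simp only [Matrix.add_apply, Matrix.smul_apply, Matrix.of_apply, Matrix.cons_val_zero,
    Matrix.cons_val_one, Matrix.cons_val', Matrix.cons_val_fin_one, smul_eq_mul, mul_one, mul_zero,
    zero_add,
    hac, hbc, hcc, hdc, ← Complex.mul_conj']
  have hv : (condVar τ w : ℂ) = (1 - τ ^ 2) * S ^ 2 / Δ := by
    simp only [condVar, hSdef, hΔdef]; push_cast; rfl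
  have hl : (condShift τ w : ℂ) = τ * (S ^ 2 - σ * conj σ) / Δ := by
    rw [Complex.mul_conj, Complex.normSq_eq_norm_sq, condShift, hσ]; push_cast; rfl
  simp only [hv, hl, map_sub, map_mul, map_div₀, map_pow, Complex.conj_ofReal, Complex.conj_conj,
    hSc, hΔc, ha, hb, hc, hd]
  -- from here on an identity of rational functions
  generalize conj z = z' at *
  generalize conj σ = σ' at *
  clear_value S σ Δ
  clear hform hmat hLL hv hl hac hbc hcc hdc
  field_simp
  rw [hΔeq]
  ring

end

end Determinant

/-! ### The Jacobian of the eigenvalue equation -/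

section Jacobian

open scoped ComplexConjugate

variable {n : ℕ} {τ : ℝ}

/-- The complex derivative at `(z, u)` of the map `(z, u) ↦ z w - B u` with `w = (1, u)`: its
first column is `w`, and the others are `z` times a unit column minus the columns of `B`. -/
def jacobianMatrix (z : ℂ) (u : Fin n → ℂ) (B : Fin (n + 1) → Fin n → ℂ) :
    Matrix (Fin (n + 1)) (Fin (n + 1)) ℂ :=
  Matrix.of fun r => Fin.cons (affineVec u r) fun k => (if r = k.succ then z else 0) - B r k

/-- The first column of the matrix with remaining columns `B` for which `(1, u)` is an eigenvector
with eigenvalue `z`. -/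
def firstColumn (z : ℂ) (u : Fin n → ℂ) (B : Fin (n + 1) → Fin n → ℂ) (r : Fin (n + 1)) : ℂ :=
  z * affineVec u r - ∑ k, B r k * u k

/-- The Jacobian in invariant form, as the determinant of `z - G` with the eigenvalue zero
replaced by one. -/
theorem det_jacobianMatrix_eq (z : ℂ) (u : Fin n → ℂ) (G : Fin (n + 1) → Fin (n + 1) → ℂ)
    (ℓ : Fin (n + 1) → ℂ) (hG : ∀ r, ∑ j, G r j * affineVec u j = z * affineVec u r)
    (hℓ : ∑ j, ℓ j * affineVec u j = 1) :
    Matrix.det (jacobianMatrix z u fun r k => G r k.succ) =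
      Matrix.det (Matrix.of fun r j => (if r = j then z else 0) + affineVec u r * ℓ j - G r j) := by
  set w := affineVec u with hw
  set M : Matrix (Fin (n + 1)) (Fin (n + 1)) ℂ :=
    Matrix.of fun r j => (if r = j then z else 0) + w r * ℓ j - G r j with hM
  -- multiplication by the unipotent matrix `T` with first column `w` leaves the determinant
  -- unchanged and turns the first column into `w`, and the other columns then differ from those
  -- of the Jacobian by multiples of the first
  let T : Matrix (Fin (n + 1)) (Fin (n + 1)) ℂ :=
    Matrix.of fun r => Fin.cons (w r) fun k => if r = k.succ then 1 else 0
  have hT : T.det = 1 := by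
    rw [Matrix.det_of_isLowerTriangular]
    · refine Finset.prod_eq_one fun i _ => ?_
      refine Fin.cases ?_ (fun k => ?_) i <;> simp [T, hw, affineVec]
    · intro i j hij
      have hij' : i < j := hij
      obtain ⟨k, rfl⟩ := Fin.exists_succ_eq.2 (Fin.ne_zero_of_lt hij')
      simp [T, hij'.ne]
  rw [← mul_one M.det, ← hT, ← Matrix.det_mul, ← Matrix.det_transpose, ← Matrix.det_transpose (M * T)]
  symm
  refine Matrix.det_eq_of_forall_row_eq_smul_add_const
    (c := fun j => if j = 0 then 0 else ℓ j) (k := 0) (by simp) fun j r => ?_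
  rw [Matrix.transpose_apply, Matrix.mul_apply, Matrix.transpose_apply, Matrix.transpose_apply]
  refine Fin.cases ?_ (fun k => ?_) j
  · simp only [T, jacobianMatrix, Matrix.of_apply, Fin.cons_zero, hM, if_true, zero_mul, add_zero,
      sub_mul, add_mul, ite_mul, Finset.sum_sub_distrib, Finset.sum_add_distrib,
      Finset.sum_ite_eq, Finset.mem_univ, hG, mul_assoc]
    rw [← Finset.mul_sum, hℓ]
    ring
  · simp [T, jacobianMatrix, hM, hw]
    ring

/-- A row of the conditioned matrix satisfies the eigenvalue equation. -/
theorem sum_rowSplit_mul (h0 : 0 ≤ τ) (h1 : τ < 1) (u β : Fin n → ℂ) (c : ℂ) :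
    ∑ j, rowSplit τ u (c, β) j * affineVec u j = c := by
  have := sum_affineVec_mul_add h0 h1 u β c
  simpa only [rowSplit, mul_comm] using this

/-- If the last entries of each row are those of a row conditioned on the eigenvalue equation,
then so is the first one. -/
theorem cons_firstColumn_eq (h0 : 0 ≤ τ) (h1 : τ < 1) (z : ℂ) (u : Fin n → ℂ)
    (β : Fin (n + 1) → Fin n → ℂ) (r : Fin (n + 1)) :
    (Fin.cons (firstColumn z u (fun r k => rowSplit τ u (z * affineVec u r, β r) k.succ) r)
      (fun k => rowSplit τ u (z * affineVec u r, β r) k.succ) : Fin (n + 1) → ℂ) =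
    rowSplit τ u (z * affineVec u r, β r) := by
  funext j
  refine Fin.cases ?_ (fun k => ?_) j
  · have := sum_rowSplit_mul h0 h1 u (β r) (z * affineVec u r)
    rw [Fin.sum_univ_succ, show affineVec u 0 = 1 from rfl] at this
    simp only [show ∀ k, affineVec u (Fin.succ k) = u k from fun _ => rfl] at this
    simp only [Fin.cons_zero, firstColumn]
    linear_combination -this
  · simp

/-- For rows conditioned on the eigenvalue equation the Jacobian is the determinant of a matrix
with independent rows of known mean. -/
theorem det_jacobianMatrix_rowSplit (h0 : 0 ≤ τ) (h1 : τ < 1) (z : ℂ) (u : Fin n → ℂ)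
    (β : Fin (n + 1) → Fin n → ℂ) :
    Matrix.det (jacobianMatrix z u fun r k => rowSplit τ u (z * affineVec u r, β r) k.succ) =
      Matrix.det (Matrix.of fun r j => meanMatrix τ (affineVec u) z r j - fluct u (β r) j) := by
  have hS : (sumNormSq (affineVec u) : ℂ) ≠ 0 := by
    exact_mod_cast (sumNormSq_affineVec_pos u).ne'
  rw [det_jacobianMatrix_eq z u (fun r => rowSplit τ u (z * affineVec u r, β r))
    (fun j => conj (affineVec u j) / sumNormSq (affineVec u))
    (fun r => sum_rowSplit_mul h0 h1 u (β r) _)]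
  · congr 1
    ext r j
    simp only [Matrix.of_apply, meanMatrix, rowSplit, Pi.add_apply]
    ring
  · simp_rw [div_mul_eq_mul_div]
    rw [← Finset.sum_div, div_eq_one_iff_eq hS, ← sum_mul_conj_eq]
    simp_rw [mul_comm]

/-- The second moments of a row of the conditioned matrix. -/
theorem integral_rowWeight_mul_meanMatrix_sub (h0 : 0 ≤ τ) (h1 : τ < 1) (u : Fin n → ℂ) (a b : ℂ)
    (i j : Fin (n + 1)) :
    Integrable (fun β : Fin n → ℂ => (rowWeight τ (fluct u β) : ℂ) *
      ((a - fluct u β i) * conj (b - fluct u β j))) ∧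
    ∫ β : Fin n → ℂ, (rowWeight τ (fluct u β) : ℂ) *
      ((a - fluct u β i) * conj (b - fluct u β j)) =
        fluctMass τ u * (condCov τ (affineVec u) i j + a * conj b) := by
  have hr0 : Integrable fun β : Fin n → ℂ => (rowWeight τ (fluct u β) : ℂ) := by
    have := integrable_rowWeight_fluct_mul h0 h1 u (f := fun _ => 1) continuous_const (A := 1)
      (C := 0) zero_le_one le_rfl (by simp)
    simpa using this
  have hr1 : Integrable fun β : Fin n → ℂ => (rowWeight τ (fluct u β) : ℂ) * fluct u β i :=
    integrable_rowWeight_fluct_mul h0 h1 u (f := fun g => g i) (by fun_prop) zero_le_one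
      zero_le_one fun g => norm_le_one_add_sum g i
  have hr1' : Integrable fun β : Fin n → ℂ =>
      (rowWeight τ (fluct u β) : ℂ) * conj (fluct u β j) :=
    integrable_rowWeight_fluct_mul h0 h1 u (f := fun g => conj (g j)) (by fun_prop) zero_le_one
      zero_le_one fun g => by rw [RCLike.norm_conj]; exact norm_le_one_add_sum g j
  have hr2 : Integrable fun β : Fin n → ℂ =>
      (rowWeight τ (fluct u β) : ℂ) * (fluct u β i * conj (fluct u β j)) :=
    integrable_rowWeight_fluct_mul h0 h1 u (f := fun g => g i * conj (g j)) (by fun_prop)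
      (A := 0) (C := 1) le_rfl zero_le_one fun g => by
        rw [norm_mul, RCLike.norm_conj]; simpa using norm_mul_le_sum g i j
  have e : ∀ β : Fin n → ℂ, (rowWeight τ (fluct u β) : ℂ) *
      ((a - fluct u β i) * conj (b - fluct u β j)) =
      ((rowWeight τ (fluct u β) : ℂ) * (a * conj b) +
        (rowWeight τ (fluct u β) : ℂ) * (fluct u β i * conj (fluct u β j))) -
      ((rowWeight τ (fluct u β) : ℂ) * fluct u β i * conj b +
        (rowWeight τ (fluct u β) : ℂ) * conj (fluct u β j) * a) := fun β => by
    rw [map_sub]; ring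
  have j1 := hr0.mul_const (a * conj b)
  have j2 := hr1.mul_const (conj b)
  have j3 := hr1'.mul_const a
  simp_rw [e]
  refine ⟨(j1.add hr2).sub (j2.add j3), ?_⟩
  rw [integral_sub, integral_add j1 hr2, integral_add j2 j3]
  rotate_left
  · exact j1.add hr2
  · exact j2.add j3
  rw [integral_mul_const, integral_mul_const, integral_mul_const,
    integral_rowWeight_fluct_mul_self u (fun c => c) (fun c => rfl) i,
    integral_rowWeight_fluct_mul_self u (fun c => conj c) (fun c => map_neg _ c) j,
    integral_rowWeight_fluct_mul_conj h0 h1, ← fluctMass]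
  ring

theorem det_mul_conj_det {m : ℕ} (M : Matrix (Fin m) (Fin m) ℂ) :
    M.det * conj M.det = ∑ σ : Equiv.Perm (Fin m), ∑ σ' : Equiv.Perm (Fin m),
      ((Equiv.Perm.sign σ : ℤ) : ℂ) * ((Equiv.Perm.sign σ' : ℤ) : ℂ) *
        ∏ r, (M r (σ r) * conj (M r (σ' r))) := by
  rw [← Matrix.det_transpose, Matrix.det_apply', map_sum, Finset.sum_mul_sum]
  refine Finset.sum_congr rfl fun σ _ => Finset.sum_congr rfl fun σ' _ => ?_
  rw [map_mul, map_prod, Finset.prod_mul_distrib]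
  simp only [Matrix.transpose_apply, map_intCast]
  ring

/-- The second moment of a determinant with independent rows `A r - fluct u (β r)`, as a Laplace
transform. -/
theorem integral_prod_rowWeight_mul_det (h0 : 0 ≤ τ) (h1 : τ < 1) (u : Fin n → ℂ)
    (A : Fin (n + 1) → Fin (n + 1) → ℂ) :
    Integrable (fun β : Fin (n + 1) → Fin n → ℂ => (∏ r, (rowWeight τ (fluct u (β r)) : ℂ)) *
      (Matrix.det (Matrix.of fun r j => A r j - fluct u (β r) j) *
        conj (Matrix.det (Matrix.of fun r j => A r j - fluct u (β r) j)))) ∧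
    ∫ β : Fin (n + 1) → Fin n → ℂ, (∏ r, (rowWeight τ (fluct u (β r)) : ℂ)) *
      (Matrix.det (Matrix.of fun r j => A r j - fluct u (β r) j) *
        conj (Matrix.det (Matrix.of fun r j => A r j - fluct u (β r) j))) =
    fluctMass τ u ^ (n + 1) * ∫ t in Set.Ioi (0 : ℝ), (Real.exp (-t) : ℂ) *
      Matrix.det (Matrix.of fun i c => (t : ℂ) * condCov τ (affineVec u) i c +
        ∑ r, A r i * conj (A r c)) := by
  have e : ∀ β : Fin (n + 1) → Fin n → ℂ, (∏ r, (rowWeight τ (fluct u (β r)) : ℂ)) *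
      (Matrix.det (Matrix.of fun r j => A r j - fluct u (β r) j) *
        conj (Matrix.det (Matrix.of fun r j => A r j - fluct u (β r) j))) =
      ∑ σ : Equiv.Perm (Fin (n + 1)), ∑ σ' : Equiv.Perm (Fin (n + 1)),
        ((Equiv.Perm.sign σ : ℤ) : ℂ) * ((Equiv.Perm.sign σ' : ℤ) : ℂ) *
        ∏ r, ((rowWeight τ (fluct u (β r)) : ℂ) * ((A r (σ r) - fluct u (β r) (σ r)) *
          conj (A r (σ' r) - fluct u (β r) (σ' r)))) := fun β => by
    rw [det_mul_conj_det, Finset.mul_sum]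
    simp_rw [Finset.mul_sum, Matrix.of_apply]
    refine Finset.sum_congr rfl fun σ _ => Finset.sum_congr rfl fun σ' _ => ?_
    simp only [Finset.prod_mul_distrib]
    ring
  have hint : ∀ σ σ' : Equiv.Perm (Fin (n + 1)),
      Integrable fun β : Fin (n + 1) → Fin n → ℂ =>
        ∏ r, ((rowWeight τ (fluct u (β r)) : ℂ) * ((A r (σ r) - fluct u (β r) (σ r)) *
          conj (A r (σ' r) - fluct u (β r) (σ' r)))) := fun σ σ' =>
    Integrable.fintype_prod (μ := fun _ => (volume : Measure (Fin n → ℂ)))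
      (f := fun r β => (rowWeight τ (fluct u β) : ℂ) * ((A r (σ r) - fluct u β (σ r)) *
          conj (A r (σ' r) - fluct u β (σ' r)))) fun r =>
      (integral_rowWeight_mul_meanMatrix_sub h0 h1 u _ _ _ _).1
  simp_rw [e]
  refine ⟨integrable_finsetSum _ fun σ _ => integrable_finsetSum _ fun σ' _ =>
    (hint σ σ').const_mul _, ?_⟩
  rw [integral_finsetSum _ fun σ _ => integrable_finsetSum _ fun σ' _ => (hint σ σ').const_mul _]
  simp_rw [integral_finsetSum _ fun σ' _ => (hint _ σ').const_mul _, integral_const_mul]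
  rw [← sum_perm_sum_perm_eq_integral_det (condCov τ (affineVec u)) A
    (fun r c => conj (A r c)), Finset.mul_sum]
  refine Finset.sum_congr rfl fun σ _ => ?_
  rw [Finset.mul_sum]
  refine Finset.sum_congr rfl fun σ' _ => ?_
  -- independence of the rows
  rw [integral_fintype_prod_volume_eq_prod (fun r β => (rowWeight τ (fluct u β) : ℂ) *
    ((A r (σ r) - fluct u β (σ r)) * conj (A r (σ' r) - fluct u β (σ' r))))]
  simp_rw [(integral_rowWeight_mul_meanMatrix_sub h0 h1 u _ _ _ _).2]
  rw [Finset.prod_mul_distrib, Finset.prod_const, Finset.card_univ, Fintype.card_fin]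
  ring

end Jacobian

/-! ### The mean squared Jacobian and the density -/

section ConditionalJacobian

open scoped ComplexConjugate

variable {n : ℕ} {τ : ℝ}

/-- The closed form of the mean of the squared modulus of the Jacobian, given that `(1, u)` is an
eigenvector with eigenvalue `z`; see `integral_exp_neg_mul_det` and
`lintegral_prod_rowWeight_mul_norm_det`. For `n = 0` the factor of `upperGamma n` vanishes. -/
def meanJacobian (τ : ℝ) (u : Fin n → ℂ) (z : ℂ) : ℝ :=
  Real.exp (‖z‖ ^ 2) * (condVar τ (affineVec u) * upperGamma ((n : ℝ) + 1) (‖z‖ ^ 2) +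
    (‖z - condShift τ (affineVec u) * conj z‖ ^ 2 - condVar τ (affineVec u) * ‖z‖ ^ 2) *
      upperGamma n (‖z‖ ^ 2))

theorem integral_exp_neg_mul_det (h0 : 0 ≤ τ) (h1 : τ < 1) (u : Fin n → ℂ) (z : ℂ) :
    ∫ t in Set.Ioi (0 : ℝ), (Real.exp (-t) : ℂ) *
      Matrix.det (Matrix.of fun i c => (t : ℂ) * condCov τ (affineVec u) i c +
        ∑ r, meanMatrix τ (affineVec u) z r i * conj (meanMatrix τ (affineVec u) z r c)) =
    (meanJacobian τ u z : ℂ) := by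
  have hw := sumNormSq_affineVec_pos u
  have hr : 0 ≤ ‖z‖ ^ 2 := by positivity
  -- in dimension one the determinant is constant; the exponent of `t + |z|²` in the general
  -- formula would be `-1`
  rcases n with _ | k
  · have hS : sumNormSq (affineVec u) = 1 := by simp [sumNormSq, affineVec]
    have hσ : sumSq (affineVec u) = 1 := by simp [sumSq, affineVec]
    have hΔ : covDet τ (affineVec u) = 1 - τ ^ 2 := by simp [covDet, hS, hσ]
    have hτ : (1 - τ ^ 2) ≠ 0 := by nlinarith
    have hκ : condVar τ (affineVec u) = 1 := by simp [condVar, hS, hΔ, hτ]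
    have hl : condShift τ (affineVec u) = 0 := by simp [condShift, hS, hσ]
    have e : ∀ t ∈ Set.Ioi (0 : ℝ), (Real.exp (-t) : ℂ) *
      Matrix.det (Matrix.of fun i c => (t : ℂ) * condCov τ (affineVec u) i c +
        ∑ r, meanMatrix τ (affineVec u) z r i * conj (meanMatrix τ (affineVec u) z r c)) =
        ((Real.exp (-t) : ℝ) : ℂ) := fun t ht => by
      have ht' : (0 : ℝ) < t := ht
      have hx : (t : ℂ) + ‖z‖ ^ 2 ≠ 0 := by
        have : t + ‖z‖ ^ 2 ≠ 0 := by positivity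
        exact_mod_cast this
      have h := det_condCov_add_meanMatrix h0 h1 hw z ht
      rw [hκ, hl] at h
      have h' : Matrix.det (Matrix.of fun i c => (t : ℂ) * condCov τ (affineVec u) i c +
        ∑ r, meanMatrix τ (affineVec u) z r i * conj (meanMatrix τ (affineVec u) z r c)) = 1 := by
        refine mul_right_cancel₀ (pow_ne_zero 2 hx) (h.trans ?_)
        simp only [Complex.ofReal_zero, zero_mul, sub_zero, Complex.ofReal_one, mul_one,
          Complex.mul_conj']
        ring
      rw [h', mul_one]
    rw [setIntegral_congr_fun measurableSet_Ioi e, integral_complex_ofReal, integral_exp_neg_Ioi_zero]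
    have := upperGamma_natCast_succ 0 hr
    simp only [meanJacobian, hκ, hl, this]
    simp [← Complex.exp_add]
  · have e : ∀ t ∈ Set.Ioi (0 : ℝ), (Real.exp (-t) : ℂ) *
      Matrix.det (Matrix.of fun i c => (t : ℂ) * condCov τ (affineVec u) i c +
        ∑ r, meanMatrix τ (affineVec u) z r i * conj (meanMatrix τ (affineVec u) z r c)) =
        ((Real.exp (-t) * ((t + ‖z‖ ^ 2) ^ k * (t * condVar τ (affineVec u) +
          ‖z - condShift τ (affineVec u) * conj z‖ ^ 2)) : ℝ) : ℂ) := fun t ht => by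
      have ht' : (0 : ℝ) < t := ht
      have hx : (t : ℂ) + ‖z‖ ^ 2 ≠ 0 := by
        have : t + ‖z‖ ^ 2 ≠ 0 := by positivity
        exact_mod_cast this
      have h := det_condCov_add_meanMatrix h0 h1 hw z ht
      have h' : Matrix.det (Matrix.of fun i c => (t : ℂ) * condCov τ (affineVec u) i c +
        ∑ r, meanMatrix τ (affineVec u) z r i * conj (meanMatrix τ (affineVec u) z r c)) =
        (((t + ‖z‖ ^ 2) ^ k * (t * condVar τ (affineVec u) +
          ‖z - condShift τ (affineVec u) * conj z‖ ^ 2) : ℝ) : ℂ) := by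
        refine mul_right_cancel₀ (pow_ne_zero 2 hx) (h.trans ?_)
        rw [Complex.mul_conj']
        push_cast
        ring
      rw [h', ← Complex.ofReal_mul]
    rw [setIntegral_congr_fun measurableSet_Ioi e, integral_complex_ofReal,
      integral_exp_neg_mul_add_pow k hr, meanJacobian]
    push_cast
    ring_nf

/-- The integral over the last columns `B` of the weight of the matrix with eigenpair
`(z, (1, u))`, times the squared modulus of the Jacobian. Translating `B` by its conditional mean
splits off the weight of the eigenvalue equation. -/
theorem lintegral_prod_rowWeight_mul_norm_det (h0 : 0 ≤ τ) (h1 : τ < 1) (u : Fin n → ℂ) (z : ℂ) :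
    ∫⁻ B : Fin (n + 1) → Fin n → ℂ,
      ENNReal.ofReal ((∏ r, rowWeight τ (Fin.cons (firstColumn z u B r) (B r))) *
        ‖(jacobianMatrix z u B).det‖ ^ 2) =
    ENNReal.ofReal ((∏ r, pairingWeight τ (affineVec u) (z * affineVec u r)) *
      ((entryMass τ ^ (n + 1) / (Real.pi * √(covDet τ (affineVec u)))) ^ (n + 1) *
        meanJacobian τ u z)) := by
  have hw := sumNormSq_affineVec_pos u
  -- translate the last entries of each row by their conditional mean
  rw [← lintegral_add_left_eq_self _
    (fun r k => regMean τ (affineVec u) (z * affineVec u r) (Fin.succ k))]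
  have e : ∀ β : Fin (n + 1) → Fin n → ℂ,
      (fun r k => regMean τ (affineVec u) (z * affineVec u r) (Fin.succ k)) + β =
        fun r k => rowSplit τ u (z * affineVec u r, β r) k.succ := fun β => rfl
  simp_rw [e, cons_firstColumn_eq h0 h1, det_jacobianMatrix_rowSplit h0 h1, rowSplit,
    rowWeight_regMean_add h0 h1 hw _ (sum_affineVec_mul_fluct u _), Finset.prod_mul_distrib,
    mul_assoc]
  have hp : 0 ≤ ∏ r, pairingWeight τ (affineVec u) (z * affineVec u r) :=
    Finset.prod_nonneg fun _ _ => pairingWeight_nonneg _ _ _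
  simp_rw [ENNReal.ofReal_mul hp]
  rw [lintegral_const_mul' _ _ ENNReal.ofReal_ne_top]
  congr 1
  obtain ⟨hi, hI⟩ := integral_prod_rowWeight_mul_det h0 h1 u (meanMatrix τ (affineVec u) z)
  rw [integral_exp_neg_mul_det h0 h1, fluctMass_eq h0 h1] at hI
  have e2 : ∀ β : Fin (n + 1) → Fin n → ℂ, (∏ r, (rowWeight τ (fluct u (β r)) : ℂ)) *
      (Matrix.det (Matrix.of fun r j => meanMatrix τ (affineVec u) z r j - fluct u (β r) j) *
        conj (Matrix.det (Matrix.of fun r j =>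
          meanMatrix τ (affineVec u) z r j - fluct u (β r) j))) =
      (((∏ r, rowWeight τ (fluct u (β r))) * ‖Matrix.det (Matrix.of fun r j =>
        meanMatrix τ (affineVec u) z r j - fluct u (β r) j)‖ ^ 2 : ℝ) : ℂ) := fun β => by
    rw [Complex.mul_conj']
    push_cast
    ring
  simp_rw [e2] at hi hI
  rw [integral_complex_ofReal, ← Complex.ofReal_pow, ← Complex.ofReal_mul, Complex.ofReal_inj] at hI
  rw [← hI, ofReal_integral_eq_lintegral_ofReal]
  · have := hi.re
    simpa only [RCLike.ofReal_re, Complex.coe_algebraMap, RCLike.re_eq_complex_re,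
      Complex.ofReal_re] using this
  · exact ae_of_all _ fun β => mul_nonneg
      (Finset.prod_nonneg fun _ _ => rowWeight_nonneg _ _) (sq_nonneg _)

/-- The density is the conditional mean of the squared Jacobian, times the density of the
condition `G w = z w`, up to the density of the projective coordinates on the sphere and the total
mass of the weight of the random matrix. -/
theorem density_eq_meanJacobian (h0 : 0 ≤ τ) (h1 : τ < 1) (u : Fin n → ℂ) (z : ℂ)
    (v : CSphere (n + 1))
    (hv : ‖∑ i, v.1.ofLp i ^ 2‖ = ‖sumSq (affineVec u)‖ / sumNormSq (affineVec u)) :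
    (∏ r, pairingWeight τ (affineVec u) (z * affineVec u r)) *
      ((entryMass τ ^ (n + 1) / (Real.pi * √(covDet τ (affineVec u)))) ^ (n + 1) *
        meanJacobian τ u z) =
    entryMass τ ^ ((n + 1) * (n + 1)) * ((n + 1) * (n.factorial * (Real.pi ^ n)⁻¹ *
      (sumNormSq (affineVec u) ^ (n + 1))⁻¹ * density (n + 1) τ z v)) := by
  have hS := sumNormSq_affineVec_pos u
  have hΔ := covDet_pos h0 h1 hS
  set w := affineVec u with hw
  set S := sumNormSq w with hSd
  have hD : D τ v = covDet τ w / S ^ 2 := by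
    unfold D covDet
    rw [hv]
    field_simp
    rw [← hSd]
  have hDpos : 0 < D τ v := by rw [hD]; positivity
  have hΔD : covDet τ w = D τ v * S ^ 2 := by rw [hD]; field_simp
  have hsqrt : √(covDet τ w) = S * √(D τ v) := by
    rw [hΔD, Real.sqrt_mul hDpos.le, Real.sqrt_sq hS.le, mul_comm]
  have hs2 : ‖sumSq w‖ ^ 2 = ‖∑ i, v.1.ofLp i ^ 2‖ ^ 2 * S ^ 2 := by
    rw [hv]; field_simp
  have hκ : condVar τ w = (1 - τ ^ 2) / D τ v := by
    rw [condVar, hΔD, ← hSd]; field_simp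
  have hl : condShift τ w * τ = 1 - (1 - τ ^ 2) / D τ v := by
    rw [condShift, hΔD, ← hSd, hs2]
    have : D τ v = 1 - τ ^ 2 * ‖∑ i, v.1.ofLp i ^ 2‖ ^ 2 := rfl
    field_simp
    rw [this]
    ring
  -- the weight of the eigenvalue equation gives the exponential factor
  have hpw : (∏ r, pairingWeight τ w (z * w r)) * Real.exp (‖z‖ ^ 2) =
      Real.exp (-((1 - D τ v) / (2 * τ * D τ v)) *
        (2 * τ * ‖z‖ ^ 2 - (z ^ 2 + starRingEnd ℂ z ^ 2).re)) := by
    unfold pairingWeight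
    rw [← Real.exp_sum, ← Real.exp_add]
    congr 1
    rw [Finset.sum_neg_distrib, ← Finset.sum_div, Finset.sum_sub_distrib, ← Finset.mul_sum,
      ← Finset.mul_sum, ← Complex.re_sum, ← Finset.mul_sum]
    have e1 : ∑ r, ‖z * w r‖ ^ 2 = ‖z‖ ^ 2 * S := by
      simp_rw [norm_mul, mul_pow]
      rw [← Finset.mul_sum]
      rfl
    have e2 : (conj (sumSq w) * ∑ r, (z * w r) ^ 2).re = ‖sumSq w‖ ^ 2 * (z ^ 2).re := by
      simp_rw [mul_pow]
      rw [← Finset.mul_sum, show ∑ i, w i ^ 2 = sumSq w from rfl,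
        show conj (sumSq w) * (z ^ 2 * sumSq w) = (sumSq w * conj (sumSq w)) * z ^ 2 by ring,
        Complex.mul_conj', ← Complex.ofReal_pow, Complex.re_ofReal_mul]
    have e3 : (z ^ 2 + conj z ^ 2).re = 2 * (z ^ 2).re := by
      rw [← map_pow, Complex.add_re, Complex.conj_re]; ring
    rw [e1, e2, e3, hs2, hΔD, ← hSd]
    have hDd : D τ v = 1 - τ ^ 2 * ‖∑ i, v.1.ofLp i ^ 2‖ ^ 2 := rfl
    -- for `τ = 0` the divisions by `τ` in the density are by zero, but both sides agree since `D
    -- = 1`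
    rcases h0.eq_or_lt with rfl | hτ
    · have hD1 : D 0 v = 1 := by simp [D]
      rw [hD1]
      field_simp
      ring
    · field_simp
      rw [hDd]
      ring
  -- the mean squared Jacobian gives the bracket
  have hbr : condVar τ w * upperGamma ((n : ℝ) + 1) (‖z‖ ^ 2) +
      (‖z - condShift τ w * conj z‖ ^ 2 - condVar τ w * ‖z‖ ^ 2) * upperGamma n (‖z‖ ^ 2) =
      ((1 - τ ^ 2) / D τ v * upperGamma ((n + 1 : ℕ) : ℝ) (‖z‖ ^ 2) +
      upperGamma (((n + 1 : ℕ) : ℝ) - 1) (‖z‖ ^ 2) * (1 - (1 - τ ^ 2) / D τ v) *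
        ((‖z‖ ^ 2 - 1 / τ * (z ^ 2 + starRingEnd ℂ z ^ 2).re) +
          ‖z‖ ^ 2 / τ ^ 2 * (1 - (1 - τ ^ 2) / D τ v))) := by
    have e3 : ‖z - condShift τ w * conj z‖ ^ 2 = ‖z‖ ^ 2 -
        condShift τ w * (z ^ 2 + starRingEnd ℂ z ^ 2).re + condShift τ w ^ 2 * ‖z‖ ^ 2 := by
      rw [norm_sq_eq, norm_sq_eq, sq_add_conj_sq_re]
      simp
      ring
    rw [e3]
    push_cast
    rw [add_sub_cancel_right, hκ, ← hl]
    have hκ' : (1 - τ ^ 2) / D τ v = 1 - condShift τ w * τ := by rw [hl]; ring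
    rw [hκ']
    rcases h0.eq_or_lt with rfl | hτ
    · have : condShift 0 w = 0 := by simp [condShift]
      rw [this]
      ring
    · field_simp
      ring
  have hm := entryMass_pos h0 h1
  rw [meanJacobian, hbr, density, ← hpw]
  have hpow : D τ v ^ (((n + 1 : ℕ) : ℝ) / 2) = √(D τ v) ^ (n + 1) := by
    rw [Real.sqrt_eq_rpow, ← Real.rpow_natCast, ← Real.rpow_mul hDpos.le]
    congr 1
    ring
  have hΓ : Real.Gamma ((n + 1 : ℕ) : ℝ) = n.factorial := by
    push_cast; exact Real.Gamma_nat_eq_factorial n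
  rw [hpow, hΓ, hsqrt]
  have hsD : 0 < √(D τ v) := Real.sqrt_pos.2 hDpos
  generalize hY : ((1 - τ ^ 2) / D τ v * upperGamma ((n + 1 : ℕ) : ℝ) (‖z‖ ^ 2) + _) = Y
  rw [div_pow, ← pow_mul, mul_pow, mul_pow, pow_succ Real.pi]
  push_cast
  have hπ := Real.pi_pos
  have hf : (0 : ℝ) < n.factorial := by positivity
  field_simp

end ConditionalJacobian

/-! ### The invariant measure on the sphere in projective coordinates -/

section Sphere

variable {n : ℕ}

/-- Integration in polar coordinates for an integrand which is a product of a radial and an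
angular part. -/
theorem lintegral_norm_mul_direction {E : Type*} [NormedAddCommGroup E] [NormedSpace ℝ E]
    [MeasurableSpace E] [BorelSpace E] [FiniteDimensional ℝ E] [Nontrivial E] (μ : Measure E)
    [μ.IsAddHaarMeasure] {g : ℝ → ℝ≥0∞} (hg : Measurable g) {f : E → ℝ≥0∞} (hf : Measurable f) :
    ∫⁻ x, g ‖x‖ * f (‖x‖⁻¹ • x) ∂μ = (∫⁻ v, f v.1 ∂μ.toSphere) *
      ∫⁻ r, g r.1 ∂(Measure.volumeIoiPow (Module.finrank ℝ E - 1)) := by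
  rw [← lintegral_prod_mul (f := fun v : Metric.sphere (0 : E) 1 => f v.1)
    (g := fun r : Set.Ioi (0 : ℝ) => g r.1) (hf.comp measurable_subtype_coe).aemeasurable
    (hg.comp measurable_subtype_coe).aemeasurable,
    ← (μ.measurePreserving_homeomorphUnitSphereProd).lintegral_comp_emb
      (homeomorphUnitSphereProd E).measurableEmbedding]
  simp only [homeomorphUnitSphereProd_apply_fst_coe, homeomorphUnitSphereProd_apply_snd_coe]
  rw [lintegral_subtype_comap (measurableSet_singleton (0 : E)).compl
    (fun x => f (‖x‖⁻¹ • x) * g ‖x‖), restrict_compl_singleton]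
  simp_rw [mul_comm]

/-- The real Jacobian of a complex linear map is the squared modulus of its complex determinant.
-/
theorem abs_det_restrictScalars {V : Type*} [AddCommGroup V] [Module ℂ V] [Module ℝ V]
    [IsScalarTower ℝ ℂ V] (f : V →ₗ[ℂ] V) :
    |LinearMap.det (f.restrictScalars ℝ)| = ‖LinearMap.det f‖ ^ 2 := by
  rw [LinearMap.det_restrictScalars, Algebra.norm_complex_apply, Complex.normSq_eq_norm_sq,
    abs_of_nonneg (sq_nonneg _)]

theorem lintegral_eq_mul_lintegral_smul (a : ℂ) (ha : a ≠ 0) {h : (Fin n → ℂ) → ℝ≥0∞}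
    (hh : Measurable h) :
    ∫⁻ t, h t = ENNReal.ofReal (‖a‖ ^ (2 * n)) * ∫⁻ u : Fin n → ℂ, h (a • u) := by
  set f : (Fin n → ℂ) →ₗ[ℂ] (Fin n → ℂ) := a • LinearMap.id with hf
  have hdet : LinearMap.det f = a ^ n := by
    rw [hf, LinearMap.det_smul]; simp
  have habs : |LinearMap.det (f.restrictScalars ℝ)| = ‖a‖ ^ (2 * n) := by
    rw [abs_det_restrictScalars, hdet, norm_pow, ← pow_mul, mul_comm]
  have hpos : 0 < ‖a‖ ^ (2 * n) := by positivity
  have hne : LinearMap.det (f.restrictScalars ℝ) ≠ 0 := by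
    rw [← abs_pos, habs]; exact hpos
  have hmap := Measure.map_linearMap_addHaar_eq_smul_addHaar
    (volume : Measure (Fin n → ℂ)) hne
  rw [abs_inv, habs] at hmap
  have hm : Measurable (f.restrictScalars ℝ) :=
    (LinearMap.continuous_of_finiteDimensional _).measurable
  have := lintegral_map (μ := (volume : Measure (Fin n → ℂ))) hh hm
  rw [hmap, lintegral_smul_measure] at this
  have e : ∀ u, h ((f.restrictScalars ℝ) u) = h (a • u) := fun u => rfl
  simp_rw [e] at this
  rw [← this, smul_eq_mul, ← mul_assoc, ← ENNReal.ofReal_mul hpos.le, mul_inv_cancel₀ hpos.ne',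
    ENNReal.ofReal_one, one_mul]

theorem continuous_sumNormSq {m : ℕ} : Continuous (sumNormSq : (Fin m → ℂ) → ℝ) := by
  unfold sumNormSq
  fun_prop

theorem continuous_affineVec : Continuous (affineVec : (Fin n → ℂ) → _) := by
  refine continuous_pi fun i => ?_
  refine Fin.cases ?_ (fun k => ?_) i
  · simp only [affineVec, Fin.cons_zero]; fun_prop
  · simp only [affineVec, Fin.cons_succ]; fun_prop

theorem sumNormSq_eq_norm_sq {m : ℕ} (x : EuclideanSpace ℂ (Fin m)) :
    sumNormSq x.ofLp = ‖x‖ ^ 2 := by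
  rw [EuclideanSpace.norm_sq_eq]; rfl

theorem ofLp_ne_zero {m : ℕ} (v : CSphere m) : v.1.ofLp ≠ 0 := fun h => by
  have h1 := mem_sphere_zero_iff_norm.1 v.2
  have h2 := sumNormSq_eq_norm_sq v.1
  rw [h1, h] at h2
  simp [sumNormSq] at h2

theorem eq_smul_affineVec {v : Fin (n + 1) → ℂ} (h : v 0 ≠ 0) :
    v = v 0 • affineVec fun k => v k.succ / v 0 := by
  funext i
  refine Fin.cases ?_ (fun k => ?_) i
  · simp [affineVec]
  · simp [affineVec]; field_simp

/-- The unit vector in the direction of `(1, u)` with first entry of phase `θ`. -/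
def sphereChart (θ : ℝ) (u : Fin n → ℂ) : CSphere (n + 1) :=
  ⟨WithLp.toLp 2 ((Complex.exp (Complex.I * θ) / (√(sumNormSq (affineVec u)) : ℝ)) • affineVec u),
    by
      have hS := sumNormSq_affineVec_pos u
      rw [mem_sphere_zero_iff_norm, ← sq_eq_sq₀ (norm_nonneg _) zero_le_one,
        ← sumNormSq_eq_norm_sq]
      have : sumNormSq ((Complex.exp (Complex.I * θ) / (√(sumNormSq (affineVec u)) : ℝ)) •
          affineVec u) = ‖Complex.exp (Complex.I * θ) / (√(sumNormSq (affineVec u)) : ℝ)‖ ^ 2 *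
            sumNormSq (affineVec u) := by
        simp only [sumNormSq, Pi.smul_apply, smul_eq_mul, norm_mul, mul_pow, ← Finset.mul_sum]
      rw [this, norm_div, div_pow, Complex.norm_real, Real.norm_of_nonneg (Real.sqrt_nonneg _),
        Real.sq_sqrt hS.le, mul_comm Complex.I, Complex.norm_exp_ofReal_mul_I]
      field_simp⟩

theorem sphereChart_apply (θ : ℝ) (u : Fin n → ℂ) (i : Fin (n + 1)) :
    (sphereChart θ u).1.ofLp i =
      Complex.exp (Complex.I * θ) / (√(sumNormSq (affineVec u)) : ℝ) * affineVec u i := rfl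

theorem continuous_sphereChart :
    Continuous fun p : ℝ × (Fin n → ℂ) => sphereChart p.1 p.2 := by
  have h1 : Continuous fun p : ℝ × (Fin n → ℂ) =>
      (Complex.exp (Complex.I * p.1) / (√(sumNormSq (affineVec p.2)) : ℝ)) := by
    refine Continuous.div (by fun_prop) (Complex.continuous_ofReal.comp
      (continuous_sumNormSq.comp (continuous_affineVec.comp continuous_snd)).sqrt) fun p => ?_
    have := Real.sqrt_pos.2 (sumNormSq_affineVec_pos p.2)
    exact_mod_cast this.ne'
  have h2 : Continuous fun p : ℝ × (Fin n → ℂ) =>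
      (Complex.exp (Complex.I * p.1) / (√(sumNormSq (affineVec p.2)) : ℝ)) • affineVec p.2 :=
    h1.smul (continuous_affineVec.comp continuous_snd)
  exact Continuous.subtype_mk ((PiLp.continuous_toLp 2 fun _ : Fin (n + 1) => ℂ).comp h2) _

theorem norm_sum_sphereChart_sq (θ : ℝ) (u : Fin n → ℂ) :
    ‖∑ i, (sphereChart θ u).1.ofLp i ^ 2‖ =
      ‖sumSq (affineVec u)‖ / sumNormSq (affineVec u) := by
  have hS := sumNormSq_affineVec_pos u
  simp_rw [sphereChart_apply, mul_pow]
  rw [← Finset.mul_sum, norm_mul, norm_pow, norm_div, Complex.norm_real,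
    Real.norm_of_nonneg (Real.sqrt_nonneg _), mul_comm Complex.I, Complex.norm_exp_ofReal_mul_I,
    div_pow, Real.sq_sqrt hS.le, one_pow, one_div, inv_mul_eq_div]
  rfl

/-- The weight `exp (-|x|²)` integrated along the ray of direction `(1, u)`, where `S = |(1, u)|²`
and `s ^ (2 n + 1)` collects the radial Jacobian of the first entry and the scaling of the other
`n` entries. -/
theorem lintegral_pow_mul_exp (n : ℕ) {S : ℝ} (hS : 0 < S) :
    ∫⁻ s in Set.Ioi (0 : ℝ), ENNReal.ofReal (s ^ (2 * n + 1) * Real.exp (-(s ^ 2 * S))) =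
      ENNReal.ofReal (n.factorial / 2 * (S ^ (n + 1))⁻¹) := by
  have hq : (-1 : ℝ) < (2 * n + 1 : ℕ) := by
    have : (0 : ℝ) ≤ (2 * n + 1 : ℕ) := by positivity
    linarith
  have h := integral_rpow_mul_exp_neg_mul_rpow (p := 2) (q := (2 * n + 1 : ℕ)) (b := S) two_pos hq hS
  have hi := integrableOn_rpow_mul_exp_neg_mul_rpow (p := 2) (s := (2 * n + 1 : ℕ)) (b := S)
    hq two_pos hS
  have e : ∀ s : ℝ, s ^ ((2 * n + 1 : ℕ) : ℝ) * Real.exp (-S * s ^ (2 : ℝ)) =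
      s ^ (2 * n + 1) * Real.exp (-(s ^ 2 * S)) := fun s => by
    rw [Real.rpow_natCast, Real.rpow_two]; ring_nf
  simp_rw [e] at h hi
  rw [← ofReal_integral_eq_lintegral_ofReal hi]
  · rw [h]
    have e1 : (((2 * n + 1 : ℕ) : ℝ) + 1) / 2 = (n : ℝ) + 1 := by push_cast; ring
    have e2 : -(((2 * n + 1 : ℕ) : ℝ) + 1) / 2 = -((n + 1 : ℕ) : ℝ) := by push_cast; ring
    rw [e1, e2, Real.Gamma_nat_eq_factorial, Real.rpow_neg hS.le, Real.rpow_natCast]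
    ring_nf
  · filter_upwards [ae_restrict_mem measurableSet_Ioi] with s hs
    have : (0 : ℝ) < s := hs
    positivity

theorem rowWeight_zero {m : ℕ} (x : Fin m → ℂ) : rowWeight 0 x = Real.exp (-sumNormSq x) := by
  unfold rowWeight gaussWeight sumNormSq
  rw [← Real.exp_sum, ← Finset.sum_neg_distrib]
  simp [norm_sq_eq]

theorem sumNormSq_smul {m : ℕ} (a : ℂ) (x : Fin m → ℂ) :
    sumNormSq (a • x) = ‖a‖ ^ 2 * sumNormSq x := by
  simp only [sumNormSq, Pi.smul_apply, smul_eq_mul, norm_mul, mul_pow, ← Finset.mul_sum]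

/-- The chart depends only on the phase of the first entry and on the ratios of the other ones to
it. -/
theorem direction_smul_affineVec {s : ℝ} (hs : 0 < s) (θ : ℝ) (u : Fin n → ℂ) :
    ‖WithLp.toLp 2 ((s * Complex.exp (Complex.I * θ)) • affineVec u)‖⁻¹ •
      (WithLp.toLp 2 ((s * Complex.exp (Complex.I * θ)) • affineVec u) :
        EuclideanSpace ℂ (Fin (n + 1))) = (sphereChart θ u).1 := by
  have hS := sumNormSq_affineVec_pos u
  have hn : ‖(WithLp.toLp 2 ((s * Complex.exp (Complex.I * θ)) • affineVec u) :
      EuclideanSpace ℂ (Fin (n + 1)))‖ = s * √(sumNormSq (affineVec u)) := by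
    rw [← sq_eq_sq₀ (norm_nonneg _) (by positivity), ← sumNormSq_eq_norm_sq, sumNormSq_smul,
      norm_mul, mul_comm Complex.I, Complex.norm_exp_ofReal_mul_I, Complex.norm_real,
      Real.norm_of_nonneg hs.le, mul_one, mul_pow, Real.sq_sqrt hS.le]
  have h2 : (√(sumNormSq (affineVec u)) : ℂ) ≠ 0 := by
    exact_mod_cast (Real.sqrt_pos.2 hS).ne'
  have hs' : (s : ℂ) ≠ 0 := by exact_mod_cast hs.ne'
  ext i
  rw [hn, sphereChart_apply, PiLp.smul_apply, PiLp.toLp_apply, Pi.smul_apply, smul_eq_mul,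
    Complex.real_smul]
  push_cast
  field_simp

/-- The Gaussian average of a function of the direction, in projective coordinates. -/
theorem lintegral_rowWeight_mul_direction {F : EuclideanSpace ℂ (Fin (n + 1)) → ℝ≥0∞}
    (hF : Measurable F) :
    ∫⁻ x : Fin (n + 1) → ℂ, ENNReal.ofReal (rowWeight 0 x) *
      F (‖WithLp.toLp 2 x‖⁻¹ • WithLp.toLp 2 x) =
    ∫⁻ θ in Set.Ioo (-Real.pi) Real.pi, ∫⁻ u : Fin n → ℂ,
      ENNReal.ofReal (n.factorial / 2 * (sumNormSq (affineVec u) ^ (n + 1))⁻¹) *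
        F (sphereChart θ u).1 := by
  set G : (Fin (n + 1) → ℂ) → ℝ≥0∞ := fun x => ENNReal.ofReal (rowWeight 0 x) *
      F (‖WithLp.toLp 2 x‖⁻¹ • WithLp.toLp 2 x) with hG
  have hGm : Measurable G := by
    have h1 : Measurable fun x : Fin (n + 1) → ℂ =>
        (WithLp.toLp 2 x : EuclideanSpace ℂ (Fin (n + 1))) :=
      (PiLp.continuous_toLp 2 _).measurable
    exact (continuous_rowWeight 0).measurable.ennreal_ofReal.mul
      (hF.comp (h1.norm.inv.smul h1))
  have hcons : Measurable fun p : ℂ × (Fin n → ℂ) => (Fin.cons p.1 p.2 : Fin (n + 1) → ℂ) := by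
    refine measurable_pi_lambda _ fun i => ?_
    refine Fin.cases ?_ (fun k => ?_) i
    · simp only [Fin.cons_zero]; fun_prop
    · simp only [Fin.cons_succ]; fun_prop
  -- separate the first entry
  have h1 : ∫⁻ x, G x = ∫⁻ p : ℂ × (Fin n → ℂ), G (Fin.cons p.1 p.2) := by
    have := (volume_preserving_piFinSuccAbove (fun _ : Fin (n + 1) => ℂ) 0).symm.lintegral_comp hGm
    rw [← this]
    refine lintegral_congr fun p => congrArg G ?_
    simp [MeasurableEquiv.piFinSuccAbove, Fin.insertNthEquiv]
  rw [h1, Measure.volume_eq_prod, lintegral_prod (fun p : ℂ × (Fin n → ℂ) => G (Fin.cons p.1 p.2))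
    (hGm.comp hcons).aemeasurable]
  -- scale the other entries by the first one
  have h2 : ∀ᵐ x₀ : ℂ, ∫⁻ t : Fin n → ℂ, G (Fin.cons x₀ t) =
      ENNReal.ofReal (‖x₀‖ ^ (2 * n)) * ∫⁻ u : Fin n → ℂ, G (x₀ • affineVec u) := by
    filter_upwards [compl_mem_ae_iff.2 (measure_singleton (0 : ℂ))] with x₀ hx₀
    rw [lintegral_eq_mul_lintegral_smul x₀ hx₀ (h := fun t => G (Fin.cons x₀ t))
      (hGm.comp (hcons.comp measurable_prodMk_left))]
    congr 1
    refine lintegral_congr fun u => ?_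
    congr 1
    funext i
    refine Fin.cases ?_ (fun k => ?_) i <;> simp [affineVec]
  rw [lintegral_congr_ae h2, ← Complex.lintegral_comp_polarCoord_symm]
  -- polar coordinates for the first entry
  have h3 : ∀ p ∈ polarCoord.target, ENNReal.ofReal p.1 •
      (ENNReal.ofReal (‖Complex.polarCoord.symm p‖ ^ (2 * n)) *
        ∫⁻ u : Fin n → ℂ, G (Complex.polarCoord.symm p • affineVec u)) =
      ∫⁻ u : Fin n → ℂ, ENNReal.ofReal
        (p.1 ^ (2 * n + 1) * Real.exp (-(p.1 ^ 2 * sumNormSq (affineVec u)))) *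
          F (sphereChart p.2 u).1 := fun p hp => by
    have hs : (0 : ℝ) < p.1 := hp.1
    have hpol : Complex.polarCoord.symm p = p.1 * Complex.exp (Complex.I * p.2) := by
      rw [Complex.polarCoord_symm_apply, mul_comm Complex.I, Complex.exp_mul_I]
      push_cast
      rfl
    rw [Complex.norm_polarCoord_symm, abs_of_pos hs, smul_eq_mul, ← mul_assoc,
      ← ENNReal.ofReal_mul hs.le, ← pow_succ', ← lintegral_const_mul' _ _ ENNReal.ofReal_ne_top]
    refine lintegral_congr fun u => ?_
    rw [hG]
    simp only [hpol]
    rw [direction_smul_affineVec hs, rowWeight_zero, sumNormSq_smul, norm_mul, mul_comm Complex.I,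
      Complex.norm_exp_ofReal_mul_I, Complex.norm_real, Real.norm_of_nonneg hs.le, mul_one,
      ← mul_assoc, ← ENNReal.ofReal_mul (by positivity)]
  have hmeas : Measurable fun q : (ℝ × ℝ) × (Fin n → ℂ) => ENNReal.ofReal
        (q.1.1 ^ (2 * n + 1) * Real.exp (-(q.1.1 ^ 2 * sumNormSq (affineVec q.2)))) *
          F (sphereChart q.1.2 q.2).1 := by
    refine Measurable.mul (Measurable.ennreal_ofReal (Continuous.measurable ?_)) (hF.comp
      (Continuous.measurable ?_))
    · have := continuous_sumNormSq.comp (continuous_affineVec (n := n))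
      have h' : Continuous fun q : (ℝ × ℝ) × (Fin n → ℂ) => sumNormSq (affineVec q.2) :=
        this.comp continuous_snd
      fun_prop
    · exact continuous_subtype_val.comp (continuous_sphereChart.comp
        (f := fun q : (ℝ × ℝ) × (Fin n → ℂ) => (q.1.2, q.2)) (by fun_prop))
  rw [setLIntegral_congr_fun (polarCoord.open_target.measurableSet) h3,
    show polarCoord.target = Set.Ioi (0 : ℝ) ×ˢ Set.Ioo (-Real.pi) Real.pi from rfl,
    Measure.volume_eq_prod, ← Measure.prod_restrict,
    lintegral_prod_symm _ hmeas.lintegral_prod_right'.aemeasurable]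
  refine lintegral_congr fun θ => ?_
  rw [lintegral_lintegral_swap]
  · refine lintegral_congr fun u => ?_
    simp only
    rw [lintegral_mul_const, lintegral_pow_mul_exp n (sumNormSq_affineVec_pos u)]
    exact Measurable.ennreal_ofReal (Continuous.measurable (by fun_prop))
  · exact (hmeas.comp (g := fun q : (ℝ × ℝ) × (Fin n → ℂ) => _)
      (f := fun q : ℝ × (Fin n → ℂ) => (((q.1, θ) : ℝ × ℝ), q.2)) (by fun_prop)).aemeasurable

/-- The constant that normalizes the projective density. -/
theorem lintegral_rowWeight_zero (m : ℕ) :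
    ∫⁻ x : Fin m → ℂ, ENNReal.ofReal (rowWeight 0 x) = ENNReal.ofReal (Real.pi ^ m) := by
  have h := integral_rowWeight (ι := Fin m) (τ := 0) le_rfl
  have hm : entryMass 0 = Real.pi := by simp [entryMass]
  rw [integral_complex_ofReal, hm, ← Complex.ofReal_pow, Complex.ofReal_inj,
    Fintype.card_fin] at h
  rw [← h, ofReal_integral_eq_lintegral_ofReal]
  · by_contra hc
    rw [integral_undef hc] at h
    have : 0 < Real.pi ^ m := by positivity
    linarith
  · exact ae_of_all _ fun x => rowWeight_nonneg _ _

/-- A `2π`-periodic function has the same integral over `(-π, π)` as over `[0, 2π)`. -/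
theorem setLIntegral_Ioo_eq_setLIntegral_Ico {g : ℝ → ℝ≥0∞}
    (hg : Function.Periodic g (2 * Real.pi)) :
    ∫⁻ θ in Set.Ioo (-Real.pi) Real.pi, g θ = ∫⁻ θ in Set.Ico 0 (2 * Real.pi), g θ := by
  have h := (isAddFundamentalDomain_Ioc Real.two_pi_pos (-Real.pi)).setLIntegral_eq
    (isAddFundamentalDomain_Ioc Real.two_pi_pos 0) g (fun a x => by
      obtain ⟨_, k, rfl⟩ := a
      have := hg.int_mul k x
      rw [← this]
      congr 1
      simp [AddSubgroup.vadd_def, add_comm])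
  rw [zero_add, show -Real.pi + 2 * Real.pi = Real.pi by ring] at h
  rw [setLIntegral_congr Ioo_ae_eq_Ioc, h, setLIntegral_congr Ico_ae_eq_Ioc]

theorem sphereChart_periodic (u : Fin n → ℂ) :
    Function.Periodic (fun θ => sphereChart θ u) (2 * Real.pi) := fun θ => by
  refine Subtype.ext (PiLp.ext fun i => ?_)
  rw [sphereChart_apply, sphereChart_apply]
  congr 2
  rw [Complex.exp_eq_exp_iff_exists_int]
  exact ⟨1, by push_cast; ring⟩

/-- The invariant measure on the sphere in projective coordinates. -/
theorem lintegral_sphereMeasure {f : CSphere (n + 1) → ℝ≥0∞} (hf : Measurable f) :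
    ∫⁻ v, f v ∂sphereMeasure (n + 1) = ∫⁻ θ, (∫⁻ u : Fin n → ℂ,
      ENNReal.ofReal (n.factorial * (Real.pi ^ n)⁻¹ * (sumNormSq (affineVec u) ^ (n + 1))⁻¹) *
        f (sphereChart θ u)) ∂uniformPhase := by
  have hemb : MeasurableEmbedding
      (Subtype.val : CSphere (n + 1) → EuclideanSpace ℂ (Fin (n + 1))) :=
    MeasurableEmbedding.subtype_coe Metric.isClosed_sphere.measurableSet
  set F : EuclideanSpace ℂ (Fin (n + 1)) → ℝ≥0∞ := Function.extend Subtype.val f 0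
  have hF : Measurable F := hemb.measurable_extend hf measurable_const
  have hFf : ∀ v : CSphere (n + 1), F v.1 = f v := fun v => hemb.injective.extend_apply f 0 v
  -- the volume on the Euclidean space is a multiple of the product measure
  let e : (Fin (n + 1) → ℂ) ≃L[ℝ] EuclideanSpace ℂ (Fin (n + 1)) :=
    (PiLp.continuousLinearEquiv 2 ℝ fun _ : Fin (n + 1) => ℂ).symm
  let ν : Measure (EuclideanSpace ℂ (Fin (n + 1))) := Measure.map e volume
  have hν : ν.IsAddHaarMeasure := e.isAddHaarMeasure_map volume
  have hc := Measure.isAddLeftInvariant_eq_smul (volume : Measure (EuclideanSpace ℂ (Fin (n + 1)))) ν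
  set c := Measure.addHaarScalarFactor (volume : Measure (EuclideanSpace ℂ (Fin (n + 1)))) ν
  have hc0 : (c : ℝ≥0∞) ≠ 0 := by
    have := (Measure.addHaarScalarFactor_pos_of_isAddHaarMeasure (volume : Measure (EuclideanSpace ℂ (Fin (n + 1)))) ν).ne'
    exact_mod_cast this
  -- polar coordinates with the radial weight `exp (-r²)`, which is the product of Gaussian
  -- weights of the entries
  let g : ℝ → ℝ≥0∞ := fun r => ENNReal.ofReal (Real.exp (-r ^ 2))
  have hg : Measurable g := by fun_prop
  have key : ∀ H : EuclideanSpace ℂ (Fin (n + 1)) → ℝ≥0∞, Measurable H → ∫⁻ x : EuclideanSpace ℂ (Fin (n + 1)), g ‖x‖ * H (‖x‖⁻¹ • x) =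
      c * ∫⁻ x : Fin (n + 1) → ℂ, ENNReal.ofReal (rowWeight 0 x) *
        H (‖WithLp.toLp 2 x‖⁻¹ • WithLp.toLp 2 x) := fun H hH => by
    have hHm : Measurable fun x : EuclideanSpace ℂ (Fin (n + 1)) => g ‖x‖ * H (‖x‖⁻¹ • x) :=
      (hg.comp measurable_norm).mul (hH.comp (measurable_norm.inv.smul measurable_id))
    rw [hc, ENNReal.smul_def, lintegral_smul_measure, lintegral_map hHm e.continuous.measurable,
      smul_eq_mul]
    congr 1
    refine lintegral_congr fun x => ?_
    rw [rowWeight_zero]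
    show ENNReal.ofReal (Real.exp (-‖(WithLp.toLp 2 x : EuclideanSpace ℂ (Fin (n + 1)))‖ ^ 2)) * _ = _
    rw [← sumNormSq_eq_norm_sq]
    rfl
  -- the radial integral `A` need not be computed: the case `f = 1` relates it to the total mass
  -- of the sphere, and the factor `c / A` cancels
  set A := ∫⁻ r, g r.1 ∂(Measure.volumeIoiPow (Module.finrank ℝ (EuclideanSpace ℂ (Fin (n + 1))) - 1)) with hA
  have hone : (volume : Measure (EuclideanSpace ℂ (Fin (n + 1)))).toSphere Set.univ * A = c * ENNReal.ofReal (Real.pi ^ (n + 1)) := by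
    have h1 := key (fun _ => 1) measurable_const
    rw [lintegral_norm_mul_direction _ hg measurable_const] at h1
    simp only [mul_one, lintegral_one, lintegral_rowWeight_zero] at h1
    exact h1
  have hF1 := key F hF
  rw [lintegral_norm_mul_direction _ hg hF, lintegral_rowWeight_mul_direction hF] at hF1
  simp_rw [hFf] at hF1
  have hper : Function.Periodic (fun θ => ∫⁻ u : Fin n → ℂ,
      ENNReal.ofReal (n.factorial / 2 * (sumNormSq (affineVec u) ^ (n + 1))⁻¹) *
        f (sphereChart θ u)) (2 * Real.pi) := fun θ => by
    refine lintegral_congr fun u => ?_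
    have := sphereChart_periodic u θ
    simp only at this
    rw [this]
  rw [setLIntegral_Ioo_eq_setLIntegral_Ico hper] at hF1
  have hπ : (0 : ℝ) < Real.pi ^ (n + 1) := by positivity
  have hR0 : c * ENNReal.ofReal (Real.pi ^ (n + 1)) ≠ 0 :=
    mul_ne_zero hc0 (ENNReal.ofReal_pos.2 hπ).ne'
  have hRt : c * ENNReal.ofReal (Real.pi ^ (n + 1)) ≠ ∞ :=
    ENNReal.mul_ne_top ENNReal.coe_ne_top ENNReal.ofReal_ne_top
  have hA0 : A ≠ 0 := fun h => hR0 (by rw [← hone, h, mul_zero])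
  have hσ0 : (volume : Measure (EuclideanSpace ℂ (Fin (n + 1)))).toSphere Set.univ ≠ 0 := fun h =>
    hR0 (by rw [← hone, h, zero_mul])
  have hσt : (volume : Measure (EuclideanSpace ℂ (Fin (n + 1)))).toSphere Set.univ ≠ ∞ := measure_ne_top _ _
  have hAt : A ≠ ∞ := fun h => hRt (by rw [← hone, h, ENNReal.mul_top hσ0])
  have e1 : (∫⁻ v, f v ∂(volume : Measure (EuclideanSpace ℂ (Fin (n + 1)))).toSphere) =
      c * (∫⁻ θ in Set.Ico 0 (2 * Real.pi), ∫⁻ u : Fin n → ℂ,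
      ENNReal.ofReal (n.factorial / 2 * (sumNormSq (affineVec u) ^ (n + 1))⁻¹) *
        f (sphereChart θ u)) / A := by
    rw [← hF1, ENNReal.mul_div_cancel_right hA0 hAt]
  have e2 : (volume : Measure (EuclideanSpace ℂ (Fin (n + 1)))).toSphere Set.univ = c * ENNReal.ofReal (Real.pi ^ (n + 1)) / A := by
    rw [← hone, ENNReal.mul_div_cancel_right hA0 hAt]
  have e3 : ∀ θ, ∫⁻ u : Fin n → ℂ,
      ENNReal.ofReal (n.factorial * (Real.pi ^ n)⁻¹ * (sumNormSq (affineVec u) ^ (n + 1))⁻¹) *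
        f (sphereChart θ u) = ENNReal.ofReal (2 * (Real.pi ^ n)⁻¹) * ∫⁻ u : Fin n → ℂ,
      ENNReal.ofReal (n.factorial / 2 * (sumNormSq (affineVec u) ^ (n + 1))⁻¹) *
        f (sphereChart θ u) := fun θ => by
    rw [← lintegral_const_mul' _ _ ENNReal.ofReal_ne_top]
    refine lintegral_congr fun u => ?_
    rw [← mul_assoc, ← ENNReal.ofReal_mul (by positivity)]
    congr 2
    ring
  rw [sphereMeasure, lintegral_smul_measure, smul_eq_mul]
  simp_rw [e3]
  rw [lintegral_const_mul' _ _ ENNReal.ofReal_ne_top, uniformPhase, lintegral_smul_measure,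
    smul_eq_mul, e1, e2]
  have hk : ∀ x : ℝ≥0∞, c * x / A = c / A * x := fun x => ENNReal.mul_div_right_comm
  have hk0 : (c : ℝ≥0∞) / A ≠ 0 := ENNReal.div_ne_zero.2 ⟨hc0, hAt⟩
  have hkt : (c : ℝ≥0∞) / A ≠ ∞ := ENNReal.div_ne_top ENNReal.coe_ne_top hA0
  rw [hk, hk, ENNReal.mul_inv (Or.inl hk0) (Or.inl hkt), mul_mul_mul_comm,
    ENNReal.inv_mul_cancel hk0 hkt, one_mul, ← mul_assoc, ← ENNReal.ofReal_inv_of_pos hπ,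
    ← ENNReal.ofReal_inv_of_pos Real.two_pi_pos, ← ENNReal.ofReal_mul (by positivity)]
  congr 2
  field_simp
  ring

end Sphere

/-! ### Measurability of the density -/

section Measurability

theorem measurable_upperGamma (s : ℝ) : Measurable (upperGamma s) := by
  have hm : Measurable fun p : ℝ × ℝ =>
      {p : ℝ × ℝ | p.1 < p.2}.indicator (fun p => p.2 ^ (s - 1) * Real.exp (-p.2)) p :=
    Measurable.indicator (by fun_prop) (measurableSet_lt measurable_fst measurable_snd)
  have e : upperGamma s = fun a => ∫ t,
      {p : ℝ × ℝ | p.1 < p.2}.indicator (fun p => p.2 ^ (s - 1) * Real.exp (-p.2)) (a, t) := by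
    funext a
    rw [upperGamma, ← integral_indicator measurableSet_Ioi]
    rfl
  rw [e]
  exact (StronglyMeasurable.integral_prod_right hm.stronglyMeasurable).measurable

theorem continuous_D {N : ℕ} (τ : ℝ) : Continuous (D τ : CSphere N → ℝ) := by
  unfold D
  fun_prop

theorem measurable_density {N : ℕ} (τ : ℝ) :
    Measurable fun p : ℂ × CSphere N => density N τ p.1 p.2 := by
  have h1 : Measurable fun p : ℂ × CSphere N => D τ p.2 :=
    (continuous_D τ).measurable.comp measurable_snd
  have h2 : ∀ s, Measurable fun p : ℂ × CSphere N => upperGamma s (‖p.1‖ ^ 2) := fun s =>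
    (measurable_upperGamma s).comp (by fun_prop)
  have h3 := h2 N
  have h4 := h2 (N - 1)
  have h5 : Measurable fun p : ℂ × CSphere N => (p.1 ^ 2 + starRingEnd ℂ p.1 ^ 2).re := by
    fun_prop
  unfold density
  fun_prop

end Measurability

/-! ### Eigenpairs as solutions of the eigenvalue equation -/

section Eigenpairs

variable {n : ℕ} {τ : ℝ}

/-- The matrix with first column `g` and remaining columns `B`. -/
def joinColumns (g : Fin (n + 1) → ℂ) (B : Fin (n + 1) → Fin n → ℂ) :
    Fin (n + 1) → Fin (n + 1) → ℂ := fun r => Fin.cons (g r) (B r)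

/-- The eigenvalue equation for `(z, (1, u))`, with `x = (z, u)`, solved for the first column. -/
def columnMap (B : Fin (n + 1) → Fin n → ℂ) (x : Fin (n + 1) → ℂ) : Fin (n + 1) → ℂ :=
  firstColumn (x 0) (Fin.tail x) B

/-- The complex derivative of `columnMap`. -/
def columnMapDeriv (B : Fin (n + 1) → Fin n → ℂ) (x : Fin (n + 1) → ℂ) :
    (Fin (n + 1) → ℂ) →L[ℂ] (Fin (n + 1) → ℂ) :=
  LinearMap.toContinuousLinearMap (Matrix.toLin' (jacobianMatrix (x 0) (Fin.tail x) B))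

theorem hasFDerivAt_columnMap (B : Fin (n + 1) → Fin n → ℂ) (x : Fin (n + 1) → ℂ) :
    HasFDerivAt (columnMap B) ((columnMapDeriv B x).restrictScalars ℝ) x := by
  refine HasFDerivAt.restrictScalars ℝ ?_
  rw [hasFDerivAt_pi']
  intro r
  have hx : ∀ j, HasFDerivAt (fun x : Fin (n + 1) → ℂ => x j)
      (ContinuousLinearMap.proj (R := ℂ) (φ := fun _ : Fin (n + 1) => ℂ) j) x := fun j =>
    hasFDerivAt_apply j x
  have hsum : HasFDerivAt (fun x : Fin (n + 1) → ℂ => ∑ k, B r k * x (Fin.succ k))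
      (∑ k, B r k • ContinuousLinearMap.proj (R := ℂ) (φ := fun _ : Fin (n + 1) => ℂ)
        (Fin.succ k)) x :=
    HasFDerivAt.fun_sum fun k _ => (hx k.succ).const_mul (B r k)
  refine Fin.cases (fun hsum => ?_) (fun i hsum => ?_) r hsum
  · have e : (fun x => columnMap B x 0) = fun x => x 0 - ∑ k, B 0 k * x (Fin.succ k) := by
      funext x
      simp [columnMap, firstColumn, affineVec, Fin.tail]
    rw [e]
    refine ((hx 0).sub hsum).congr_fderiv (ContinuousLinearMap.ext fun y => ?_)
    simp [columnMapDeriv, Matrix.mulVec, dotProduct, jacobianMatrix, Fin.sum_univ_succ, affineVec,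
      (Fin.succ_ne_zero _).symm]
    ring
  · have e : (fun x => columnMap B x i.succ) =
        fun x => x 0 * x i.succ - ∑ k, B i.succ k * x (Fin.succ k) := by
      funext x
      simp [columnMap, firstColumn, affineVec, Fin.tail]
    rw [e]
    refine (((hx 0).mul (hx i.succ)).sub hsum).congr_fderiv (ContinuousLinearMap.ext fun y => ?_)
    simp [columnMapDeriv, Matrix.mulVec, dotProduct, jacobianMatrix, Fin.sum_univ_succ, affineVec,
      Fin.tail, sub_mul, Finset.sum_sub_distrib]
    ring

theorem abs_det_columnMapDeriv (B : Fin (n + 1) → Fin n → ℂ) (x : Fin (n + 1) → ℂ) :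
    |((columnMapDeriv B x).restrictScalars ℝ).det| =
      ‖(jacobianMatrix (x 0) (Fin.tail x) B).det‖ ^ 2 := by
  rw [← LinearMap.det_toLin', ← abs_det_restrictScalars]
  rfl

theorem continuous_jacobianMatrix :
    Continuous fun p : (Fin (n + 1) → ℂ) × (Fin (n + 1) → Fin n → ℂ) =>
      jacobianMatrix (p.1 0) (Fin.tail p.1) p.2 := by
  refine continuous_matrix fun r j => ?_
  refine Fin.cases ?_ (fun k => ?_) j
  · simp only [jacobianMatrix, Matrix.of_apply, Fin.cons_zero]
    refine Fin.cases ?_ (fun k => ?_) r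
    · simp only [affineVec, Fin.cons_zero]; fun_prop
    · simp only [affineVec, Fin.cons_succ, Fin.tail]; fun_prop
  · simp only [jacobianMatrix, Matrix.of_apply, Fin.cons_succ]
    split_ifs <;> fun_prop

theorem continuous_columnMap :
    Continuous fun p : (Fin (n + 1) → ℂ) × (Fin (n + 1) → Fin n → ℂ) => columnMap p.2 p.1 := by
  refine continuous_pi fun r => ?_
  simp only [columnMap, firstColumn, Fin.tail]
  refine Continuous.sub (Continuous.mul (by fun_prop) ?_) (by fun_prop)
  refine Fin.cases ?_ (fun k => ?_) r
  · simp only [affineVec, Fin.cons_zero]; fun_prop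
  · simp only [affineVec, Fin.cons_succ, Fin.tail]; fun_prop

theorem continuous_joinColumns :
    Continuous fun p : (Fin (n + 1) → ℂ) × (Fin (n + 1) → Fin n → ℂ) => joinColumns p.1 p.2 := by
  refine continuous_pi fun r => continuous_pi fun j => ?_
  refine Fin.cases ?_ (fun k => ?_) j
  · simp only [joinColumns, Fin.cons_zero]; fun_prop
  · simp only [joinColumns, Fin.cons_succ]; fun_prop

theorem measurePreserving_joinColumns :
    MeasurePreserving (fun p : (Fin (n + 1) → ℂ) × (Fin (n + 1) → Fin n → ℂ) =>
      joinColumns p.1 p.2) := by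
  have h1 := (volume_measurePreserving_arrowProdEquivProdArrow ℂ (Fin n → ℂ) (Fin (n + 1))).symm
  have h2 := volume_preserving_pi (ι := Fin (n + 1)) fun _ =>
    (volume_preserving_piFinSuccAbove (fun _ : Fin (n + 1) => ℂ) 0).symm
  have h3 := h2.comp h1
  refine (congrArg (fun f => MeasurePreserving f volume volume) ?_).mpr h3
  funext p r
  simp [joinColumns, MeasurableEquiv.piFinSuccAbove, Fin.insertNthEquiv,
    MeasurableEquiv.arrowProdEquivProdArrow, Equiv.arrowProdEquivProdArrow]

theorem sphereChart_succ_div (θ : ℝ) (u : Fin n → ℂ) (k : Fin n) :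
    (sphereChart θ u).1.ofLp k.succ / (sphereChart θ u).1.ofLp 0 = u k := by
  have h2 : (√(sumNormSq (affineVec u)) : ℂ) ≠ 0 := by
    exact_mod_cast (Real.sqrt_pos.2 (sumNormSq_affineVec_pos u)).ne'
  rw [sphereChart_apply, sphereChart_apply]
  have := Complex.exp_ne_zero (Complex.I * θ)
  rw [show affineVec u k.succ = u k from rfl, show affineVec u 0 = 1 from rfl]
  field_simp

theorem norm_sphereChart_zero (θ : ℝ) (u : Fin n → ℂ) :
    ‖(sphereChart θ u).1.ofLp 0‖ = (√(sumNormSq (affineVec u)))⁻¹ := by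
  rw [sphereChart_apply, norm_mul, norm_div, mul_comm Complex.I, Complex.norm_exp_ofReal_mul_I,
    Complex.norm_real, Real.norm_of_nonneg (Real.sqrt_nonneg _)]
  simp [affineVec]

/-- A unit vector whose first entry does not vanish and has phase `θ` is in the image of the
chart. -/
theorem eq_sphereChart {θ : ℝ} {v : CSphere (n + 1)} (h0 : v.1.ofLp 0 ≠ 0)
    (hθ : v.1.ofLp 0 = (‖v.1.ofLp 0‖ : ℂ) * Complex.exp (Complex.I * θ)) :
    v = sphereChart θ fun k => v.1.ofLp k.succ / v.1.ofLp 0 := by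
  set u : Fin n → ℂ := fun k => v.1.ofLp k.succ / v.1.ofLp 0 with hu
  have hv : v.1.ofLp = v.1.ofLp 0 • affineVec u := eq_smul_affineVec h0
  have hn : ‖v.1.ofLp 0‖ ^ 2 * sumNormSq (affineVec u) = 1 := by
    rw [← sumNormSq_smul, ← hv, sumNormSq_eq_norm_sq, mem_sphere_zero_iff_norm.1 v.2, one_pow]
  have hS := Real.sqrt_pos.2 (sumNormSq_affineVec_pos u)
  have hn' : ‖v.1.ofLp 0‖ = (√(sumNormSq (affineVec u)))⁻¹ := by
    rw [← sq_eq_sq₀ (norm_nonneg _) (by positivity), inv_pow,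
      Real.sq_sqrt (sumNormSq_affineVec_pos u).le]
    exact eq_inv_of_mul_eq_one_left hn
  refine Subtype.ext (PiLp.ext fun i => ?_)
  rw [hv, Pi.smul_apply, sphereChart_apply, hθ, hn', smul_eq_mul]
  push_cast
  ring

theorem columnMap_eq_iff (B : Fin (n + 1) → Fin n → ℂ) (x g : Fin (n + 1) → ℂ) :
    columnMap B x = g ↔ (Matrix.of (joinColumns g B)).mulVec (affineVec (Fin.tail x)) =
      x 0 • affineVec (Fin.tail x) := by
  rw [funext_iff, funext_iff]
  refine forall_congr' fun r => ?_
  simp only [columnMap, firstColumn, Matrix.mulVec, dotProduct, Matrix.of_apply, joinColumns,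
    Fin.sum_univ_succ, affineVec, Fin.cons_zero, Fin.cons_succ, mul_one, Pi.smul_apply, smul_eq_mul]
  constructor <;> intro h <;> linear_combination -h

theorem mem_eigenpairs_of_columnMap_eq {B : Fin (n + 1) → Fin n → ℂ} {x g : Fin (n + 1) → ℂ}
    (h : columnMap B x = g) (θ : ℝ) :
    (x 0, sphereChart θ (Fin.tail x)) ∈ eigenpairs (Matrix.of (joinColumns g B)) θ := by
  refine ⟨?_, ?_⟩
  · have h' := (columnMap_eq_iff B x g).1 h
    show (Matrix.of (joinColumns g B)).mulVec ((Complex.exp (Complex.I * θ) /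
      (√(sumNormSq (affineVec (Fin.tail x))) : ℝ)) • affineVec (Fin.tail x)) =
      x 0 • ((Complex.exp (Complex.I * θ) /
      (√(sumNormSq (affineVec (Fin.tail x))) : ℝ)) • affineVec (Fin.tail x))
    rw [Matrix.mulVec_smul, h', smul_comm]
  · show (sphereChart θ (Fin.tail x)).1.ofLp 0 =
      (‖(sphereChart θ (Fin.tail x)).1.ofLp 0‖ : ℂ) * _
    rw [norm_sphereChart_zero, sphereChart_apply]
    push_cast
    simp only [affineVec, Fin.cons_zero]
    ring

/-- If no eigenvector has vanishing first entry, the eigenpairs are in bijection with the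
solutions `x` of the eigenvalue equation. -/
theorem lintegral_empirical_eq_tsum {g : Fin (n + 1) → ℂ} {B : Fin (n + 1) → Fin n → ℂ}
    (hv : ∀ (z : ℂ) (v : Fin (n + 1) → ℂ), v ≠ 0 →
      (Matrix.of (joinColumns g B)).mulVec v = z • v → v 0 ≠ 0) (θ : ℝ)
    {f : ℂ × CSphere (n + 1) → ℝ≥0∞} (hf : Measurable f) :
    ∫⁻ p, f p ∂(empirical (Matrix.of (joinColumns g B)) θ) =
      ∑' x : {x // columnMap B x = g}, f (x.1 0, sphereChart θ (Fin.tail x.1)) := by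
  rw [empirical, lintegral_sum_measure]
  simp_rw [lintegral_dirac' _ hf]
  let e : {x // columnMap B x = g} → eigenpairs (Matrix.of (joinColumns g B)) θ := fun x =>
    ⟨(x.1 0, sphereChart θ (Fin.tail x.1)), mem_eigenpairs_of_columnMap_eq x.2 θ⟩
  have he : Function.Bijective e := by
    constructor
    · intro x y hxy
      have h1 : x.1 0 = y.1 0 := congrArg (fun p => p.1.1) hxy
      have h2 : sphereChart θ (Fin.tail x.1) = sphereChart θ (Fin.tail y.1) :=
        congrArg (fun p => p.1.2) hxy
      refine Subtype.ext (funext fun i => ?_)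
      refine Fin.cases h1 (fun k => ?_) i
      have h3 := sphereChart_succ_div θ (Fin.tail x.1) k
      rw [h2, sphereChart_succ_div] at h3
      exact h3.symm
    · rintro ⟨⟨z, v⟩, hz, hθ⟩
      have h0 : v.1.ofLp 0 ≠ 0 := hv z _ (ofLp_ne_zero v) hz
      have hch := eq_sphereChart h0 hθ
      set u : Fin n → ℂ := fun k => v.1.ofLp k.succ / v.1.ofLp 0 with hu
      have hvu : v.1.ofLp = v.1.ofLp 0 • affineVec u := eq_smul_affineVec h0
      refine ⟨⟨Fin.cons z u, ?_⟩, ?_⟩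
      · rw [columnMap_eq_iff, Fin.tail_cons, Fin.cons_zero]
        simp only at hz
        rw [hvu, Matrix.mulVec_smul, smul_comm] at hz
        exact smul_right_injective _ h0 hz
      · refine Subtype.ext ?_
        simp only [e, Fin.cons_zero, Fin.tail_cons]
        rw [← hch]
  exact ((Equiv.ofBijective e he).tsum_eq
    (fun p : eigenpairs (Matrix.of (joinColumns g B)) θ => f p.1)).symm

/-- The squared Jacobian integrated over the columns other than the first, in terms of the
density. -/
theorem lintegral_norm_det_mul_rowWeight (h0 : 0 ≤ τ) (h1 : τ < 1) (θ z) (u : Fin n → ℂ) :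
    ∫⁻ B : Fin (n + 1) → Fin n → ℂ, ENNReal.ofReal (‖(jacobianMatrix z u B).det‖ ^ 2) *
      ENNReal.ofReal (∏ r, rowWeight τ (Fin.cons (firstColumn z u B r) (B r))) =
    ENNReal.ofReal (entryMass τ ^ ((n + 1) * (n + 1)) * (n + 1)) *
      (ENNReal.ofReal (n.factorial * (Real.pi ^ n)⁻¹ * (sumNormSq (affineVec u) ^ (n + 1))⁻¹) *
        ENNReal.ofReal (density (n + 1) τ z (sphereChart θ u))) := by
  have hprod : ∀ B : Fin (n + 1) → Fin n → ℂ, 0 ≤ ∏ r, rowWeight τ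
      (Fin.cons (firstColumn z u B r) (B r)) := fun B =>
    Finset.prod_nonneg fun _ _ => rowWeight_nonneg _ _
  have hS := sumNormSq_affineVec_pos u
  have hm := entryMass_pos h0 h1
  simp_rw [mul_comm (ENNReal.ofReal (‖_‖ ^ 2)), ← ENNReal.ofReal_mul (hprod _)]
  rw [lintegral_prod_rowWeight_mul_norm_det h0 h1,
    density_eq_meanJacobian h0 h1 _ _ (sphereChart θ u) (norm_sum_sphereChart_sq θ _),
    ← mul_assoc (entryMass τ ^ _), ENNReal.ofReal_mul (by positivity),
    ENNReal.ofReal_mul (p := n.factorial * _ * _) (by positivity)]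

/-- The expected empirical measure, against the unnormalized density of the random matrix. For
fixed remaining columns the first column is parametrized by the eigenpairs, and the area formula
counts each matrix once for each of its eigenpairs. -/
theorem lintegral_rowWeight_mul_empirical (h0 : 0 ≤ τ) (h1 : τ < 1) (θ : ℝ)
    {f : ℂ × CSphere (n + 1) → ℝ≥0∞} (hf : Measurable f)
    (hv : ∀ᵐ X : Fin (n + 1) → Fin (n + 1) → ℂ, ∀ (z : ℂ) (v : Fin (n + 1) → ℂ), v ≠ 0 →
      (Matrix.of X).mulVec v = z • v → v 0 ≠ 0)
    (hm : AEMeasurable fun X : Fin (n + 1) → Fin (n + 1) → ℂ =>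
      ∫⁻ p, f p ∂(empirical (Matrix.of X) θ)) :
    ∫⁻ X : Fin (n + 1) → Fin (n + 1) → ℂ, ENNReal.ofReal (∏ r, rowWeight τ (X r)) *
      ∫⁻ p, f p ∂(empirical (Matrix.of X) θ) =
    ENNReal.ofReal (entryMass τ ^ ((n + 1) * (n + 1)) * (n + 1)) * ∫⁻ z : ℂ, ∫⁻ u : Fin n → ℂ,
      ENNReal.ofReal (n.factorial * (Real.pi ^ n)⁻¹ * (sumNormSq (affineVec u) ^ (n + 1))⁻¹) *
        (ENNReal.ofReal (density (n + 1) τ z (sphereChart θ u)) * f (z, sphereChart θ u)) := by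
  have hρ : Continuous fun X : Fin (n + 1) → Fin (n + 1) → ℂ => ∏ r, rowWeight τ (X r) :=
    continuous_finsetProd _ fun r _ => (continuous_rowWeight τ).comp (continuous_apply r)
  have hmeas : AEMeasurable fun X : Fin (n + 1) → Fin (n + 1) → ℂ =>
      ENNReal.ofReal (∏ r, rowWeight τ (X r)) * ∫⁻ p, f p ∂(empirical (Matrix.of X) θ) :=
    hρ.measurable.ennreal_ofReal.aemeasurable.mul hm
  have hjm := measurePreserving_joinColumns (n := n)
  -- the integrand after the change of variables in the first column
  set H : (Fin (n + 1) → ℂ) × (Fin (n + 1) → Fin n → ℂ) → ℝ≥0∞ := fun q =>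
    ENNReal.ofReal (∏ r, rowWeight τ (joinColumns (columnMap q.2 q.1) q.2 r)) *
      f (q.1 0, sphereChart θ (Fin.tail q.1)) with hH
  have hcf : Measurable fun x : Fin (n + 1) → ℂ => f (x 0, sphereChart θ (Fin.tail x)) := by
    refine hf.comp (Continuous.measurable ?_)
    refine Continuous.prodMk (by fun_prop) (continuous_sphereChart.comp
      (f := fun x : Fin (n + 1) → ℂ => (θ, Fin.tail x)) ?_)
    simp only [Fin.tail_def]
    fun_prop
  have hHm : Measurable H := by
    refine Measurable.mul (Measurable.ennreal_ofReal (Continuous.measurable ?_))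
      (hcf.comp measurable_fst)
    exact hρ.comp (continuous_joinColumns.comp (continuous_columnMap.prodMk continuous_snd))
  have hJm : Continuous fun q : (Fin (n + 1) → ℂ) × (Fin (n + 1) → Fin n → ℂ) =>
      ‖(jacobianMatrix (q.1 0) (Fin.tail q.1) q.2).det‖ ^ 2 :=
    (continuous_jacobianMatrix.matrix_det.norm).pow 2
  have hW : Continuous fun q : (Fin (n + 1) → ℂ) × (Fin (n + 1) → Fin n → ℂ) =>
      ∏ r, rowWeight τ (Fin.cons (firstColumn (q.1 0) (Fin.tail q.1) q.2 r) (q.2 r)) :=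
    hρ.comp (continuous_joinColumns.comp (continuous_columnMap.prodMk continuous_snd))
  rw [← hjm.map_eq] at hmeas hv
  rw [← hjm.map_eq, lintegral_map' hmeas hjm.measurable.aemeasurable, Measure.volume_eq_prod,
    lintegral_prod_symm (fun a : (Fin (n + 1) → ℂ) × (Fin (n + 1) → Fin n → ℂ) =>
      ENNReal.ofReal (∏ r, rowWeight τ (joinColumns a.1 a.2 r)) *
        ∫⁻ p, f p ∂(empirical (Matrix.of (joinColumns a.1 a.2)) θ))
      (hmeas.comp_measurable hjm.measurable)]
  have hv' := ae_of_ae_map hjm.measurable.aemeasurable hv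
  have hv2 := Measure.ae_ae_of_ae_prod
    (Measure.measurePreserving_swap.quasiMeasurePreserving.ae hv')
  have step1 : ∀ᵐ B : Fin (n + 1) → Fin n → ℂ, ∫⁻ g : Fin (n + 1) → ℂ,
      ENNReal.ofReal (∏ r, rowWeight τ (joinColumns g B r)) *
        ∫⁻ p, f p ∂(empirical (Matrix.of (joinColumns g B)) θ) =
      ∫⁻ x : Fin (n + 1) → ℂ,
        ENNReal.ofReal (‖(jacobianMatrix (x 0) (Fin.tail x) B).det‖ ^ 2) * H (x, B) := by
    filter_upwards [hv2] with B hB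
    have harea := lintegral_tsum_fiber_eq_lintegral_abs_det_fderiv_mul
      (volume : Measure (Fin (n + 1) → ℂ)) (hasFDerivAt_columnMap B) (by
        have : {x | ((columnMapDeriv B x).restrictScalars ℝ).det ≠ 0} =
            {x | ‖(jacobianMatrix (x 0) (Fin.tail x) B).det‖ ^ 2 ≠ 0} := by
          ext x
          rw [Set.mem_ofPred_eq, Set.mem_ofPred_eq, ← abs_det_columnMapDeriv, abs_ne_zero]
        rw [this]
        exact (measurableSet_singleton (0 : ℝ)).compl.preimage
          (hJm.comp (continuous_id.prodMk continuous_const)).measurable)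
      (g := fun x => H (x, B)) (hHm.comp (measurable_id.prodMk measurable_const))
    simp_rw [abs_det_columnMapDeriv] at harea
    rw [← harea]
    refine lintegral_congr_ae ?_
    filter_upwards [hB] with g hg
    simp only [Prod.swap] at hg
    rw [lintegral_empirical_eq_tsum hg θ hf, ← ENNReal.tsum_mul_left]
    refine tsum_congr fun x => ?_
    rw [hH]
    simp only
    rw [x.2]
  rw [lintegral_congr_ae step1, lintegral_lintegral_swap]
  rotate_left
  · refine Measurable.aemeasurable ?_
    have hsw : Measurable fun q : (Fin (n + 1) → Fin n → ℂ) × (Fin (n + 1) → ℂ) => (q.2, q.1) :=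
      measurable_swap
    exact (hJm.measurable.ennreal_ofReal.comp hsw).mul (hHm.comp hsw)
  set K : ℂ × (Fin n → ℂ) → ℝ≥0∞ := fun p =>
    ENNReal.ofReal (n.factorial * (Real.pi ^ n)⁻¹ * (sumNormSq (affineVec p.2) ^ (n + 1))⁻¹) *
      (ENNReal.ofReal (density (n + 1) τ p.1 (sphereChart θ p.2)) * f (p.1, sphereChart θ p.2))
    with hK
  have hKm : Measurable K := by
    have hc : Measurable fun p : ℂ × (Fin n → ℂ) => (p.1, sphereChart θ p.2) :=
      (continuous_fst.prodMk (continuous_sphereChart.comp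
        (f := fun p : ℂ × (Fin n → ℂ) => (θ, p.2)) (by fun_prop))).measurable
    have hs : Measurable fun p : ℂ × (Fin n → ℂ) => sumNormSq (affineVec p.2) :=
      (continuous_sumNormSq.comp (continuous_affineVec.comp continuous_snd)).measurable
    exact (by fun_prop : Measurable fun p : ℂ × (Fin n → ℂ) => ENNReal.ofReal
      (n.factorial * (Real.pi ^ n)⁻¹ * (sumNormSq (affineVec p.2) ^ (n + 1))⁻¹)).mul
      (((measurable_density τ).comp hc).ennreal_ofReal.mul (hf.comp hc))
  have step2 : ∀ x : Fin (n + 1) → ℂ, ∫⁻ B : Fin (n + 1) → Fin n → ℂ,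
      ENNReal.ofReal (‖(jacobianMatrix (x 0) (Fin.tail x) B).det‖ ^ 2) * H (x, B) =
      ENNReal.ofReal (entryMass τ ^ ((n + 1) * (n + 1)) * (n + 1)) * K (x 0, Fin.tail x) :=
    fun x => by
    have hx : Continuous fun B : Fin (n + 1) → Fin n → ℂ => (x, B) := by fun_prop
    rw [hK]
    simp only
    rw [← mul_assoc (ENNReal.ofReal (n.factorial * _ * _)), ← mul_assoc,
      ← lintegral_norm_det_mul_rowWeight h0 h1 θ, ← lintegral_mul_const]
    · refine lintegral_congr fun B => ?_
      rw [mul_assoc]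
      rfl
    · have h1 := (hJm.comp hx).measurable.ennreal_ofReal
      have h2 := (hW.comp hx).measurable.ennreal_ofReal
      simp only [Function.comp_def] at h1 h2
      exact h1.mul h2
  simp_rw [step2]
  rw [lintegral_const_mul' _ _ ENNReal.ofReal_ne_top]
  congr 1
  have := (volume_preserving_piFinSuccAbove (fun _ : Fin (n + 1) => ℂ) 0).lintegral_comp hKm
  rw [Measure.volume_eq_prod, lintegral_prod _ hKm.aemeasurable] at this
  rw [← this]
  refine lintegral_congr fun x => congrArg K ?_
  simp [MeasurableEquiv.piFinSuccAbove, Fin.insertNthEquiv]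

end Eigenpairs

/-! ### Generic matrices -/

section Generic

open Polynomial

variable {n : ℕ}

/-- The matrix whose rows are the first rows of the powers `M ^ 0, …, M ^ n`. -/
def krylov {R : Type*} [CommRing R] (M : Matrix (Fin (n + 1)) (Fin (n + 1)) R) :
    Matrix (Fin (n + 1)) (Fin (n + 1)) R :=
  Matrix.of fun k j => (M ^ (k : ℕ)) 0 j

/-- The Hankel matrix of the power sums of the eigenvalues of `M`; its determinant is the
discriminant of the characteristic polynomial. -/
def powerSumHankel {R : Type*} [CommRing R] (M : Matrix (Fin (n + 1)) (Fin (n + 1)) R) :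
    Matrix (Fin (n + 1)) (Fin (n + 1)) R :=
  Matrix.of fun i j => Matrix.trace (M ^ ((i : ℕ) + j))

/-- A matrix with simple spectrum for which the first unit row vector is cyclic. The latter
determines eigenvectors from their eigenvalue and their first entry, which cannot vanish. -/
def IsGeneric (M : Matrix (Fin (n + 1)) (Fin (n + 1)) ℂ) : Prop :=
  (krylov M).det ≠ 0 ∧ (powerSumHankel M).det ≠ 0

/-- The powers of `M` act on an eigenvector by powers of the eigenvalue. -/
theorem krylov_mulVec {M : Matrix (Fin (n + 1)) (Fin (n + 1)) ℂ} {v : Fin (n + 1) → ℂ} {z : ℂ}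
    (h : M.mulVec v = z • v) : (krylov M).mulVec v = v 0 • fun k : Fin (n + 1) => z ^ (k : ℕ) := by
  have hpow : ∀ k : ℕ, (M ^ k).mulVec v = z ^ k • v := fun k => by
    induction k with
    | zero => simp
    | succ k ih => rw [pow_succ, ← Matrix.mulVec_mulVec, h, Matrix.mulVec_smul, ih, smul_smul,
        pow_succ, mul_comm]
  funext k
  have := congrFun (hpow k) 0
  simp only [Matrix.mulVec, dotProduct, krylov, Matrix.of_apply, Pi.smul_apply, smul_eq_mul] at *
  rw [this, mul_comm]

/-- If the multiplicity of a multiple root is lowered by one, the resulting polynomial `p` has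
`p(M)` nilpotent. All `M ^ i p(M)` then have trace zero, so the coefficients of `p` lie in the
kernel of the Hankel matrix. -/
theorem nodup_roots_charpoly {M : Matrix (Fin (n + 1)) (Fin (n + 1)) ℂ}
    (h : (powerSumHankel M).det ≠ 0) : M.charpoly.roots.Nodup := by
  rw [Multiset.nodup_iff_count_le_one]
  intro z
  by_contra hz
  rw [not_le, count_roots] at hz
  have hne : M.charpoly ≠ 0 := M.charpoly_monic.ne_zero
  obtain ⟨s, hs⟩ := (le_rootMultiplicity_iff hne).1 (Nat.succ_le_of_lt hz)
  -- `p` is the characteristic polynomial with one multiple root reduced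
  set p : ℂ[X] := (X - C z) * s with hp
  have hcp : M.charpoly = (X - C z) * p := by rw [hs, hp]; ring
  have hpm : p.Monic := (monic_X_sub_C z).of_mul_monic_left (hcp ▸ M.charpoly_monic)
  have hpd : p.natDegree = n := by
    have h1 := M.charpoly_natDegree_eq_dim
    rw [hcp, (monic_X_sub_C z).natDegree_mul hpm, natDegree_X_sub_C, Fintype.card_fin] at h1
    omega
  have hsum : aeval M p = ∑ j : Fin (n + 1), p.coeff j • M ^ (j : ℕ) := by
    rw [aeval_eq_sum_range' (n := n + 1) (by omega), Finset.sum_range]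
  refine h (Matrix.exists_mulVec_eq_zero_iff.1 ⟨fun j => p.coeff j, fun h0 => ?_, ?_⟩)
  · have := congrFun h0 (Fin.last n)
    simp only [Fin.val_last, Pi.zero_apply] at this
    rw [← hpd, hpm.coeff_natDegree] at this
    exact one_ne_zero this
  · funext i
    have hnil : IsNilpotent (M ^ (i : ℕ) * aeval M p) := by
      refine ⟨2, ?_⟩
      have : M ^ (i : ℕ) * aeval M p = aeval M (X ^ (i : ℕ) * p) := by simp
      rw [this, ← map_pow, show (X ^ (i : ℕ) * p) ^ 2 = X ^ (2 * (i : ℕ)) * s * M.charpoly by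
        rw [hcp, mul_pow, ← pow_mul, hp]; ring, map_mul, Matrix.aeval_self_charpoly, mul_zero]
    have htr := (Matrix.isNilpotent_trace_of_isNilpotent hnil).eq_zero
    rw [hsum, Finset.mul_sum, Matrix.trace_sum] at htr
    simp only [Matrix.mulVec, dotProduct, powerSumHankel, Matrix.of_apply, Pi.zero_apply]
    rw [← htr]
    refine Finset.sum_congr rfl fun j _ => ?_
    rw [Matrix.mul_smul, Matrix.trace_smul, ← pow_add, smul_eq_mul, mul_comm]

theorem continuous_det_krylov :
    Continuous fun M : Matrix (Fin (n + 1)) (Fin (n + 1)) ℂ => (krylov M).det := by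
  refine Continuous.matrix_det (continuous_matrix fun k j => ?_)
  exact (continuous_id.pow (k : ℕ)).matrix_elem 0 j

theorem continuous_det_powerSumHankel :
    Continuous fun M : Matrix (Fin (n + 1)) (Fin (n + 1)) ℂ => (powerSumHankel M).det := by
  refine Continuous.matrix_det (continuous_matrix fun i j => ?_)
  exact (continuous_id.pow ((i : ℕ) + j)).matrix_trace

theorem map_krylov {R S : Type*} [CommRing R] [CommRing S] (f : R →+* S)
    (M : Matrix (Fin (n + 1)) (Fin (n + 1)) R) :
    krylov (f.mapMatrix M) = f.mapMatrix (krylov M) := by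
  ext k j
  rw [krylov, Matrix.of_apply, ← map_pow]
  rfl

theorem map_powerSumHankel {R S : Type*} [CommRing R] [CommRing S] (f : R →+* S)
    (M : Matrix (Fin (n + 1)) (Fin (n + 1)) R) :
    powerSumHankel (f.mapMatrix M) = f.mapMatrix (powerSumHankel M) := by
  ext i j
  rw [powerSumHankel, Matrix.of_apply, ← map_pow]
  simp [powerSumHankel, Matrix.trace]

theorem evalRingHom_mapMatrix_line (X₀ Y : Matrix (Fin (n + 1)) (Fin (n + 1)) ℂ) (t : ℂ) :
    (evalRingHom t).mapMatrix ((X : ℂ[X]) • C.mapMatrix X₀ + C.mapMatrix Y) = t • X₀ + Y := by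
  ext i j
  simp
  ring

theorem det_krylov_smul (c : ℂ) (M : Matrix (Fin (n + 1)) (Fin (n + 1)) ℂ) :
    (krylov (c • M)).det = (∏ k : Fin (n + 1), c ^ (k : ℕ)) * (krylov M).det := by
  rw [← Matrix.det_mul_column]
  congr 1
  ext k j
  simp [krylov, _root_.smul_pow]

theorem det_powerSumHankel_smul (c : ℂ) (M : Matrix (Fin (n + 1)) (Fin (n + 1)) ℂ) :
    (powerSumHankel (c • M)).det = (∏ k : Fin (n + 1), c ^ (k : ℕ)) *
      ((∏ k : Fin (n + 1), c ^ (k : ℕ)) * (powerSumHankel M).det) := by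
  rw [← Matrix.det_mul_row, ← Matrix.det_mul_column]
  congr 1
  ext i j
  simp only [powerSumHankel, _root_.smul_pow, Matrix.of_apply, pow_add, Matrix.smul_mul,
    Matrix.mul_smul, Matrix.trace_smul, smul_eq_mul]
  ring

/-- A homogeneous polynomial condition on matrices which holds at one point `Y` holds almost
everywhere on a vector space of matrices containing `Y`, because on a line in the direction of
`Y` it fails at finitely many points. -/
theorem ae_ne_zero_of_line {E : Type*} [NormedAddCommGroup E] [NormedSpace ℝ E]
    [MeasurableSpace E] [BorelSpace E] [FiniteDimensional ℝ E] (μ : Measure E) [μ.IsAddHaarMeasure]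
    {q : Matrix (Fin (n + 1)) (Fin (n + 1)) ℂ → ℂ} (hq : Continuous q)
    (hpoly : ∀ X₀ Y, ∃ P : ℂ[X], ∀ t, P.eval t = q (t • X₀ + Y))
    (hhom : ∀ c : ℂ, c ≠ 0 → ∀ M, q (c • M) = 0 → q M = 0)
    {A : E → Matrix (Fin (n + 1)) (Fin (n + 1)) ℂ} (hA : Continuous A) (e₀ : E)
    {Y : Matrix (Fin (n + 1)) (Fin (n + 1)) ℂ}
    (hline : ∀ e (t : ℝ), A (e + t • e₀) = A e + (t : ℂ) • Y) (hY : q Y ≠ 0) :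
    ∀ᵐ e ∂μ, q (A e) ≠ 0 := by
  refine ae_mem_of_ae_add_linearMap_mem (LinearMap.toSpanSingleton ℝ E e₀) volume μ
    (s := {e | q (A e) ≠ 0}) ?_ fun e => ?_
  · exact ((measurableSet_singleton (0 : ℂ)).compl).preimage (hq.comp hA).measurable
  · obtain ⟨P, hP⟩ := hpoly (A e) Y
    have hP0 : P ≠ 0 := fun h => hY (by simpa [h] using (hP 0).symm)
    have hfin : {t : ℝ | P.IsRoot (t : ℂ)⁻¹}.Finite := by
      refine Set.Finite.preimage (f := fun t : ℝ => (t : ℂ)⁻¹) (fun a _ b _ hab => ?_)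
        (finite_setOfPred_isRoot hP0)
      simpa using hab
    filter_upwards [compl_mem_ae_iff.2 ((hfin.insert 0).measure_zero volume)] with t ht h
    rw [Set.mem_compl_iff, Set.mem_insert_iff, not_or] at ht
    have ht0 : (t : ℂ) ≠ 0 := by exact_mod_cast ht.1
    refine ht.2 ?_
    rw [LinearMap.toSpanSingleton_apply, hline] at h
    rw [Set.mem_ofPred_eq, IsRoot.def, hP]
    -- `X + t Y` is `t` times `t⁻¹ X + Y`, and `s ↦ q (s X + Y)` is a polynomial which is nonzero
    -- at `s = 0`
    refine hhom t ht0 _ ?_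
    rw [smul_add, smul_smul, mul_inv_cancel₀ ht0, one_smul]
    exact h

/-- A family of matrices which can be translated in the direction of every real matrix is generic
almost everywhere. The nilpotent shift matrix has Krylov matrix `1`, and a diagonal matrix with
distinct entries has the square of a Vandermonde determinant as its discriminant. -/
theorem ae_isGeneric {E : Type*} [NormedAddCommGroup E] [NormedSpace ℝ E]
    [MeasurableSpace E] [BorelSpace E] [FiniteDimensional ℝ E] (μ : Measure E) [μ.IsAddHaarMeasure]
    {A : E → Matrix (Fin (n + 1)) (Fin (n + 1)) ℂ} (hA : Continuous A)
    (hline : ∀ Y : Matrix (Fin (n + 1)) (Fin (n + 1)) ℝ, ∃ e₀ : E, ∀ e (t : ℝ),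
      A (e + t • e₀) = A e + (t : ℂ) • Y.map Complex.ofReal) :
    ∀ᵐ e ∂μ, IsGeneric (A e) := by
  have hprod : ∀ c : ℂ, c ≠ 0 → ∏ k : Fin (n + 1), c ^ (k : ℕ) ≠ 0 := fun c hc =>
    Finset.prod_ne_zero_iff.2 fun k _ => pow_ne_zero _ hc
  -- the shift matrix
  have h1 : ∀ᵐ e ∂μ, (krylov (A e)).det ≠ 0 := by
    obtain ⟨e₀, he₀⟩ := hline (Matrix.of fun i j => if (j : ℕ) = i + 1 then 1 else 0)
    refine ae_ne_zero_of_line μ continuous_det_krylov (fun X₀ Y => ?_) (fun c hc M hM => ?_) hA e₀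
      he₀ ?_
    · refine ⟨(krylov ((X : ℂ[X]) • C.mapMatrix X₀ + C.mapMatrix Y)).det, fun t => ?_⟩
      rw [← coe_evalRingHom, RingHom.map_det, ← map_krylov, evalRingHom_mapMatrix_line]
    · rw [det_krylov_smul] at hM
      exact (mul_eq_zero.1 hM).resolve_left (hprod c hc)
    · set S : Matrix (Fin (n + 1)) (Fin (n + 1)) ℂ :=
        (Matrix.of fun i j : Fin (n + 1) => if (j : ℕ) = i + 1 then (1 : ℝ) else 0).map
          Complex.ofReal with hS
      have hSij : ∀ i j, S i j = if (j : ℕ) = i + 1 then 1 else 0 := fun i j => by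
        simp only [hS, Matrix.map_apply, Matrix.of_apply]
        split_ifs <;> simp
      have hrow : ∀ k : ℕ, k ≤ n → ∀ j : Fin (n + 1), (S ^ k) 0 j = if (j : ℕ) = k then 1 else 0 := by
        intro k
        induction k with
        | zero =>
          intro _ j
          rw [pow_zero, Matrix.one_apply]
          simp only [Fin.ext_iff, Fin.val_zero, eq_comm]
        | succ k ih =>
          intro hk j
          rw [pow_succ, Matrix.mul_apply, Finset.sum_eq_single (⟨k, by omega⟩ : Fin (n + 1))]
          · rw [ih (by omega), hSij]; simp
          · intro i _ hi
            rw [ih (by omega), if_neg (fun h => hi (Fin.ext h)), zero_mul]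
          · simp
      have : krylov S = 1 := by
        ext k j
        rw [krylov, Matrix.of_apply, hrow k (by omega), Matrix.one_apply]
        simp [Fin.ext_iff, eq_comm]
      rw [this, Matrix.det_one]
      exact one_ne_zero
  -- a diagonal matrix with distinct entries
  have h2 : ∀ᵐ e ∂μ, (powerSumHankel (A e)).det ≠ 0 := by
    obtain ⟨e₀, he₀⟩ := hline (Matrix.diagonal fun i => ((i : ℕ) : ℝ))
    refine ae_ne_zero_of_line μ continuous_det_powerSumHankel (fun X₀ Y => ?_)
      (fun c hc M hM => ?_) hA e₀ he₀ ?_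
    · refine ⟨(powerSumHankel ((X : ℂ[X]) • C.mapMatrix X₀ + C.mapMatrix Y)).det, fun t => ?_⟩
      rw [← coe_evalRingHom, RingHom.map_det, ← map_powerSumHankel, evalRingHom_mapMatrix_line]
    · rw [det_powerSumHankel_smul] at hM
      exact (mul_eq_zero.1 ((mul_eq_zero.1 hM).resolve_left (hprod c hc))).resolve_left (hprod c hc)
    · have : powerSumHankel ((Matrix.diagonal fun i : Fin (n + 1) => ((i : ℕ) : ℝ)).map
          Complex.ofReal) = (Matrix.vandermonde fun i : Fin (n + 1) => ((i : ℕ) : ℂ)).transpose *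
            Matrix.vandermonde fun i : Fin (n + 1) => ((i : ℕ) : ℂ) := by
        rw [Matrix.diagonal_map Complex.ofReal_zero]
        ext i j
        simp [powerSumHankel, Matrix.diagonal_pow, Matrix.mul_apply, Matrix.vandermonde_apply,
          pow_add]
      rw [this, Matrix.det_mul, Matrix.det_transpose]
      have hv : (Matrix.vandermonde fun i : Fin (n + 1) => ((i : ℕ) : ℂ)).det ≠ 0 :=
        Matrix.det_vandermonde_ne_zero_iff.2 fun i j hij => Fin.ext (by exact_mod_cast hij)
      exact mul_ne_zero hv hv
  filter_upwards [h1, h2] with e he1 he2 using ⟨he1, he2⟩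

end Generic

/-! ### Continuity and measurability of the empirical measure -/

section Enumeration

open Filter Topology
open scoped BoundedContinuousFunction NNReal

variable {n : ℕ}

theorem IsGeneric.apply_zero_ne_zero {M : Matrix (Fin (n + 1)) (Fin (n + 1)) ℂ} (hM : IsGeneric M)
    {z : ℂ} {v : Fin (n + 1) → ℂ} (hv : v ≠ 0) (h : M.mulVec v = z • v) : v 0 ≠ 0 := fun h0 => by
  have h1 := krylov_mulVec h
  rw [h0, zero_smul] at h1
  exact hM.1 (Matrix.exists_mulVec_eq_zero_iff.1 ⟨v, hv, h1⟩)

/-- Invertibility of the Krylov matrix makes eigenspaces one-dimensional. -/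
theorem IsGeneric.eq_of_mem_eigenpairs {M : Matrix (Fin (n + 1)) (Fin (n + 1)) ℂ}
    (hM : IsGeneric M) {θ : ℝ} {z : ℂ} {v v' : CSphere (n + 1)} (h : (z, v) ∈ eigenpairs M θ)
    (h' : (z, v') ∈ eigenpairs M θ) : v = v' := by
  have h0 := hM.apply_zero_ne_zero (ofLp_ne_zero v) h.1
  have h0' := hM.apply_zero_ne_zero (ofLp_ne_zero v') h'.1
  have hk : (krylov M).mulVec ((v.1.ofLp 0)⁻¹ • v.1.ofLp) =
      (krylov M).mulVec ((v'.1.ofLp 0)⁻¹ • v'.1.ofLp) := by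
    rw [Matrix.mulVec_smul, Matrix.mulVec_smul, krylov_mulVec h.1, krylov_mulVec h'.1, smul_smul,
      smul_smul, inv_mul_cancel₀ h0, inv_mul_cancel₀ h0']
  have hinj := Matrix.mulVec_injective_of_isUnit
    ((Matrix.isUnit_iff_isUnit_det _).2 (isUnit_iff_ne_zero.2 hM.1)) hk
  rw [eq_sphereChart h0 h.2, eq_sphereChart h0' h'.2]
  congr 1
  funext k
  have := congrFun hinj k.succ
  simp only [Pi.smul_apply, smul_eq_mul] at this
  rw [div_eq_inv_mul, div_eq_inv_mul, this]

/-- A list of eigenpairs with phase `θ` whose eigenvalues are listed with their multiplicity. -/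
def IsEnumeration (M : Matrix (Fin (n + 1)) (Fin (n + 1)) ℂ) (θ : ℝ)
    (p : Fin (n + 1) → ℂ × CSphere (n + 1)) : Prop :=
  (∀ t : ℂ, (Matrix.scalar _ t - M).det = ∏ a, (t - (p a).1)) ∧ ∀ a, p a ∈ eigenpairs M θ

theorem det_scalar_sub_eq_zero_of_mem_eigenpairs {M : Matrix (Fin (n + 1)) (Fin (n + 1)) ℂ}
    {θ : ℝ} {p : ℂ × CSphere (n + 1)} (h : p ∈ eigenpairs M θ) :
    (Matrix.scalar _ p.1 - M).det = 0 := by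
  refine Matrix.exists_mulVec_eq_zero_iff.1 ⟨p.2.1.ofLp, ofLp_ne_zero _, ?_⟩
  rw [Matrix.sub_mulVec, h.1, Matrix.scalar_apply, sub_eq_zero]
  funext i
  rw [Matrix.mulVec_diagonal, Pi.smul_apply, smul_eq_mul]

theorem IsGeneric.exists_isEnumeration {M : Matrix (Fin (n + 1)) (Fin (n + 1)) ℂ}
    (hM : IsGeneric M) (θ : ℝ) : ∃ p, IsEnumeration M θ p := by
  have hnd := nodup_roots_charpoly hM.2
  have hsplit := IsAlgClosed.splits M.charpoly
  have heval : ∀ t, M.charpoly.eval t = (M.charpoly.roots.map fun z => t - z).prod := fun t => by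
    conv_lhs => rw [hsplit.eq_prod_roots_of_monic M.charpoly_monic]
    rw [Polynomial.eval_multiset_prod, Multiset.map_map]
    simp
  have hcard : M.charpoly.roots.toFinset.card = n + 1 := by
    rw [Multiset.toFinset_card_of_nodup hnd, ← hsplit.natDegree_eq_card_roots,
      M.charpoly_natDegree_eq_dim, Fintype.card_fin]
  let e := (Finset.equivFinOfCardEq hcard).symm
  -- each root has an eigenvector, which can be normalized since its first entry does not vanish
  have hex : ∀ a, ∃ v : CSphere (n + 1), ((e a : ℂ), v) ∈ eigenpairs M θ := fun a => by
    have hroot : M.charpoly.IsRoot (e a : ℂ) := by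
      have := (e a).2
      rw [Multiset.mem_toFinset] at this
      exact Polynomial.isRoot_of_mem_roots this
    rw [Polynomial.IsRoot.def, Matrix.eval_charpoly] at hroot
    obtain ⟨v, hv, hv'⟩ := Matrix.exists_mulVec_eq_zero_iff.2 hroot
    have hMv : M.mulVec v = (e a : ℂ) • v := by
      rw [Matrix.sub_mulVec, sub_eq_zero] at hv'
      rw [← hv']
      funext i
      rw [Matrix.scalar_apply, Matrix.mulVec_diagonal, Pi.smul_apply, smul_eq_mul]
    have h0 := hM.apply_zero_ne_zero hv hMv
    set u : Fin n → ℂ := fun k => v k.succ / v 0 with hu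
    have hvu : v = v 0 • affineVec u := eq_smul_affineVec h0
    have hMu : M.mulVec (affineVec u) = (e a : ℂ) • affineVec u := by
      rw [hvu, Matrix.mulVec_smul, smul_comm] at hMv
      exact smul_right_injective _ h0 hMv
    refine ⟨sphereChart θ u, ?_⟩
    have hcol : M = Matrix.of (joinColumns (fun r => M r 0) fun r k => M r k.succ) := by
      ext r j
      refine Fin.cases ?_ (fun k => ?_) j <;> simp [joinColumns]
    have := mem_eigenpairs_of_columnMap_eq (x := Fin.cons (e a : ℂ) u)
      (((columnMap_eq_iff (fun r k => M r k.succ) _ (fun r => M r 0))).2 (by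
        rw [← hcol, Fin.tail_cons, Fin.cons_zero]; exact hMu)) θ
    rwa [← hcol, Fin.tail_cons, Fin.cons_zero] at this
  choose v hv using hex
  refine ⟨fun a => (e a, v a), fun t => ?_, hv⟩
  rw [← Matrix.eval_charpoly, heval]
  have h1 : (M.charpoly.roots.map fun z => t - z).prod = ∏ z ∈ M.charpoly.roots.toFinset, (t - z) := by
    rw [Finset.prod, Multiset.toFinset_val, hnd.dedup]
  rw [← Finset.prod_coe_sort, ← e.prod_comp] at h1
  exact h1

/-- An enumeration of a generic matrix lists every eigenpair exactly once. -/
theorem IsGeneric.lintegral_empirical {M : Matrix (Fin (n + 1)) (Fin (n + 1)) ℂ}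
    (hM : IsGeneric M) {θ : ℝ} {p : Fin (n + 1) → ℂ × CSphere (n + 1)} (hp : IsEnumeration M θ p)
    {f : ℂ × CSphere (n + 1) → ℝ≥0∞} (hf : Measurable f) :
    ∫⁻ x, f x ∂(empirical M θ) = ∑ a, f (p a) := by
  rw [empirical, lintegral_sum_measure]
  simp_rw [lintegral_dirac' _ hf]
  let e : Fin (n + 1) → eigenpairs M θ := fun a => ⟨p a, hp.2 a⟩
  have hcp : M.charpoly = (Finset.univ.val.map fun a => Polynomial.X - Polynomial.C (p a).1).prod := by
    refine Polynomial.funext fun t => ?_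
    rw [Matrix.eval_charpoly, hp.1 t, ← Finset.prod, Polynomial.eval_prod]
    simp
  have hroots : M.charpoly.roots = Finset.univ.val.map fun a => (p a).1 := by
    rw [hcp, show (Finset.univ.val.map fun a => Polynomial.X - Polynomial.C (p a).1) =
      (Finset.univ.val.map fun a => (p a).1).map fun z => Polynomial.X - Polynomial.C z by
        rw [Multiset.map_map]; rfl, Polynomial.roots_multiset_prod_X_sub_C]
  have hinj : Function.Injective fun a => (p a).1 := by
    have := nodup_roots_charpoly hM.2
    rw [hroots] at this
    intro a b hab
    exact Multiset.inj_on_of_nodup_map this a (Finset.mem_univ_val a) b (Finset.mem_univ_val b) hab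
  have he : Function.Bijective e := by
    constructor
    · intro a b hab
      exact hinj (congrArg (fun q => q.1.1) hab)
    · rintro ⟨⟨z, v⟩, hq⟩
      have h0 := det_scalar_sub_eq_zero_of_mem_eigenpairs hq
      rw [hp.1, Finset.prod_eq_zero_iff] at h0
      obtain ⟨a, -, ha⟩ := h0
      have hz : z = (p a).1 := sub_eq_zero.1 ha
      subst hz
      refine ⟨a, Subtype.ext (Prod.ext rfl ?_)⟩
      exact hM.eq_of_mem_eigenpairs (hp.2 a) hq
  rw [← (Equiv.ofBijective e he).tsum_eq, tsum_fintype]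
  rfl

/-- A bound which is locally uniform in the matrix, so that enumerations of convergent sequences
of matrices have convergent subsequences. -/
theorem norm_le_of_mem_eigenpairs {M : Matrix (Fin (n + 1)) (Fin (n + 1)) ℂ} {θ : ℝ}
    {p : ℂ × CSphere (n + 1)} (h : p ∈ eigenpairs M θ) : ‖p.1‖ ≤ ∑ i, ∑ j, ‖M i j‖ := by
  obtain ⟨i, -, hi⟩ := Finset.exists_max_image Finset.univ (fun i => ‖p.2.1.ofLp i‖)
    Finset.univ_nonempty
  have hpos : 0 < ‖p.2.1.ofLp i‖ := by
    obtain ⟨j, hj⟩ := Function.ne_iff.1 (ofLp_ne_zero p.2)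
    exact (norm_pos_iff.2 hj).trans_le (hi j (Finset.mem_univ j))
  have h1 := congrFun h.1 i
  rw [Pi.smul_apply, smul_eq_mul] at h1
  have h2 : ‖p.1‖ * ‖p.2.1.ofLp i‖ ≤ (∑ j, ‖M i j‖) * ‖p.2.1.ofLp i‖ := by
    rw [← norm_mul, ← h1, Finset.sum_mul]
    refine (norm_sum_le Finset.univ fun j => M i j * p.2.1.ofLp j).trans
      (Finset.sum_le_sum fun j _ => ?_)
    rw [norm_mul]
    exact mul_le_mul_of_nonneg_left (hi j (Finset.mem_univ j)) (norm_nonneg (M i j))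
  refine (le_of_mul_le_mul_right h2 hpos).trans ?_
  exact Finset.single_le_sum (f := fun i => ∑ j, ‖M i j‖)
    (fun i _ => Finset.sum_nonneg fun j _ => norm_nonneg (M i j)) (Finset.mem_univ i)

theorem continuous_ofLp_apply {m : ℕ} (i : Fin m) :
    Continuous fun v : CSphere m => v.1.ofLp i := by
  fun_prop

/-- Limits of enumerations are enumerations, since the factorization of the characteristic
polynomial, the eigenvalue equation and the condition on the phase are closed conditions. -/
theorem IsEnumeration.of_tendsto {M : ℕ → Matrix (Fin (n + 1)) (Fin (n + 1)) ℂ}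
    {M' : Matrix (Fin (n + 1)) (Fin (n + 1)) ℂ} {θ : ℕ → ℝ} {θ' : ℝ}
    {p : ℕ → Fin (n + 1) → ℂ × CSphere (n + 1)} {p' : Fin (n + 1) → ℂ × CSphere (n + 1)}
    (h : ∀ k, IsEnumeration (M k) (θ k) (p k)) (hM : Tendsto M atTop (𝓝 M'))
    (hθ : Tendsto θ atTop (𝓝 θ')) (hp : Tendsto p atTop (𝓝 p')) : IsEnumeration M' θ' p' := by
  have hpa : ∀ a, Tendsto (fun k => p k a) atTop (𝓝 (p' a)) := fun a => tendsto_pi_nhds.1 hp a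
  have hz : ∀ a, Tendsto (fun k => (p k a).1) atTop (𝓝 (p' a).1) := fun a =>
    (continuous_fst.tendsto _).comp (hpa a)
  have hv : ∀ a i, Tendsto (fun k => (p k a).2.1.ofLp i) atTop (𝓝 ((p' a).2.1.ofLp i)) :=
    fun a i => (((continuous_ofLp_apply i).comp continuous_snd).tendsto _).comp (hpa a)
  have hMij : ∀ i j, Tendsto (fun k => M k i j) atTop (𝓝 (M' i j)) := fun i j =>
    tendsto_pi_nhds.1 (tendsto_pi_nhds.1 hM i) j
  refine ⟨fun t => ?_, fun a => ⟨?_, ?_⟩⟩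
  · have h1 : Tendsto (fun k => (Matrix.scalar _ t - M k).det) atTop
        (𝓝 (Matrix.scalar _ t - M').det) :=
      ((continuous_const.sub continuous_id).matrix_det.tendsto M').comp hM
    have h2 : Tendsto (fun k => ∏ a, (t - (p k a).1)) atTop (𝓝 (∏ a, (t - (p' a).1))) :=
      tendsto_finsetProd _ fun a _ => tendsto_const_nhds.sub (hz a)
    refine tendsto_nhds_unique h1 (h2.congr fun k => ((h k).1 t).symm)
  · funext i
    have h1 : Tendsto (fun k => ∑ j, M k i j * (p k a).2.1.ofLp j) atTop
        (𝓝 (∑ j, M' i j * (p' a).2.1.ofLp j)) :=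
      tendsto_finsetSum _ fun j _ => (hMij i j).mul (hv a j)
    have h2 := (hz a).mul (hv a i)
    refine tendsto_nhds_unique h1 (h2.congr fun k => ?_)
    exact (congrFun ((h k).2 a).1 i).symm
  · have h1 : Tendsto (fun k => (‖(p k a).2.1.ofLp 0‖ : ℂ) * Complex.exp (Complex.I * θ k)) atTop
        (𝓝 ((‖(p' a).2.1.ofLp 0‖ : ℂ) * Complex.exp (Complex.I * θ'))) := by
      refine Tendsto.mul ((Complex.continuous_ofReal.tendsto _).comp (hv a 0).norm) ?_
      exact ((by fun_prop : Continuous fun t : ℝ => Complex.exp (Complex.I * t)).tendsto θ').comp hθ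
    exact tendsto_nhds_unique (hv a 0) (h1.congr fun k => ((h k).2 a).2.symm)

/-- The pairs of a generic matrix and a phase. -/
def genericSet (n : ℕ) : Set ((Fin (n + 1) → Fin (n + 1) → ℂ) × ℝ) :=
  {x | IsGeneric (Matrix.of x.1)}

theorem isGeneric_of_genericSet (x : genericSet n) : IsGeneric (Matrix.of x.1.1) := x.2

/-- The empirical measure of a generic matrix depends continuously on the matrix. Enumerations of
eigenpairs lie in a compact set, and limits of enumerations are enumerations. -/
theorem continuous_lintegral_empirical (f : ℂ × CSphere (n + 1) →ᵇ ℝ≥0) :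
    Continuous fun x : genericSet n =>
      ∫⁻ q, f q ∂(empirical (Matrix.of x.1.1) x.1.2) := by
  have hf : Measurable fun q => (f q : ℝ≥0∞) := f.continuous.measurable.coe_nnreal_ennreal
  refine continuous_iff_seqContinuous.2 fun x x' hx => ?_
  -- it suffices to find a further subsequence along which enumerations converge
  refine tendsto_of_subseq_tendsto fun ns hns => ?_
  choose p hp using fun k => (isGeneric_of_genericSet (x (ns k))).exists_isEnumeration (x (ns k)).1.2
  have hx1 : Tendsto (fun k => (x (ns k)).1.1) atTop (𝓝 x'.1.1) :=
    ((continuous_fst.comp continuous_subtype_val).tendsto _).comp (hx.comp hns)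
  have hx2 : Tendsto (fun k => (x (ns k)).1.2) atTop (𝓝 x'.1.2) :=
    ((continuous_snd.comp continuous_subtype_val).tendsto _).comp (hx.comp hns)
  have hnorm : Tendsto (fun k => ∑ i, ∑ j, ‖(x (ns k)).1.1 i j‖) atTop
      (𝓝 (∑ i, ∑ j, ‖x'.1.1 i j‖)) :=
    tendsto_finsetSum _ fun i _ => tendsto_finsetSum _ fun j _ =>
      (tendsto_pi_nhds.1 (tendsto_pi_nhds.1 hx1 i) j).norm
  obtain ⟨R, hR⟩ := hnorm.bddAbove_range
  have hcomp : IsCompact (Set.univ.pi fun _ : Fin (n + 1) =>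
      (Metric.closedBall (0 : ℂ) R) ×ˢ (Set.univ : Set (CSphere (n + 1)))) :=
    isCompact_univ_pi fun _ => (isCompact_closedBall 0 R).prod isCompact_univ
  obtain ⟨p', -, φ, hφ, hlim⟩ := hcomp.tendsto_subseq (x := p) fun k a _ =>
    ⟨mem_closedBall_zero_iff.2 ((norm_le_of_mem_eigenpairs ((hp k).2 a)).trans
      (hR ⟨k, rfl⟩)), trivial⟩
  have hp' : IsEnumeration (Matrix.of x'.1.1) x'.1.2 p' :=
    IsEnumeration.of_tendsto (fun k => hp (φ k)) (hx1.comp hφ.tendsto_atTop)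
      (hx2.comp hφ.tendsto_atTop) hlim
  refine ⟨φ, ?_⟩
  rw [(isGeneric_of_genericSet x').lintegral_empirical hp' hf]
  refine Tendsto.congr (fun k => ((isGeneric_of_genericSet (x (ns (φ k)))).lintegral_empirical (hp (φ k)) hf).symm) ?_
  refine tendsto_finsetSum _ fun a _ => ENNReal.tendsto_coe.2 ?_
  exact (f.continuous.tendsto _).comp (tendsto_pi_nhds.1 hlim a)

theorem measurableSet_isGeneric : MeasurableSet (genericSet n) := by
  have h1 : Continuous fun x : (Fin (n + 1) → Fin (n + 1) → ℂ) × ℝ => Matrix.of x.1 :=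
    continuous_fst
  exact ((measurableSet_singleton (0 : ℂ)).compl.preimage
    (continuous_det_krylov.comp h1).measurable).inter
    ((measurableSet_singleton (0 : ℂ)).compl.preimage
      (continuous_det_powerSumHankel.comp h1).measurable)

theorem IsGeneric.empirical_univ {M : Matrix (Fin (n + 1)) (Fin (n + 1)) ℂ}
    (hM : IsGeneric M) (θ : ℝ) : empirical M θ Set.univ = (n + 1 : ℕ) := by
  obtain ⟨p, hp⟩ := hM.exists_isEnumeration θ
  rw [← lintegral_one, hM.lintegral_empirical hp measurable_const]
  simp

/-- A weakly continuous family of finite measures is measurable, because indicators of closed sets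
are decreasing limits of bounded continuous functions. -/
theorem measurable_of_continuous_lintegral {α Ω : Type*} [TopologicalSpace Ω] [MeasurableSpace Ω]
    [BorelSpace Ω] [HasOuterApproxClosed Ω] [TopologicalSpace α] [MeasurableSpace α]
    [OpensMeasurableSpace α] {m : α → Measure Ω} [∀ a, IsFiniteMeasure (m a)]
    (h : ∀ f : Ω →ᵇ ℝ≥0, Continuous fun a => ∫⁻ q, f q ∂(m a)) : Measurable m := by
  refine Measurable.measure_of_isPiSystem (S := {s | IsClosed s})
    (BorelSpace.measurable_eq.trans borel_eq_generateFrom_isClosed) isPiSystem_isClosed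
    (fun F hF => ?_) ?_
  · have hF' : IsClosed F := hF
    refine measurable_of_tendsto_metrizable (f := fun k a => ∫⁻ q, (hF'.apprSeq k q : ℝ≥0∞) ∂(m a))
      (fun k => (h (hF'.apprSeq k)).measurable) ?_
    rw [tendsto_pi_nhds]
    exact fun a => HasOuterApproxClosed.tendsto_lintegral_apprSeq hF' (m a)
  · have := (h 1).measurable
    simpa using this

theorem measurable_empirical_genericSet :
    Measurable fun x : genericSet n => empirical (Matrix.of x.1.1) x.1.2 := by
  have hfin : ∀ x : genericSet n, IsFiniteMeasure (empirical (Matrix.of x.1.1) x.1.2) := fun x =>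
    ⟨by rw [(isGeneric_of_genericSet x).empirical_univ]; exact ENNReal.natCast_lt_top _⟩
  exact measurable_of_continuous_lintegral continuous_lintegral_empirical

theorem aemeasurable_of_measurable_subtype {α β : Type*} [MeasurableSpace α] [MeasurableSpace β]
    {μ : Measure α} {s : Set α} (hs : MeasurableSet s) (h : ∀ᵐ x ∂μ, x ∈ s) {f : α → β}
    (hf : Measurable fun x : s => f x) : AEMeasurable f μ := by
  have := aemeasurable_restrict_of_measurable_subtype (μ := μ) hs hf
  rwa [Measure.restrict_eq_self_of_ae_mem h] at this

theorem aemeasurable_empirical (μ : Measure ((Fin (n + 1) → Fin (n + 1) → ℂ) × ℝ))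
    (h : ∀ᵐ x ∂μ, x ∈ genericSet n) :
    AEMeasurable (fun x => empirical (Matrix.of x.1) x.2) μ :=
  aemeasurable_of_measurable_subtype measurableSet_isGeneric h measurable_empirical_genericSet

end Enumeration

/-! ### The law of the random matrix -/

section MatrixLaw

/-- Stated separately because instance search does not iterate the product instance. -/
theorem isAddHaarMeasure_volume_pi_pi {E : Type*} [NormedAddCommGroup E] [MeasureSpace E]
    [BorelSpace E] [SecondCountableTopology E] [SigmaFinite (volume : Measure E)]
    [(volume : Measure E).IsAddHaarMeasure] (N : ℕ) :
    (volume : Measure (Fin N → Fin N → E)).IsAddHaarMeasure :=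
  @Measure.pi.isAddHaarMeasure (Fin N) (fun _ => Fin N → E) _ _ (fun _ => volume)
    (fun _ => inferInstance) _ _ (fun _ => inferInstance) fun _ => inferInstance

/-- A product of measures with densities has the product density. -/
theorem pi_withDensity_ofReal {ι α : Type*} [Fintype ι] [MeasurableSpace α] (μ : Measure α)
    [SigmaFinite μ] {f : α → ℝ} (h0 : ∀ x, 0 ≤ f x) (hf : Integrable f μ) :
    (Measure.pi fun _ : ι => μ.withDensity fun x => ENNReal.ofReal (f x)) =
      (Measure.pi fun _ : ι => μ).withDensity fun x => ENNReal.ofReal (∏ i, f (x i)) := by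
  have := isFiniteMeasure_withDensity_ofReal hf.2
  refine Measure.pi_eq fun s hs => ?_
  have hpi : MeasurableSet (Set.univ.pi s) := MeasurableSet.univ_pi hs
  rw [withDensity_apply _ hpi, ← lintegral_indicator hpi]
  have e : ∀ x : ι → α, (Set.univ.pi s).indicator (fun x => ENNReal.ofReal (∏ i, f (x i))) x =
      ENNReal.ofReal (∏ i, (s i).indicator f (x i)) := fun x => by
    by_cases hx : x ∈ Set.univ.pi s
    · rw [Set.indicator_of_mem hx]
      congr 1
      exact Finset.prod_congr rfl fun i _ => (Set.indicator_of_mem (hx i trivial) f).symm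
    · rw [Set.indicator_of_notMem hx]
      rw [Set.mem_univ_pi, not_forall] at hx
      obtain ⟨i, hi⟩ := hx
      rw [Finset.prod_eq_zero (Finset.mem_univ i) (Set.indicator_of_notMem hi f),
        ENNReal.ofReal_zero]
  have hi : ∀ i, Integrable ((s i).indicator f) μ := fun i => hf.indicator (hs i)
  have hnn : ∀ i x, 0 ≤ (s i).indicator f x := fun i x => Set.indicator_nonneg (fun x _ => h0 x) x
  simp_rw [e]
  rw [← ofReal_integral_eq_lintegral_ofReal
    (Integrable.fintype_prod (μ := fun _ => μ) (f := fun i => (s i).indicator f) hi)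
    (ae_of_all _ fun x => Finset.prod_nonneg fun i _ => hnn i _),
    integral_fintype_prod_eq_prod (μ := fun _ => μ) (fun i => (s i).indicator f),
    ENNReal.ofReal_prod_of_nonneg fun i _ => integral_nonneg (hnn i)]
  refine Finset.prod_congr rfl fun i _ => ?_
  rw [withDensity_apply _ (hs i), integral_indicator (hs i),
    ofReal_integral_eq_lintegral_ofReal hf.integrableOn (ae_of_all _ h0)]

theorem realGinibre_absolutelyContinuous (N : ℕ) : realGinibre N ≪ volume := by
  have h1 : (gaussianReal 0 1) = volume.withDensity
      fun x => ENNReal.ofReal (gaussianPDFReal 0 1 x) := gaussianReal_of_var_ne_zero 0 one_ne_zero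
  have h2 := pi_withDensity_ofReal (ι := Fin N) (volume : Measure ℝ)
    (gaussianPDFReal_nonneg 0 1) (integrable_gaussianPDFReal 0 1)
  have h3 := pi_withDensity_ofReal (ι := Fin N) (Measure.pi fun _ : Fin N => (volume : Measure ℝ))
    (f := fun x => ∏ i, gaussianPDFReal 0 1 (x i))
    (fun x => Finset.prod_nonneg fun i _ => gaussianPDFReal_nonneg 0 1 _)
    (Integrable.fintype_prod (μ := fun _ => (volume : Measure ℝ)) fun _ =>
      integrable_gaussianPDFReal 0 1)
  have : realGinibre N = (volume : Measure (Fin N → Fin N → ℝ)).withDensity fun x =>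
      ENNReal.ofReal (∏ i, ∏ j, gaussianPDFReal 0 1 (x i j)) := by
    unfold realGinibre
    simp_rw [h1]
    simp_rw [h2]
    rw [h3]
    rfl
  rw [this]
  exact withDensity_absolutelyContinuous _ _

instance (N : ℕ) : IsProbabilityMeasure (realGinibre N) := by
  unfold realGinibre; infer_instance

variable {n : ℕ} {τ : ℝ}

theorem continuous_interpolating (N : ℕ) (τ : ℝ) : Continuous
    fun ω : (Fin N → Fin N → ℝ) × (Fin N → Fin N → ℝ) => interpolating τ ω.1 ω.2 := by
  refine continuous_matrix fun i j => ?_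
  simp only [interpolating, Matrix.of_apply]
  fun_prop

/-- For every `τ ≥ 0`, also for `τ = 1`, the first matrix alone translates the random matrix in
every real direction. -/
theorem ae_isGeneric_interpolating (h0 : 0 ≤ τ) :
    ∀ᵐ ω ∂((realGinibre (n + 1)).prod (realGinibre (n + 1))),
      IsGeneric (interpolating τ ω.1 ω.2) := by
  have hH := isAddHaarMeasure_volume_pi_pi (E := ℝ) (n + 1)
  have hac := (realGinibre_absolutelyContinuous (n + 1)).prod
    (realGinibre_absolutelyContinuous (n + 1))
  refine hac.ae_le ?_
  have hP : ((volume : Measure (Fin (n + 1) → Fin (n + 1) → ℝ)).prod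
      (volume : Measure (Fin (n + 1) → Fin (n + 1) → ℝ))).IsAddHaarMeasure :=
    Measure.prod.instIsAddHaarMeasure _ _
  refine ae_isGeneric (volume.prod volume) (continuous_interpolating (n + 1) τ) fun Y => ?_
  have ha : √((1 + τ) / 2) ≠ 0 := (Real.sqrt_pos.2 (by positivity)).ne'
  refine ⟨((√((1 + τ) / 2))⁻¹ • fun i j => Y i j, 0), fun e t => ?_⟩
  ext i j
  simp only [interpolating, Matrix.of_apply, Matrix.add_apply, Matrix.smul_apply, Matrix.map_apply,
    Prod.fst_add, Prod.snd_add, Prod.smul_fst, Prod.smul_snd, smul_zero, Pi.add_apply,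
    Pi.smul_apply, Pi.zero_apply, add_zero, smul_eq_mul]
  have ha' : (√((1 + τ) / 2) : ℂ) ≠ 0 := by exact_mod_cast ha
  push_cast
  field_simp
  ring

theorem ae_isGeneric_volume : ∀ᵐ X : Fin (n + 1) → Fin (n + 1) → ℂ, IsGeneric (Matrix.of X) := by
  have hH := isAddHaarMeasure_volume_pi_pi (E := ℂ) (n + 1)
  refine ae_isGeneric volume (A := fun X : Fin (n + 1) → Fin (n + 1) → ℂ => Matrix.of X)
    continuous_id fun Y => ?_
  refine ⟨fun i j => (Y i j : ℂ), fun e t => ?_⟩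
  ext i j
  simp

theorem measurePreserving_withDensity {α β : Type*} [MeasurableSpace α] [MeasurableSpace β]
    {μ : Measure α} {ν : Measure β} {e : α → β} (he : MeasurePreserving e μ ν) {f : β → ℝ≥0∞}
    (hf : Measurable f) :
    MeasurePreserving e (μ.withDensity fun x => f (e x)) (ν.withDensity f) := by
  refine ⟨he.measurable, Measure.ext fun s hs => ?_⟩
  rw [Measure.map_apply he.measurable hs, withDensity_apply _ (he.measurable hs),
    withDensity_apply _ hs, he.setLIntegral_comp_preimage hs hf]

/-- An entry of `interpolating τ G₁ G₂` as a function of the entries of `G₁` and `G₂`. -/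
def entryMap (τ : ℝ) (p : ℝ × ℝ) : ℂ :=
  ((√((1 + τ) / 2) * p.1 : ℝ) : ℂ) + Complex.I * ((√((1 - τ) / 2) * p.2 : ℝ) : ℂ)

/-- The law of an entry of the interpolating ensemble for `τ < 1`, given by its density on `ℂ`. -/
def entryLaw (τ : ℝ) : Measure ℂ :=
  volume.withDensity fun c => ENNReal.ofReal ((entryMass τ)⁻¹ * gaussWeight (1 + τ) (1 - τ) c)

theorem measurePreserving_entryMap (h0 : 0 ≤ τ) (h1 : τ < 1) :
    MeasurePreserving (entryMap τ) ((gaussianReal 0 1).prod (gaussianReal 0 1)) (entryLaw τ) := by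
  have hp : 0 < (1 + τ) / 2 := by linarith
  have hm : 0 < (1 - τ) / 2 := by linarith
  have hscale : ∀ s : ℝ, 0 < s → MeasurePreserving (fun x => √s * x) (gaussianReal 0 1)
      (volume.withDensity fun x => ENNReal.ofReal (gaussianPDFReal 0 s.toNNReal x)) := fun s hs => by
    refine ⟨by fun_prop, ?_⟩
    have hv : NNReal.mk (√s ^ 2) (sq_nonneg _) * 1 = s.toNNReal := by
      rw [mul_one]
      ext
      simp [Real.sq_sqrt hs.le, Real.coe_toNNReal _ hs.le]
    rw [gaussianReal_map_const_mul, mul_zero, hv,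
      gaussianReal_of_var_ne_zero 0 (by simpa using hs)]
    rfl
  have hprod := (hscale _ hp).prod (hscale _ hm)
  rw [prod_withDensity (by fun_prop) (by fun_prop), ← Measure.volume_eq_prod] at hprod
  have hden : ∀ p : ℝ × ℝ, ENNReal.ofReal (gaussianPDFReal 0 ((1 + τ) / 2).toNNReal p.1) *
      ENNReal.ofReal (gaussianPDFReal 0 ((1 - τ) / 2).toNNReal p.2) =
      ENNReal.ofReal ((entryMass τ)⁻¹ *
        gaussWeight (1 + τ) (1 - τ) (Complex.measurableEquivRealProd.symm p)) := fun p => by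
    rw [← ENNReal.ofReal_mul (gaussianPDFReal_nonneg _ _ _)]
    congr 1
    have hπ := Real.pi_pos
    simp only [gaussianPDFReal_def]
    rw [Real.coe_toNNReal _ hp.le,
      Real.coe_toNNReal _ hm.le, gaussWeight, entryMass,
      Real.sqrt_mul (show 0 ≤ 1 + τ by linarith) (1 - τ), show 2 * Real.pi * ((1 + τ) / 2) = Real.pi * (1 + τ) by ring,
      show 2 * Real.pi * ((1 - τ) / 2) = Real.pi * (1 - τ) by ring,
      Real.sqrt_mul hπ.le, Real.sqrt_mul hπ.le, neg_add, Real.exp_add]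
    have h2 : √Real.pi * √Real.pi = Real.pi := Real.mul_self_sqrt hπ.le
    have e1 : -(p.1 - 0) ^ 2 / (2 * ((1 + τ) / 2)) =
        -((Complex.measurableEquivRealProd.symm p).re ^ 2 / (1 + τ)) := by
      rw [Complex.measurableEquivRealProd_symm_apply]
      ring_nf
    have e2 : -(p.2 - 0) ^ 2 / (2 * ((1 - τ) / 2)) =
        -((Complex.measurableEquivRealProd.symm p).im ^ 2 / (1 - τ)) := by
      rw [Complex.measurableEquivRealProd_symm_apply]
      ring_nf
    simp only [e1, e2]
    conv_rhs => rw [← h2]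
    rw [mul_inv, mul_inv, mul_inv, mul_inv, mul_inv]
    ring
  simp_rw [hden] at hprod
  have hvol := measurePreserving_withDensity Complex.volume_preserving_equiv_real_prod.symm
    (f := fun c => ENNReal.ofReal ((entryMass τ)⁻¹ * gaussWeight (1 + τ) (1 - τ) c))
    (((continuous_gaussWeight _ _).measurable.const_mul _).ennreal_ofReal)
  have := hvol.comp hprod
  refine (congrArg (fun f => MeasurePreserving f _ _) ?_).mpr this
  funext p
  apply Complex.ext <;> simp [entryMap, Complex.measurableEquivRealProd_symm_apply]

theorem measurePreserving_pi_prod {ι α β γ : Type*} [Fintype ι] [MeasurableSpace α]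
    [MeasurableSpace β] [MeasurableSpace γ] {μ : Measure α} {ν : Measure β} {ρ : Measure γ}
    [SigmaFinite μ] [SigmaFinite ν] [SigmaFinite ρ] {m : α × β → γ}
    (hm : MeasurePreserving m (μ.prod ν) ρ) :
    MeasurePreserving (fun (p : (ι → α) × (ι → β)) i => m (p.1 i, p.2 i))
      ((Measure.pi fun _ => μ).prod (Measure.pi fun _ => ν)) (Measure.pi fun _ => ρ) :=
  (measurePreserving_pi (fun _ : ι => μ.prod ν) (fun _ => ρ) fun _ => hm).comp
    (measurePreserving_arrowProdEquivProdArrow α β ι (fun _ => μ) fun _ => ν).symm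

theorem integrable_gaussWeight (h0 : 0 ≤ τ) (h1 : τ < 1) :
    Integrable (gaussWeight (1 + τ) (1 - τ)) := by
  -- the integral is nonzero, whereas it would be zero for a nonintegrable function
  by_contra hc
  have h : ∫ c, gaussWeight (1 + τ) (1 - τ) c = entryMass τ := by
    have := integral_gaussWeight (a := 1 + τ) (b := 1 - τ) (by linarith)
    rw [integral_complex_ofReal, Complex.ofReal_inj] at this
    exact this
  rw [integral_undef hc] at h
  exact (entryMass_pos h0 h1).ne h

/-- The matrix entries of the interpolating ensemble have the Gaussian density. -/
theorem measurePreserving_interpolating (h0 : 0 ≤ τ) (h1 : τ < 1) (N : ℕ) :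
    MeasurePreserving (fun ω : (Fin N → Fin N → ℝ) × (Fin N → Fin N → ℝ) =>
        fun i j => interpolating τ ω.1 ω.2 i j)
      ((realGinibre N).prod (realGinibre N))
      ((volume : Measure (Fin N → Fin N → ℂ)).withDensity fun X =>
        ENNReal.ofReal ((entryMass τ ^ (N * N))⁻¹ * ∏ r, rowWeight τ (X r))) := by
  have hm := entryMass_pos h0 h1
  have hnn : ∀ c, 0 ≤ (entryMass τ)⁻¹ * gaussWeight (1 + τ) (1 - τ) c := fun c =>
    mul_nonneg (inv_nonneg.2 hm.le) (Real.exp_nonneg _)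
  have hint : Integrable fun c => (entryMass τ)⁻¹ * gaussWeight (1 + τ) (1 - τ) c :=
    (integrable_gaussWeight h0 h1).const_mul _
  have hfin : IsFiniteMeasure (entryLaw τ) := isFiniteMeasure_withDensity_ofReal hint.2
  have hmp := measurePreserving_pi_prod (ι := Fin N)
    (measurePreserving_pi_prod (ι := Fin N) (measurePreserving_entryMap h0 h1))
  have h2 := pi_withDensity_ofReal (ι := Fin N) (volume : Measure ℂ) hnn hint
  have h3 := pi_withDensity_ofReal (ι := Fin N) (Measure.pi fun _ : Fin N => (volume : Measure ℂ))
    (f := fun x => ∏ i, (entryMass τ)⁻¹ * gaussWeight (1 + τ) (1 - τ) (x i))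
    (fun x => Finset.prod_nonneg fun i _ => hnn _)
    (Integrable.fintype_prod (μ := fun _ => (volume : Measure ℂ)) fun _ => hint)
  have hlaw : (Measure.pi fun _ : Fin N => Measure.pi fun _ : Fin N => entryLaw τ) =
      (volume : Measure (Fin N → Fin N → ℂ)).withDensity fun X =>
        ENNReal.ofReal ((entryMass τ ^ (N * N))⁻¹ * ∏ r, rowWeight τ (X r)) := by
    unfold entryLaw
    rw [h2, h3]
    congr 1
    funext X
    congr 1
    simp only [Finset.prod_mul_distrib, rowWeight, Finset.prod_const, Finset.card_univ,
      Fintype.card_fin]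
    rw [← pow_mul, inv_pow]
  rw [hlaw] at hmp
  exact hmp

end MatrixLaw

/-! ### The law of the eigenpairs for `τ < 1` -/

section SubcriticalLaw

variable {n : ℕ} {τ : ℝ}

instance : IsProbabilityMeasure uniformPhase := by
  refine ⟨?_⟩
  have h : ENNReal.ofReal (2 * Real.pi) ≠ 0 := by
    rw [Ne, ENNReal.ofReal_eq_zero, not_le]
    positivity
  simp [uniformPhase, -ENNReal.ofReal_mul, ENNReal.inv_mul_cancel h ENNReal.ofReal_ne_top]

instance (N : ℕ) : IsFiniteMeasure (sphereMeasure N) := by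
  refine ⟨lt_of_le_of_lt ?_ ENNReal.one_lt_top⟩
  simp only [sphereMeasure, Measure.smul_apply, smul_eq_mul]
  exact ENNReal.inv_mul_le_one _

theorem ae_interpolating_mem_genericSet (h0 : 0 ≤ τ) :
    ∀ᵐ ω ∂(((realGinibre (n + 1)).prod (realGinibre (n + 1))).prod uniformPhase),
      ((fun i j => interpolating τ ω.1.1 ω.1.2 i j, ω.2) :
        (Fin (n + 1) → Fin (n + 1) → ℂ) × ℝ) ∈ genericSet n :=
  Measure.quasiMeasurePreserving_fst.ae (ae_isGeneric_interpolating h0)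

theorem measurable_interpolating_prod (N : ℕ) (τ : ℝ) :
    Measurable fun ω : ((Fin N → Fin N → ℝ) × (Fin N → Fin N → ℝ)) × ℝ =>
      ((fun i j => interpolating τ ω.1.1 ω.1.2 i j, ω.2) : (Fin N → Fin N → ℂ) × ℝ) := by
  have h : Continuous fun ω : (Fin N → Fin N → ℝ) × (Fin N → Fin N → ℝ) =>
      (fun i j => interpolating τ ω.1 ω.2 i j : Fin N → Fin N → ℂ) := continuous_interpolating N τ
  exact ((h.comp continuous_fst).prodMk continuous_snd).measurable

theorem aemeasurable_empirical_interpolating (h0 : 0 ≤ τ) :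
    AEMeasurable (fun ω : ((Fin (n + 1) → Fin (n + 1) → ℝ) × (Fin (n + 1) → Fin (n + 1) → ℝ)) × ℝ =>
      empirical (interpolating τ ω.1.1 ω.1.2) ω.2)
      (((realGinibre (n + 1)).prod (realGinibre (n + 1))).prod uniformPhase) := by
  have hg := measurable_interpolating_prod (n + 1) τ
  exact (aemeasurable_empirical _ ((ae_map_iff hg.aemeasurable measurableSet_isGeneric).2
    (ae_interpolating_mem_genericSet h0))).comp_measurable hg

theorem lintegral_eigenLaw (h0 : 0 ≤ τ) {f : ℂ × CSphere (n + 1) → ℝ≥0∞} (hf : Measurable f) :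
    ∫⁻ p, f p ∂(eigenLaw (n + 1) τ) = ((n + 1 : ℕ) : ℝ≥0∞)⁻¹ *
      ∫⁻ ω, ∫⁻ p, f p ∂(empirical (interpolating τ ω.1.1 ω.1.2) ω.2)
        ∂(((realGinibre (n + 1)).prod (realGinibre (n + 1))).prod uniformPhase) := by
  rw [eigenLaw, lintegral_smul_measure, Measure.lintegral_bind
    (aemeasurable_empirical_interpolating h0) hf.aemeasurable, smul_eq_mul]

theorem aemeasurable_lintegral_empirical {μ : Measure ((Fin (n + 1) → Fin (n + 1) → ℂ) × ℝ)}
    (h : ∀ᵐ x ∂μ, x ∈ genericSet n) {f : ℂ × CSphere (n + 1) → ℝ≥0∞} (hf : Measurable f) :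
    AEMeasurable (fun x => ∫⁻ p, f p ∂(empirical (Matrix.of x.1) x.2)) μ :=
  (Measure.measurable_lintegral hf).comp_aemeasurable (aemeasurable_empirical μ h)

/-- The expectation of a linear statistic of the eigenpairs, for a fixed phase. -/
theorem lintegral_empirical_withDensity (h0 : 0 ≤ τ) (h1 : τ < 1) (θ : ℝ)
    {f : ℂ × CSphere (n + 1) → ℝ≥0∞} (hf : Measurable f) :
    ∫⁻ X : Fin (n + 1) → Fin (n + 1) → ℂ, ∫⁻ p, f p ∂(empirical (Matrix.of X) θ)
      ∂(volume.withDensity fun X =>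
        ENNReal.ofReal ((entryMass τ ^ ((n + 1) * (n + 1)))⁻¹ * ∏ r, rowWeight τ (X r))) =
    ((n + 1 : ℕ) : ℝ≥0∞) * ∫⁻ z : ℂ, ∫⁻ u : Fin n → ℂ,
      ENNReal.ofReal (n.factorial * (Real.pi ^ n)⁻¹ * (sumNormSq (affineVec u) ^ (n + 1))⁻¹) *
        (ENNReal.ofReal (density (n + 1) τ z (sphereChart θ u)) * f (z, sphereChart θ u)) := by
  have hρ : Continuous fun X : Fin (n + 1) → Fin (n + 1) → ℂ => ∏ r, rowWeight τ (X r) :=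
    continuous_finsetProd _ fun r _ => (continuous_rowWeight τ).comp (continuous_apply r)
  have hc := pow_pos (entryMass_pos h0 h1) ((n + 1) * (n + 1))
  have hgen : ∀ᵐ x ∂(Measure.map (fun X : Fin (n + 1) → Fin (n + 1) → ℂ => (X, θ)) volume),
      x ∈ genericSet n :=
    (ae_map_iff measurable_prodMk_right.aemeasurable measurableSet_isGeneric).2 ae_isGeneric_volume
  have hm : AEMeasurable fun X : Fin (n + 1) → Fin (n + 1) → ℂ =>
      ∫⁻ p, f p ∂(empirical (Matrix.of X) θ) :=
    (aemeasurable_lintegral_empirical hgen hf).comp_measurable measurable_prodMk_right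
  have hρm : Measurable fun X : Fin (n + 1) → Fin (n + 1) → ℂ =>
      ENNReal.ofReal ((entryMass τ ^ ((n + 1) * (n + 1)))⁻¹ * ∏ r, rowWeight τ (X r)) :=
    (hρ.measurable.const_mul _).ennreal_ofReal
  rw [lintegral_withDensity_eq_lintegral_mul₀ hρm.aemeasurable hm]
  simp only [Pi.mul_apply, ENNReal.ofReal_mul (inv_nonneg.2 hc.le), mul_assoc (ENNReal.ofReal _)]
  rw [lintegral_const_mul' _ _ ENNReal.ofReal_ne_top, lintegral_rowWeight_mul_empirical h0 h1 θ hf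
    (ae_isGeneric_volume.mono fun X hX z v hv h => hX.apply_zero_ne_zero hv h) hm, ← mul_assoc,
    ← ENNReal.ofReal_mul (inv_nonneg.2 hc.le), inv_mul_cancel_left₀ hc.ne']
  congr 1
  rw [← Nat.cast_succ, ENNReal.ofReal_natCast]

theorem measurePreserving_interpolating_prod (h0 : 0 ≤ τ) (h1 : τ < 1) (N : ℕ) :
    MeasurePreserving (fun ω : ((Fin N → Fin N → ℝ) × (Fin N → Fin N → ℝ)) × ℝ =>
      ((fun i j => interpolating τ ω.1.1 ω.1.2 i j, ω.2) : (Fin N → Fin N → ℂ) × ℝ))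
      (((realGinibre N).prod (realGinibre N)).prod uniformPhase)
      (((volume : Measure (Fin N → Fin N → ℂ)).withDensity fun X =>
        ENNReal.ofReal ((entryMass τ ^ (N * N))⁻¹ * ∏ r, rowWeight τ (X r))).prod uniformPhase) := by
  have h := measurePreserving_interpolating h0 h1 N
  generalize hP : (realGinibre N).prod (realGinibre N) = P at *
  have hs : SFinite P := by
    have := Measure.prod.instIsProbabilityMeasure (realGinibre N) (realGinibre N)
    rw [hP] at this
    infer_instance
  exact h.prod (MeasurePreserving.id uniformPhase)

/-- The law of the eigenpairs for `τ < 1` in the affine chart of the sphere. -/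
theorem lintegral_eigenLaw_eq (h0 : 0 ≤ τ) (h1 : τ < 1) {f : ℂ × CSphere (n + 1) → ℝ≥0∞}
    (hf : Measurable f) :
    ∫⁻ p, f p ∂(eigenLaw (n + 1) τ) = ∫⁻ θ, (∫⁻ z : ℂ, ∫⁻ u : Fin n → ℂ,
      ENNReal.ofReal (n.factorial * (Real.pi ^ n)⁻¹ * (sumNormSq (affineVec u) ^ (n + 1))⁻¹) *
        (ENNReal.ofReal (density (n + 1) τ z (sphereChart θ u)) * f (z, sphereChart θ u)))
          ∂uniformPhase := by
  have hmp := measurePreserving_interpolating_prod h0 h1 (n + 1)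
  have hgen : ∀ᵐ x ∂((volume.withDensity fun X : Fin (n + 1) → Fin (n + 1) → ℂ =>
      ENNReal.ofReal ((entryMass τ ^ ((n + 1) * (n + 1)))⁻¹ * ∏ r, rowWeight τ (X r))).prod
        uniformPhase), x ∈ genericSet n := by
    rw [← hmp.map_eq]
    exact (ae_map_iff hmp.measurable.aemeasurable measurableSet_isGeneric).2
      (ae_interpolating_mem_genericSet h0)
  have hF := aemeasurable_lintegral_empirical hgen hf
  rw [lintegral_eigenLaw h0 hf]
  have e := lintegral_map' (μ := ((realGinibre (n + 1)).prod (realGinibre (n + 1))).prod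
    uniformPhase) (by rw [hmp.map_eq]; exact hF) hmp.measurable.aemeasurable
  rw [hmp.map_eq, lintegral_prod_symm _ hF] at e
  refine (congrArg _ e.symm).trans ?_
  simp only [lintegral_empirical_withDensity h0 h1 _ hf]
  rw [lintegral_const_mul' _ _ (ENNReal.natCast_ne_top _), ← mul_assoc,
    ENNReal.inv_mul_cancel (by simp) (ENNReal.natCast_ne_top _), one_mul]

theorem measurable_chart_integrand {f : ℂ × CSphere (n + 1) → ℝ≥0∞} (hf : Measurable f) :
    Measurable fun q : (ℝ × ℂ) × (Fin n → ℂ) => ENNReal.ofReal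
      (n.factorial * (Real.pi ^ n)⁻¹ * (sumNormSq (affineVec q.2) ^ (n + 1))⁻¹) *
      f (q.1.2, sphereChart q.1.1 q.2) := by
  have hchart : Measurable fun q : (ℝ × ℂ) × (Fin n → ℂ) =>
      ((q.1.2, sphereChart q.1.1 q.2) : ℂ × CSphere (n + 1)) :=
    ((continuous_snd.comp continuous_fst).prodMk (continuous_sphereChart.comp
      (f := fun q : (ℝ × ℂ) × (Fin n → ℂ) => (q.1.1, q.2)) (by fun_prop))).measurable
  have hS : Measurable fun q : (ℝ × ℂ) × (Fin n → ℂ) => ENNReal.ofReal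
      (n.factorial * (Real.pi ^ n)⁻¹ * (sumNormSq (affineVec q.2) ^ (n + 1))⁻¹) :=
    ((((continuous_sumNormSq.comp (continuous_affineVec.comp continuous_snd)).measurable.pow_const
      (n + 1)).inv).const_mul _).ennreal_ofReal
  exact hS.mul (hf.comp hchart)

/-- Integration over `ℂ × CSphere (n + 1)` in the affine chart of the sphere, with the phase as
the outermost variable. -/
theorem lintegral_prod_sphereMeasure {f : ℂ × CSphere (n + 1) → ℝ≥0∞} (hf : Measurable f) :
    ∫⁻ p, f p ∂((volume : Measure ℂ).prod (sphereMeasure (n + 1))) =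
      ∫⁻ θ, (∫⁻ z : ℂ, ∫⁻ u : Fin n → ℂ,
        ENNReal.ofReal (n.factorial * (Real.pi ^ n)⁻¹ * (sumNormSq (affineVec u) ^ (n + 1))⁻¹) *
          f (z, sphereChart θ u)) ∂uniformPhase := by
  rw [lintegral_prod _ hf.aemeasurable]
  have hsph : ∀ z : ℂ, ∫⁻ v, f (z, v) ∂sphereMeasure (n + 1) = ∫⁻ θ, (∫⁻ u : Fin n → ℂ,
      ENNReal.ofReal (n.factorial * (Real.pi ^ n)⁻¹ * (sumNormSq (affineVec u) ^ (n + 1))⁻¹) *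
        f (z, sphereChart θ u)) ∂uniformPhase := fun z =>
    lintegral_sphereMeasure (hf.comp measurable_prodMk_left)
  simp only [hsph]
  have hm := (measurable_chart_integrand hf).lintegral_prod_right'
    (ν := (volume : Measure (Fin n → ℂ)))
  exact (lintegral_lintegral_swap (μ := uniformPhase) (ν := (volume : Measure ℂ))
    (f := fun θ z => ∫⁻ u : Fin n → ℂ, ENNReal.ofReal
      (n.factorial * (Real.pi ^ n)⁻¹ * (sumNormSq (affineVec u) ^ (n + 1))⁻¹) *
        f (z, sphereChart θ u)) hm.aemeasurable).symm

/-- Both measures have the same integrals in the affine chart of the sphere. -/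
theorem eigenLaw_eq_withDensity (h0 : 0 ≤ τ) (h1 : τ < 1) :
    eigenLaw (n + 1) τ = ((volume : Measure ℂ).prod (sphereMeasure (n + 1))).withDensity
      (fun p => ENNReal.ofReal (density (n + 1) τ p.1 p.2)) := by
  refine Measure.ext_of_lintegral _ fun f hf => ?_
  have hd : Measurable fun p : ℂ × CSphere (n + 1) => ENNReal.ofReal (density (n + 1) τ p.1 p.2) :=
    (measurable_density τ).ennreal_ofReal
  rw [lintegral_eigenLaw_eq h0 h1 hf, lintegral_withDensity_eq_lintegral_mul _ hd hf]
  exact (lintegral_prod_sphereMeasure (hd.mul hf)).symm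

end SubcriticalLaw

/-! ### The limit `τ → 1` -/

section CriticalLaw

open Filter Topology
open scoped NNReal BoundedContinuousFunction

variable {n : ℕ} {τ : ℝ}

theorem lintegral_empirical_interpolating_le (h0 : 0 ≤ τ) {f : ℂ × CSphere (n + 1) → ℝ≥0∞}
    {C : ℝ≥0} (hC : ∀ p, f p ≤ C) :
    ∀ᵐ ω ∂(((realGinibre (n + 1)).prod (realGinibre (n + 1))).prod uniformPhase),
      ∫⁻ p, f p ∂(empirical (interpolating τ ω.1.1 ω.1.2) ω.2) ≤ (C : ℝ≥0∞) * (n + 1 : ℕ) := by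
  filter_upwards [ae_interpolating_mem_genericSet h0] with ω hω
  have hg : IsGeneric (interpolating τ ω.1.1 ω.1.2) := hω
  rw [← hg.empirical_univ ω.2, ← lintegral_const]
  exact lintegral_mono hC

theorem isFiniteMeasure_eigenLaw (h0 : 0 ≤ τ) : IsFiniteMeasure (eigenLaw (n + 1) τ) := by
  have hprob : IsProbabilityMeasure ((realGinibre (n + 1)).prod (realGinibre (n + 1))) :=
    Measure.prod.instIsProbabilityMeasure _ _
  have hprob' : IsProbabilityMeasure
      (((realGinibre (n + 1)).prod (realGinibre (n + 1))).prod uniformPhase) :=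
    Measure.prod.instIsProbabilityMeasure _ _
  refine ⟨?_⟩
  rw [← lintegral_one, lintegral_eigenLaw h0 measurable_const]
  refine ENNReal.mul_lt_top (by simp) (lt_of_le_of_lt (lintegral_mono_ae
    (lintegral_empirical_interpolating_le h0 (C := 1) fun _ => le_rfl)) ?_)
  rw [lintegral_const, measure_univ]
  simp

theorem tendsto_lintegral_empirical_subtype {y : ℕ → genericSet n} {x : genericSet n}
    (h : Tendsto y atTop (𝓝 x)) (f : ℂ × CSphere (n + 1) →ᵇ ℝ≥0) :
    Tendsto (fun k => ∫⁻ p, f p ∂(empirical (Matrix.of (y k).1.1) (y k).1.2)) atTop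
      (𝓝 (∫⁻ p, f p ∂(empirical (Matrix.of x.1.1) x.1.2))) :=
  ((continuous_lintegral_empirical f).tendsto x).comp h

theorem tendsto_genericSet_mk {M : ℕ → Fin (n + 1) → Fin (n + 1) → ℂ}
    {M₀ : Fin (n + 1) → Fin (n + 1) → ℂ} {θ : ℝ} (hM : ∀ k, (M k, θ) ∈ genericSet n)
    (hM₀ : (M₀, θ) ∈ genericSet n)
    (hlim : ∀ i j, Tendsto (fun k => M k i j) atTop (𝓝 (M₀ i j))) :
    Tendsto (fun k => (⟨(M k, θ), hM k⟩ : genericSet n)) atTop (𝓝 ⟨(M₀, θ), hM₀⟩) := by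
  rw [tendsto_subtype_rng]
  exact Tendsto.prodMk_nhds (tendsto_pi_nhds.2 fun i => tendsto_pi_nhds.2 fun j => hlim i j)
    tendsto_const_nhds

theorem tendsto_lintegral_empirical {M : ℕ → Fin (n + 1) → Fin (n + 1) → ℂ}
    {M₀ : Fin (n + 1) → Fin (n + 1) → ℂ} {θ : ℝ} (hM : ∀ k, (M k, θ) ∈ genericSet n)
    (hM₀ : (M₀, θ) ∈ genericSet n)
    (hlim : ∀ i j, Tendsto (fun k => M k i j) atTop (𝓝 (M₀ i j)))
    (f : ℂ × CSphere (n + 1) →ᵇ ℝ≥0) :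
    Tendsto (fun k => ∫⁻ p, f p ∂(empirical (Matrix.of (M k)) θ)) atTop
      (𝓝 (∫⁻ p, f p ∂(empirical (Matrix.of M₀) θ))) :=
  tendsto_lintegral_empirical_subtype (tendsto_genericSet_mk hM hM₀ hlim) f

/-- The law of the eigenpairs depends continuously on `τ`, in the weak topology. -/
theorem tendsto_lintegral_eigenLaw {t : ℕ → ℝ} (ht : ∀ k, 0 ≤ t k) (h0 : 0 ≤ τ)
    (hlim : Tendsto t atTop (𝓝 τ)) (f : ℂ × CSphere (n + 1) →ᵇ ℝ≥0) :
    Tendsto (fun k => ∫⁻ p, f p ∂(eigenLaw (n + 1) (t k))) atTop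
      (𝓝 (∫⁻ p, f p ∂(eigenLaw (n + 1) τ))) := by
  have hprob : IsProbabilityMeasure ((realGinibre (n + 1)).prod (realGinibre (n + 1))) :=
    Measure.prod.instIsProbabilityMeasure _ _
  have hprob' : IsProbabilityMeasure
      (((realGinibre (n + 1)).prod (realGinibre (n + 1))).prod uniformPhase) :=
    Measure.prod.instIsProbabilityMeasure _ _
  have hf : Measurable fun q => (f q : ℝ≥0∞) := f.continuous.measurable.coe_nnreal_ennreal
  have hb : ∀ q, (f q : ℝ≥0∞) ≤ (nndist f 0 : ℝ≥0) := fun q =>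
    ENNReal.coe_le_coe.2 (BoundedContinuousFunction.NNReal.upper_bound f q)
  simp only [lintegral_eigenLaw (ht _) hf, lintegral_eigenLaw h0 hf]
  refine ENNReal.Tendsto.const_mul ?_ (Or.inr (by simp))
  refine tendsto_lintegral_of_dominated_convergence'
    (fun _ => ((nndist f 0 : ℝ≥0) : ℝ≥0∞) * (n + 1 : ℕ))
    (fun k => (Measure.measurable_lintegral hf).comp_aemeasurable
      (aemeasurable_empirical_interpolating (ht k)))
    (fun k => lintegral_empirical_interpolating_le (ht k) hb) ?_ ?_
  · rw [lintegral_const, measure_univ, mul_one]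
    exact ENNReal.mul_ne_top ENNReal.coe_ne_top (ENNReal.natCast_ne_top _)
  · filter_upwards [ae_interpolating_mem_genericSet h0,
      ae_all_iff.2 fun k => ae_interpolating_mem_genericSet (ht k)] with ω hω hωk
    refine tendsto_lintegral_empirical (M := fun k i j => interpolating (t k) ω.1.1 ω.1.2 i j)
      hωk hω (fun i j => ?_) f
    have hc : Continuous fun s : ℝ => interpolating s ω.1.1 ω.1.2 i j := by
      simp only [interpolating, Matrix.of_apply]
      fun_prop
    exact (hc.tendsto τ).comp hlim

theorem continuous_upperGamma_natCast_succ (k : ℕ) :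
    Continuous fun z : ℂ => upperGamma ((k : ℝ) + 1) (‖z‖ ^ 2) := by
  have : (fun z : ℂ => upperGamma ((k : ℝ) + 1) (‖z‖ ^ 2)) = fun z : ℂ => k.factorial *
      (Real.exp (-‖z‖ ^ 2) * ∑ j ∈ Finset.range (k + 1), (‖z‖ ^ 2) ^ j / (j.factorial : ℝ)) :=
    funext fun z => by rw [upperGamma_natCast_succ k (by positivity), neg_eq_neg_one_mul]
  rw [this]
  fun_prop

/-- Joint continuity in `τ`, `z` and `v`, away from `τ = 0` and `D = 0`. The dimension is at least
two so that both incomplete Gamma functions have a positive order. -/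
theorem continuousAt_density {m : ℕ} {q : ℝ × ℂ × CSphere (m + 2)} (hq : 0 < q.1)
    (hqD : 0 < D q.1 q.2.2) :
    ContinuousAt (fun q : ℝ × ℂ × CSphere (m + 2) => density (m + 2) q.1 q.2.1 q.2.2) q := by
  have hD : Continuous fun q : ℝ × ℂ × CSphere (m + 2) => D q.1 q.2.2 := by
    unfold D
    fun_prop
  have h1 : Continuous fun q : ℝ × ℂ × CSphere (m + 2) =>
      upperGamma ((m + 2 : ℕ) : ℝ) (‖q.2.1‖ ^ 2) := by
    have e : ((m + 2 : ℕ) : ℝ) = ((m + 1 : ℕ) : ℝ) + 1 := by push_cast; ring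
    rw [e]
    exact (continuous_upperGamma_natCast_succ (m + 1)).comp (by fun_prop)
  have h2 : Continuous fun q : ℝ × ℂ × CSphere (m + 2) =>
      upperGamma (((m + 2 : ℕ) : ℝ) - 1) (‖q.2.1‖ ^ 2) := by
    have e : ((m + 2 : ℕ) : ℝ) - 1 = (m : ℝ) + 1 := by push_cast; ring
    rw [e]
    exact (continuous_upperGamma_natCast_succ m).comp (by fun_prop)
  have hr : ContinuousAt (fun q : ℝ × ℂ × CSphere (m + 2) =>
      1 / D q.1 q.2.2 ^ (((m + 2 : ℕ) : ℝ) / 2)) q :=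
    continuousAt_const.div (hD.continuousAt.rpow_const (Or.inl hqD.ne'))
      (Real.rpow_pos_of_pos hqD _).ne'
  have hD' := hD.continuousAt (x := q)
  have h1' := h1.continuousAt (x := q)
  have h2' := h2.continuousAt (x := q)
  have hi : ContinuousAt (fun q : ℝ × ℂ × CSphere (m + 2) => (D q.1 q.2.2)⁻¹) q := hD'.inv₀ hqD.ne'
  have ht : ContinuousAt (fun q : ℝ × ℂ × CSphere (m + 2) => q.1⁻¹) q :=
    continuous_fst.continuousAt.inv₀ hq.ne'
  unfold density
  simp only [div_eq_mul_inv, mul_inv, ← inv_pow] at hr ⊢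
  fun_prop

theorem D_one_nonneg {N : ℕ} (v : CSphere N) : 0 ≤ D 1 v := by
  simpa using one_sub_sq_le_D 1 v

theorem D_one_le_D {N : ℕ} (h0 : 0 ≤ τ) (h1 : τ ≤ 1) (v : CSphere N) : D 1 v ≤ D τ v := by
  unfold D
  have : τ ^ 2 ≤ 1 ^ 2 := pow_le_pow_left₀ h0 h1 2
  nlinarith [sq_nonneg ‖∑ i, v.1.ofLp i ^ 2‖]

/-- A continuous cutoff, vanishing outside a compact set of pairs `(z, v)` with `Im z ≠ 0` and `D
1 v > 0`. Its supports exhaust all such pairs as `k` grows. -/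
def cutoff (m k : ℕ) (p : ℂ × CSphere m) : ℝ≥0 :=
  Real.toNNReal (min (min |p.1.im| (D 1 p.2)) (k - ‖p.1‖) - 1 / (k + 1))

theorem continuous_cutoff (m k : ℕ) : Continuous (cutoff m k) := by
  have h : Continuous fun p : ℂ × CSphere m => D 1 p.2 := (continuous_D 1).comp continuous_snd
  unfold cutoff
  fun_prop

theorem cutoff_le_one (m k : ℕ) (p : ℂ × CSphere m) : cutoff m k p ≤ 1 := by
  refine Real.toNNReal_le_one.2 ?_
  have h1 : min (min |p.1.im| (D 1 p.2)) (k - ‖p.1‖) ≤ D 1 p.2 :=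
    (min_le_left _ _).trans (min_le_right _ _)
  have h2 : (0 : ℝ) ≤ 1 / (k + 1) := by positivity
  linarith [D_le_one 1 p.2]

theorem cutoff_ne_zero_iff (m k : ℕ) (p : ℂ × CSphere m) : cutoff m k p ≠ 0 ↔
    (1 / (k + 1) < |p.1.im| ∧ 1 / ((k : ℝ) + 1) < D 1 p.2) ∧ 1 / ((k : ℝ) + 1) < k - ‖p.1‖ := by
  rw [cutoff, Ne, Real.toNNReal_eq_zero, not_le, sub_pos, lt_min_iff, lt_min_iff]

/-- The supports of the cutoffs exhaust the open set on which the limiting density is continuous.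
-/
theorem iUnion_cutoff_ne_zero (m : ℕ) :
    ⋃ k, {p | cutoff m k p ≠ 0} = {p | p.1.im ≠ 0 ∧ 0 < D 1 p.2} := by
  ext p
  simp only [Set.mem_iUnion, Set.mem_ofPred_eq, cutoff_ne_zero_iff]
  constructor
  · rintro ⟨k, ⟨h1, h2⟩, -⟩
    have h : (0 : ℝ) < 1 / (k + 1) := by positivity
    exact ⟨abs_pos.1 (h.trans h1), h.trans h2⟩
  · rintro ⟨h1, h2⟩
    obtain ⟨a, ha⟩ := exists_nat_one_div_lt (lt_min (abs_pos.2 h1) h2)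
    obtain ⟨b, hb⟩ := exists_nat_gt (‖p.1‖ + 1)
    rw [lt_min_iff] at ha
    have hle : (1 : ℝ) / ((max a b : ℕ) + 1) ≤ 1 / (a + 1) := by
      gcongr
      exact le_max_left a b
    refine ⟨max a b, ⟨hle.trans_lt ha.1, hle.trans_lt ha.2⟩, ?_⟩
    have h3 : (b : ℝ) ≤ (max a b : ℕ) := by exact_mod_cast le_max_right a b
    have h4 : (1 : ℝ) / ((max a b : ℕ) + 1) ≤ 1 :=
      (div_le_one (by positivity)).2 (by linarith [Nat.cast_nonneg (α := ℝ) (max a b)])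
    linarith

/-- Multiplication of a bounded continuous function by the cutoff. -/
def cutoffMul (m k : ℕ) (f : ℂ × CSphere m →ᵇ ℝ≥0) : ℂ × CSphere m →ᵇ ℝ≥0 :=
  BoundedContinuousFunction.mkOfBound
    ⟨fun p => cutoff m k p * f p, (continuous_cutoff m k).mul f.continuous⟩ (nndist f 0) fun p q => by
      have h : ∀ p, cutoff m k p * f p ≤ nndist f 0 := fun p =>
        (mul_le_of_le_one_left' (cutoff_le_one m k p)).trans
          (BoundedContinuousFunction.NNReal.upper_bound f p)
      have h' : ∀ p, ((cutoff m k p * f p : ℝ≥0) : ℝ) ≤ (nndist f 0 : ℝ≥0) := fun p =>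
        NNReal.coe_le_coe.2 (h p)
      rw [NNReal.dist_eq, abs_sub_le_iff]
      constructor
      · have := h' p
        have := NNReal.coe_nonneg (cutoff m k q * f q)
        simp only [ContinuousMap.coe_mk]
        linarith
      · have := h' q
        have := NNReal.coe_nonneg (cutoff m k p * f p)
        simp only [ContinuousMap.coe_mk]
        linarith

theorem cutoffMul_apply (m k : ℕ) (f : ℂ × CSphere m →ᵇ ℝ≥0) (p : ℂ × CSphere m) :
    cutoffMul m k f p = cutoff m k p * f p := rfl

/-- On the support of a cutoff the densities are bounded uniformly for `1/2 ≤ τ ≤ 1`, by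
compactness. -/
theorem exists_density_le (m k : ℕ) : ∃ C : ℝ, ∀ t : ℝ, 1 / 2 ≤ t → t ≤ 1 →
    ∀ p : ℂ × CSphere (m + 2), cutoff (m + 2) k p ≠ 0 → density (m + 2) t p.1 p.2 ≤ C := by
  have hK : IsCompact ((Set.Icc (1 / 2 : ℝ) 1) ×ˢ
      ((Metric.closedBall (0 : ℂ) k ×ˢ (Set.univ : Set (CSphere (m + 2)))) ∩
        {p | 1 / ((k : ℝ) + 1) ≤ D 1 p.2})) :=
    isCompact_Icc.prod (((isCompact_closedBall _ _).prod isCompact_univ).inter_right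
      (isClosed_le continuous_const ((continuous_D 1).comp continuous_snd)))
  have hpos : (0 : ℝ) < 1 / ((k : ℝ) + 1) := by positivity
  obtain ⟨C, hC⟩ := hK.exists_bound_of_continuousOn (fun q hq => by
    have h1 : (1 / 2 : ℝ) ≤ q.1 := hq.1.1
    have h2 : q.1 ≤ 1 := hq.1.2
    have h3 : 1 / ((k : ℝ) + 1) ≤ D 1 q.2.2 := hq.2.2
    exact (continuousAt_density (by linarith) ((hpos.trans_le h3).trans_le
      (D_one_le_D (by linarith) h2 _))).continuousWithinAt)
  refine ⟨C, fun t h1 h2 p hp => ?_⟩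
  rw [cutoff_ne_zero_iff] at hp
  refine (Real.le_norm_self _).trans (hC (t, p) ⟨⟨h1, h2⟩, ⟨⟨?_, trivial⟩, hp.1.2.le⟩⟩)
  rw [mem_closedBall_zero_iff]
  linarith [hp.2]

theorem tendsto_density {m : ℕ} {t : ℕ → ℝ} (hlim : Tendsto t atTop (𝓝 1))
    {p : ℂ × CSphere (m + 2)} (hp : 0 < D 1 p.2) :
    Tendsto (fun j => density (m + 2) (t j) p.1 p.2) atTop (𝓝 (density (m + 2) 1 p.1 p.2)) := by
  have hc := continuousAt_density (q := ((1 : ℝ), p)) one_pos hp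
  have hin : Tendsto (fun j => ((t j, p) : ℝ × ℂ × CSphere (m + 2))) atTop (𝓝 (1, p)) :=
    Tendsto.prodMk_nhds hlim tendsto_const_nhds
  generalize hF : (fun q : ℝ × ℂ × CSphere (m + 2) => density (m + 2) q.1 q.2.1 q.2.2) = F at hc
  have h := hc.tendsto.comp hin
  rw [← hF] at h
  exact h

/-- Convergence of the densities as `τ → 1`, dominated on the support of the cutoff. -/
theorem tendsto_lintegral_density (m k : ℕ) {t : ℕ → ℝ} (ht : ∀ j, 1 / 2 ≤ t j)
    (ht1 : ∀ j, t j ≤ 1) (hlim : Tendsto t atTop (𝓝 1)) (f : ℂ × CSphere (m + 2) →ᵇ ℝ≥0) :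
    Tendsto (fun j => ∫⁻ p, ENNReal.ofReal (density (m + 2) (t j) p.1 p.2) *
        cutoffMul (m + 2) k f p ∂((volume : Measure ℂ).prod (sphereMeasure (m + 2)))) atTop
      (𝓝 (∫⁻ p, ENNReal.ofReal (density (m + 2) 1 p.1 p.2) *
        cutoffMul (m + 2) k f p ∂((volume : Measure ℂ).prod (sphereMeasure (m + 2))))) := by
  obtain ⟨C, hC⟩ := exists_density_le m k
  set g := cutoffMul (m + 2) k f with hg
  have hgm : Measurable fun p => (g p : ℝ≥0∞) := g.continuous.measurable.coe_nnreal_ennreal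
  have hg0 : ∀ p, cutoff (m + 2) k p = 0 → g p = 0 := fun p hp => by
    rw [hg, cutoffMul_apply, hp, zero_mul]
  refine tendsto_lintegral_of_dominated_convergence
    ((Metric.closedBall (0 : ℂ) k ×ˢ (Set.univ : Set (CSphere (m + 2)))).indicator fun _ =>
      ENNReal.ofReal C * (nndist g 0 : ℝ≥0))
    (fun j => (measurable_density (t j)).ennreal_ofReal.mul hgm)
    (fun j => ae_of_all _ fun p => ?_) ?_ (ae_of_all _ fun p => ?_)
  · by_cases hp : cutoff (m + 2) k p = 0
    · simp [hg0 p hp]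
    · have hp' := (cutoff_ne_zero_iff _ _ _).1 hp
      have hpos : (0 : ℝ) < 1 / ((k : ℝ) + 1) := by positivity
      rw [Set.indicator_of_mem]
      · exact mul_le_mul' (ENNReal.ofReal_le_ofReal (hC _ (ht j) (ht1 j) p hp))
          (ENNReal.coe_le_coe.2 (BoundedContinuousFunction.NNReal.upper_bound g p))
      · refine ⟨?_, trivial⟩
        rw [mem_closedBall_zero_iff]
        linarith [hp'.2]
  · rw [lintegral_indicator_const (Metric.isClosed_closedBall.measurableSet.prod
      MeasurableSet.univ), Measure.prod_prod]
    exact ENNReal.mul_ne_top (ENNReal.mul_ne_top ENNReal.ofReal_ne_top ENNReal.coe_ne_top)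
      (ENNReal.mul_ne_top (isCompact_closedBall _ _).measure_lt_top.ne (measure_ne_top _ _))
  · by_cases hp : cutoff (m + 2) k p = 0
    · simp [hg0 p hp]
    · have hp' := (cutoff_ne_zero_iff _ _ _).1 hp
      have hpos : (0 : ℝ) < 1 / ((k : ℝ) + 1) := by positivity
      exact ENNReal.Tendsto.mul_const (ENNReal.tendsto_ofReal (tendsto_density hlim
        (hpos.trans hp'.1.2))) (Or.inr ENNReal.coe_ne_top)

end CriticalLaw

/-! ### The law off the real axis for `τ = 1` -/

section CriticalRestriction

open Filter Topology
open scoped NNReal BoundedContinuousFunction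

/-- The formula for `τ < 1`, tested against functions supported where the densities are locally
bounded, passes to the limit `τ → 1`. -/
theorem lintegral_cutoffMul_eigenLaw_one (m k : ℕ) (f : ℂ × CSphere (m + 2) →ᵇ ℝ≥0) :
    ∫⁻ p, cutoffMul (m + 2) k f p ∂(eigenLaw (m + 2) 1) =
      ∫⁻ p, ENNReal.ofReal (density (m + 2) 1 p.1 p.2) *
        cutoffMul (m + 2) k f p ∂((volume : Measure ℂ).prod (sphereMeasure (m + 2))) := by
  -- a sequence in `[1/2, 1)` tending to one
  set t : ℕ → ℝ := fun j => 1 - 1 / (j + 2) with ht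
  have hj : ∀ j : ℕ, 0 < 1 / ((j : ℝ) + 2) ∧ 1 / ((j : ℝ) + 2) ≤ 1 / 2 := fun j =>
    ⟨by positivity, by gcongr; linarith [Nat.cast_nonneg (α := ℝ) j]⟩
  have hlim : Tendsto t atTop (𝓝 1) := by
    have h : Tendsto (fun j : ℕ => 1 / ((j : ℝ) + 2)) atTop (𝓝 0) := by
      refine Tendsto.div_atTop tendsto_const_nhds ?_
      exact tendsto_natCast_atTop_atTop.atTop_add tendsto_const_nhds
    simpa [ht] using h.const_sub 1
  have h0 : ∀ j, 1 / 2 ≤ t j := fun j => by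
    have := (hj j).2
    simp only [ht]
    linarith
  have h1 : ∀ j, t j < 1 := fun j => by
    have := (hj j).1
    simp only [ht]
    linarith
  have h0' : ∀ j, 0 ≤ t j := fun j => by linarith [h0 j]
  have hl := tendsto_lintegral_eigenLaw (n := m + 1) h0' zero_le_one hlim (cutoffMul (m + 2) k f)
  have hr := tendsto_lintegral_density m k h0 (fun j => (h1 j).le) hlim f
  refine tendsto_nhds_unique hl (hr.congr fun j => ?_)
  rw [eigenLaw_eq_withDensity (n := m + 1) (h0' j) (h1 j),
    lintegral_withDensity_eq_lintegral_mul _ (measurable_density _).ennreal_ofReal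
      (cutoffMul (m + 2) k f).continuous.measurable.coe_nnreal_ennreal]
  rfl

theorem withDensity_cutoff_eigenLaw_one (m k : ℕ) :
    (eigenLaw (m + 2) 1).withDensity (fun p => cutoff (m + 2) k p) =
      (((volume : Measure ℂ).prod (sphereMeasure (m + 2))).withDensity
        (fun p => ENNReal.ofReal (density (m + 2) 1 p.1 p.2))).withDensity
          (fun p => cutoff (m + 2) k p) := by
  have hw : Measurable fun p => (cutoff (m + 2) k p : ℝ≥0∞) :=
    (continuous_cutoff _ _).measurable.coe_nnreal_ennreal
  have hd : Measurable fun p : ℂ × CSphere (m + 2) =>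
    ENNReal.ofReal (density (m + 2) 1 p.1 p.2) := (measurable_density 1).ennreal_ofReal
  have hfin : IsFiniteMeasure (eigenLaw (m + 2) 1) :=
    isFiniteMeasure_eigenLaw (n := m + 1) zero_le_one
  have hfin' : IsFiniteMeasure
      ((eigenLaw (m + 2) 1).withDensity (fun p => (cutoff (m + 2) k p : ℝ≥0∞))) := by
    refine isFiniteMeasure_withDensity (lt_of_le_of_lt (lintegral_mono (g := fun _ => 1)
      fun p => ?_) ?_).ne
    · exact (ENNReal.coe_le_coe.2 (cutoff_le_one _ k p)).trans_eq ENNReal.coe_one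
    · simp
  refine ext_of_forall_lintegral_eq_of_IsFiniteMeasure fun f => ?_
  have hf : Measurable fun p => (f p : ℝ≥0∞) := f.continuous.measurable.coe_nnreal_ennreal
  rw [lintegral_withDensity_eq_lintegral_mul _ hw hf, lintegral_withDensity_eq_lintegral_mul _ hw hf,
    lintegral_withDensity_eq_lintegral_mul _ hd (hw.mul hf)]
  have h := lintegral_cutoffMul_eigenLaw_one m k f
  simp only [cutoffMul_apply, ENNReal.coe_mul] at h
  exact h

/-- Measures that agree after multiplication by a weight agree where the weight is positive. -/
theorem restrict_eq_of_withDensity_eq {α : Type*} [MeasurableSpace α] {μ ν : Measure α}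
    {w : α → ℝ≥0} (hw : Measurable w)
    (h : μ.withDensity (fun x => (w x : ℝ≥0∞)) = ν.withDensity (fun x => (w x : ℝ≥0∞))) :
    μ.restrict {x | w x ≠ 0} = ν.restrict {x | w x ≠ 0} := by
  have hs : MeasurableSet {x | w x ≠ 0} := (measurableSet_singleton 0).compl.preimage hw
  have key : ∀ ρ : Measure α, ρ.restrict {x | w x ≠ 0} =
      ((ρ.withDensity (fun x => (w x : ℝ≥0∞))).restrict {x | w x ≠ 0}).withDensity
        (fun x => (w x : ℝ≥0∞)⁻¹) := fun ρ => by
    rw [restrict_withDensity hs, withDensity_inv_same hw.coe_nnreal_ennreal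
      ((ae_restrict_mem hs).mono fun x hx => ENNReal.coe_ne_zero.2 hx)
      (ae_of_all _ fun x => ENNReal.coe_ne_top)]
  rw [key μ, key ν, h]

theorem restrict_eigenLaw_one (m : ℕ) :
    (eigenLaw (m + 2) 1).restrict {p | p.1.im ≠ 0 ∧ 0 < D 1 p.2} =
      (((volume : Measure ℂ).prod (sphereMeasure (m + 2))).withDensity
        (fun p => ENNReal.ofReal (density (m + 2) 1 p.1 p.2))).restrict
          {p | p.1.im ≠ 0 ∧ 0 < D 1 p.2} := by
  -- the supports of the cutoffs exhaust the set
  rw [← iUnion_cutoff_ne_zero, Measure.restrict_iUnion_congr]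
  exact fun k => restrict_eq_of_withDensity_eq (continuous_cutoff _ k).measurable
    (withDensity_cutoff_eigenLaw_one m k)

/-- If `|vᵀ v| = 1` then `v` is a multiple of its conjugate, by the equality case of the
Cauchy–Schwarz inequality. -/
theorem conj_eq_of_D_one_eq_zero {N : ℕ} {v : CSphere N} (hD : D 1 v = 0) (i : Fin N) :
    starRingEnd ℂ (v.1.ofLp i) =
      starRingEnd ℂ (∑ j, v.1.ofLp j ^ 2) * v.1.ofLp i := by
  set x := v.1.ofLp with hx
  set s := ∑ i, x i ^ 2 with hs
  have hs1 : ‖s‖ ^ 2 = 1 := by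
    unfold D at hD
    rw [hs, hx]
    linarith
  have hn : ∑ i, ‖x i‖ ^ 2 = 1 := by
    have := v.2
    rw [mem_sphere_zero_iff_norm, EuclideanSpace.norm_eq, Real.sqrt_eq_one] at this
    exact this
  -- expand `∑ |x̄ᵢ - s̄ xᵢ|² = 1 + |s|² - 2 |s|²`
  have hzero : ∑ i, ‖starRingEnd ℂ (x i) - starRingEnd ℂ s * x i‖ ^ 2 = 0 := by
    have e : ∀ i, ((‖starRingEnd ℂ (x i) - starRingEnd ℂ s * x i‖ ^ 2 : ℝ) : ℂ) =
        (‖x i‖ ^ 2 : ℝ) + (‖s‖ ^ 2 : ℝ) * (‖x i‖ ^ 2 : ℝ) - s * starRingEnd ℂ (x i ^ 2) -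
          starRingEnd ℂ s * x i ^ 2 := fun i => by
      push_cast
      simp only [← Complex.mul_conj', map_sub, map_mul, Complex.conj_conj, map_pow]
      ring
    have h2 : ((∑ i, ‖starRingEnd ℂ (x i) - starRingEnd ℂ s * x i‖ ^ 2 : ℝ) : ℂ) = 0 := by
      rw [Complex.ofReal_sum]
      simp only [e, Finset.sum_sub_distrib, Finset.sum_add_distrib, ← Finset.mul_sum]
      rw [← map_sum, ← hs, Complex.mul_conj', mul_comm (starRingEnd ℂ s) s, Complex.mul_conj',
        ← Complex.ofReal_sum, hn, hs1]
      have : ((‖s‖ : ℂ)) ^ 2 = 1 := by exact_mod_cast hs1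
      rw [this]
      simp
    exact_mod_cast h2
  have h := (Finset.sum_eq_zero_iff_of_nonneg fun i _ => sq_nonneg _).1 hzero i
    (Finset.mem_univ i)
  exact sub_eq_zero.1 (norm_eq_zero.1 (pow_eq_zero_iff two_ne_zero |>.1 h))

/-- In the affine chart, vectors with `|vᵀ v| = 1` have real coordinates, and these form a null
set in dimension at least two. -/
theorem sphereMeasure_D_one_eq_zero (m : ℕ) :
    sphereMeasure (m + 2) {v : CSphere (m + 2) | D 1 v = 0} = 0 := by
  have hW : MeasurableSet {v : CSphere (m + 2) | D 1 v = 0} :=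
    (measurableSet_singleton 0).preimage (continuous_D 1).measurable
  have hreal : ∀ (θ : ℝ) (u : Fin (m + 1) → ℂ), D 1 (sphereChart θ u) = 0 → (u 0).im = 0 := by
    intro θ u hD
    rw [← Complex.conj_eq_iff_im, ← sphereChart_succ_div θ u 0, map_div₀,
      conj_eq_of_D_one_eq_zero hD, conj_eq_of_D_one_eq_zero hD, mul_div_mul_left]
    rw [map_ne_zero]
    intro hs
    simp [D, hs] at hD
  have hnull : ∀ᵐ u : Fin (m + 1) → ℂ, (u 0).im ≠ 0 := by
    let L : (Fin (m + 1) → ℂ) →ₗ[ℝ] ℝ := Complex.imLm ∘ₗ LinearMap.proj 0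
    refine measure_eq_zero_iff_ae_notMem.1 (Measure.addHaar_submodule volume (LinearMap.ker L)
      fun h => ?_)
    have hI : (fun _ => Complex.I) ∈ LinearMap.ker L := h ▸ Submodule.mem_top
    simp [L] at hI
  rw [← lintegral_indicator_one hW, lintegral_sphereMeasure (measurable_one.indicator hW)]
  refine (lintegral_congr fun θ => ?_).trans lintegral_zero
  refine (lintegral_congr_ae ?_).trans lintegral_zero
  filter_upwards [hnull] with u hu
  have hmem : sphereChart θ u ∉ {v : CSphere (m + 2) | D 1 v = 0} := fun h => hu (hreal θ u h)
  rw [Set.indicator_of_notMem hmem, mul_zero]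

/-- An eigenvector of a real matrix which is a multiple of its conjugate has a real eigenvalue. -/
theorem im_eq_zero_of_D_one_eq_zero {N : ℕ} [NeZero N] {G : Fin N → Fin N → ℝ}
    {G' : Fin N → Fin N → ℝ} {θ : ℝ} {p : ℂ × CSphere N}
    (hp : p ∈ eigenpairs (interpolating 1 G G') θ) (hD : D 1 p.2 = 0) : p.1.im = 0 := by
  obtain ⟨z, v⟩ := p
  have hX : (interpolating 1 G G').mulVec v.1.ofLp = z • v.1.ofLp := hp.1
  have hconj := conj_eq_of_D_one_eq_zero hD
  have hv0 : v.1.ofLp ≠ 0 := ofLp_ne_zero v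
  simp only at hconj
  have hs0 : starRingEnd ℂ (∑ j, v.1.ofLp j ^ 2) ≠ 0 := fun h => by
    rw [map_eq_zero] at h
    simp [D, h] at hD
  generalize v.1.ofLp = x at *
  generalize starRingEnd ℂ (∑ j, x j ^ 2) = s at *
  obtain ⟨i, hi⟩ := Function.ne_iff.1 hv0
  have hi' : x i ≠ 0 := hi
  have h1 : ∑ j, ((G i j : ℝ) : ℂ) * x j = z * x i := by
    have := congrFun hX i
    simpa [Matrix.mulVec, dotProduct, interpolating] using this
  -- conjugate the eigenvalue equation and divide by the factor of proportionality
  have h2 := congrArg (starRingEnd ℂ) h1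
  simp only [map_sum, map_mul, Complex.conj_ofReal, hconj] at h2
  have h3 : s * (z * x i) = s * (starRingEnd ℂ z * x i) := by
    rw [← h1, Finset.mul_sum]
    refine Eq.trans (Finset.sum_congr rfl fun j _ => by ring) (h2.trans (by ring))
  have h4 := mul_right_cancel₀ hi' (mul_left_cancel₀ hs0 h3)
  exact Complex.conj_eq_iff_im.1 h4.symm

/-- The part of the set `Im z ≠ 0` where `D` vanishes carries no mass: for the law of the
eigenpairs because there the eigenvalue would be real, and for the measure with density because it
is a null set. -/
theorem restrict_im_ne_zero_eigenLaw_one (m : ℕ) :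
    (eigenLaw (m + 2) 1).restrict {p | p.1.im ≠ 0} =
      (((volume : Measure ℂ).prod (sphereMeasure (m + 2))).withDensity
        (fun p => ENNReal.ofReal (density (m + 2) 1 p.1 p.2))).restrict {p | p.1.im ≠ 0} := by
  have hDm : Measurable fun p : ℂ × CSphere (m + 2) => D 1 p.2 :=
    (continuous_D 1).measurable.comp measurable_snd
  have hW : MeasurableSet {p : ℂ × CSphere (m + 2) | p.1.im ≠ 0 ∧ D 1 p.2 = 0} :=
    ((measurableSet_singleton (0 : ℝ)).compl.preimage
      (Complex.measurable_im.comp measurable_fst)).inter ((measurableSet_singleton 0).preimage hDm)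
  have hsplit : {p : ℂ × CSphere (m + 2) | p.1.im ≠ 0} = {p | p.1.im ≠ 0 ∧ 0 < D 1 p.2} ∪
      {p | p.1.im ≠ 0 ∧ D 1 p.2 = 0} := by
    ext p
    simp only [Set.mem_ofPred_eq, Set.mem_union, ← and_or_left]
    exact ⟨fun h => ⟨h, (D_one_nonneg p.2).lt_or_eq.imp_right Eq.symm⟩, And.left⟩
  rw [hsplit, Measure.restrict_union_congr]
  refine ⟨restrict_eigenLaw_one m, ?_⟩
  have h1 : eigenLaw (m + 2) 1 {p : ℂ × CSphere (m + 2) | p.1.im ≠ 0 ∧ D 1 p.2 = 0} = 0 := by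
    rw [← lintegral_indicator_one hW, lintegral_eigenLaw (n := m + 1) zero_le_one
      (measurable_one.indicator hW)]
    refine mul_eq_zero_of_right _ ?_
    refine (lintegral_congr fun ω => ?_).trans lintegral_zero
    rw [lintegral_indicator_one hW, empirical, Measure.sum_apply _ hW, ENNReal.tsum_eq_zero]
    intro p
    rw [Measure.dirac_apply' _ hW]
    refine Set.indicator_of_notMem (fun hp => ?_) _
    exact hp.1 (im_eq_zero_of_D_one_eq_zero p.2 hp.2)
  have h2 : (((volume : Measure ℂ).prod (sphereMeasure (m + 2))).withDensity
      (fun p => ENNReal.ofReal (density (m + 2) 1 p.1 p.2)))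
        {p : ℂ × CSphere (m + 2) | p.1.im ≠ 0 ∧ D 1 p.2 = 0} = 0 := by
    refine withDensity_absolutelyContinuous _ _ (measure_mono_null
      (t := Set.univ ×ˢ {v | D 1 v = 0}) (fun p hp => ⟨trivial, hp.2⟩) ?_)
    rw [Measure.prod_prod, sphereMeasure_D_one_eq_zero, mul_zero]
  rw [Measure.restrict_eq_zero.2 h1, Measure.restrict_eq_zero.2 h2]

end CriticalRestriction

end Ginibre

end

theorem mainTheorem2 (N : ℕ) [NeZero N] :
    (∀ τ : ℝ, 0 ≤ τ → τ < 1 →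
      (∀ (z : ℂ) (v : Ginibre.CSphere N), 0 ≤ Ginibre.density N τ z v) ∧
      Ginibre.eigenLaw N τ =
        ((volume : Measure ℂ).prod (Ginibre.sphereMeasure N)).withDensity
          (fun p => ENNReal.ofReal (Ginibre.density N τ p.1 p.2))) ∧
    (2 ≤ N →
      (∀ (z : ℂ) (v : Ginibre.CSphere N), z.im ≠ 0 → 0 ≤ Ginibre.density N 1 z v) ∧
      (Ginibre.eigenLaw N 1).restrict {p | p.1.im ≠ 0} =
        (((volume : Measure ℂ).prod (Ginibre.sphereMeasure N)).withDensity
          (fun p => ENNReal.ofReal (Ginibre.density N 1 p.1 p.2))).restrict {p | p.1.im ≠ 0}) ∧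
    (∀ a : ℝ, 0 ≤ a →
      Ginibre.upperGamma N a =
        Real.Gamma N * Real.exp (-a) * ∑ n ∈ Finset.range N, a ^ n / (n.factorial : ℝ)) := by
  obtain ⟨n, rfl⟩ := Nat.exists_eq_succ_of_ne_zero (NeZero.ne N)
  refine ⟨fun τ h0 h1 => ⟨Ginibre.density_nonneg h0 (Or.inl h1),
    Ginibre.eigenLaw_eq_withDensity h0 h1⟩, fun h2 => ⟨fun z v _ =>
      Ginibre.density_nonneg zero_le_one (Or.inr ⟨rfl, h2⟩) z v, ?_⟩, fun a ha => ?_⟩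
  · obtain ⟨m, rfl⟩ := Nat.exists_eq_succ_of_ne_zero (by omega : n ≠ 0)
    exact Ginibre.restrict_im_ne_zero_eigenLaw_one m
  · have h := Ginibre.upperGamma_natCast_succ n ha
    rw [Nat.succ_eq_add_one, Nat.cast_succ, h, Real.Gamma_nat_eq_factorial, mul_assoc]
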